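/- Let $n\ge 0$, $\rho=e^{2\pi i/(2n+1)}$, $\alpha_k=\begin{pmatrix}\rho^k&0\\0&\rho^{-k}\end{pmatrix}$, $\beta_k=\begin{pmatrix}0&\rho^{-k}\\ \rho^k&0\end{pmatrix}$, and let $\Gamma_n=\{\alpha_k,\beta_l : k,l\in\mathbb Z\}$, a group of order $4n+2$ acting on $V=\mathbb C^2$, regarded as a real vector space with complex coordinates $z_1,z_2$. Put $A=S(V^*)\rtimes\Gamma_n$ (over $\mathbb R$). For $\gamma\in\Gamma_n$ let $V^\gamma$ be the fixed space, $l(\gamma)$ its real codimension, $N^\gamma$ the image of $1-\gamma$ on $V$, and identify $(V^\gamma)^*$ with the $\gamma$-fixed vectors of $V^*$. For $b\in\bigoplus_\gamma M\otimes\wedge^2V$ (where $M$ is $\mathbb R$ or $V^*$) and $\pi\in\bigoplus_\gamma V^*\otimes\wedge^2V$ put $$\llbracket b,\pi\rrbracket_\gamma(x,y,z)=\sum_{\alpha\beta=\gamma}\Big(b_\alpha(\pi_\beta(x,y),z+{}^\beta z)+b_\alpha(\pi_\beta(y,z),x+{}^\beta x)+b_\alpha(\pi_\beta(z,x),y+{}^\beta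 y)\Big),$$ and for $b_\gamma\in\wedge^2V$ put $\partial^\gamma b_\gamma(x,y,z)=b_\gamma(y,z)(x-{}^\gamma x)-b_\gamma(x,z)(y-{}^\gamma y)+b_\gamma(x,y)(z-{}^\gamma z)$. A linear Poisson structure on $A$ is an element $\pi=(\pi_\gamma)$ of $$(V^*\otimes\wedge^2V)^{\Gamma_n}\oplus\Big(\bigoplus_{l(\gamma)=2}(V^\gamma)^*\otimes\wedge^2N^\gamma\Big)^{\Gamma_n}$$ whose Gerstenhaber bracket $[\pi,\pi]_\gamma=\mathrm{pr}_\gamma\llbracket\pi,\pi\rrbracket_\gamma$ vanishes for all $\gamma$, where $\mathrm{pr}_\gamma$ is the projection of $V^*\otimes\wedge^3V$ onto $(V^\gamma)^*\otimes\wedge^{3-l(\gamma)}V^\gamma\otimes\wedge^{l(\gamma)}N^\gamma$. **Proposition.** Every linear Poisson structure $\pi$ on $S(V^*)\rtimes\Gamma_n$ can be quantized. More precisely, there are $c\in\mathbb C$ and an alternating, $\Gamma_n$-invariant family $B=(B_\gamma)_{\gamma\in\Gamma_n}$, $B_\gamma\in\wedge^2V$, such that: 1. for all $k\in\mathbb Z$,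 $$\pi_{\beta_{2k}}=\big[c(\rho^kz_1+\rho^{-k}z_2)-\bar c(\rho^{-k}\bar z_1+\rho^k\bar z_2)\big]\big(\partial_1\wedge\bar\partial_1-\rho^{-2k}\partial_1\wedge\bar\partial_2-\rho^{2k}\partial_2\wedge\bar\partial_1+\partial_2\wedge\bar\partial_2\big);$$ 2. $B_{\beta_k}=0$ and $$B_{\alpha_{2k}}=(2n+1)(\rho^k-\rho^{-k})\big[-|c|^2\partial_2\wedge\bar\partial_2+|c|^2\partial_1\wedge\bar\partial_1+\bar c^2\partial_1\wedge\partial_2-c^2\bar\partial_1\wedge\bar\partial_2\big]$$ for all $k\in\mathbb Z$; 3. $\llbracket\pi,\pi\rrbracket_\gamma=2\,\partial^\gamma B_\gamma$ for all $\gamma\in\Gamma_n$; 4. for $b=(b_\gamma)_{\gamma\in\Gamma_n}$ with $b_\gamma\in\wedge^2V$, let $H_{\pi,b}$ be the quotient of $(T(V^*)\rtimes\Gamma_n)[[\hbar]]$ by the $\hbar$-adically closed two-sided ideal generated by $$x\otimes y-y\otimes x-\hbar\sum_\gamma\pi_\gamma(x,y)\gamma-\hbar^2\sum_\gamma b_\gamma(x,y)\gamma,\qquad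 x,y\in V^*.$$ Then $H_{\pi,B}$ is a deformation quantization of $A$ along $\pi$: there are an associative unital $\mathbb R[[\hbar]]$-bilinear product $a\star a'=aa'+\hbar m_1(a,a')+\hbar^2m_2(a,a')+\cdots$ on $A[[\hbar]]$, such that the Hochschild class of $m_1$ in $H^2(A,A)$ is the one defined by $\pi$ (via the Koszul complex), and an isomorphism of $\mathbb R[[\hbar]]$-algebras $H_{\pi,B}\cong(A[[\hbar]],\star)$ which modulo $\hbar$ is induced by the canonical map $T(V^*)\rtimes\Gamma_n\to A$. In particular $H_{\pi,B}$ has the PBW property: it is isomorphic to $A[[\hbar]]$ as an $\mathbb R[[\hbar]]$-module, compatibly with the canonical map modulo $\hbar$; 5. the terms at the nontrivial rotations are forced: if $b=(b_\gamma)$, $b_\gamma\in\wedge^2V$, is any family for which $H_{\pi,b}$ has the PBW property, then $b_{\alpha_k}=B_{\alpha_k}$ whenever $(2n+1)\nmid k$; and if $\pi_{\beta_j}\ne0$ for some $j$, then $\llbracket\pi,\pi\rrbracket_{\alpha_k}\ne0$ and $B_{\alpha_k}\neq 0$ whenever $(2n+1)\nmid k$. -/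

import Mathlib

open scoped PowerSeries

namespace DihedralQuant

noncomputable section

/-! ### The group `Γ_n` acting on `V = ℂ²` -/

/-- `V = ℂ²`, used as a four-dimensional real vector space. -/
abbrev V := Fin 2 → ℂ

/-- The real dual space `V*`. -/
abbrev W := Module.Dual ℝ V

/-- `ρ = exp (2 π i / (2 n + 1))`. -/
def rho (n : ℕ) : ℂ := Complex.exp (2 * Real.pi * Complex.I / (2 * n + 1))

lemma rho_ne_zero (n : ℕ) : rho n ≠ 0 := Complex.exp_ne_zero _

lemma rho_pow (n : ℕ) : rho n ^ (2 * n + 1) = 1 := by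
  have h : ((2 * n + 1 : ℕ) : ℂ) ≠ 0 := by exact_mod_cast (by omega : 2 * n + 1 ≠ 0)
  rw [rho, ← Complex.exp_nat_mul]
  rw [show ((2 * n + 1 : ℕ) : ℂ) * (2 * Real.pi * Complex.I / (2 * n + 1)) =
    2 * Real.pi * Complex.I by push_cast at h ⊢; field_simp]
  exact Complex.exp_two_pi_mul_I

/-- The diagonal matrix `diag (ρ^k, ρ^{-k})`. -/
def alphaMat (n : ℕ) (k : ℤ) : Matrix (Fin 2) (Fin 2) ℂ := !![rho n ^ k, 0; 0, rho n ^ (-k)]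

/-- The antidiagonal matrix with entries `ρ^{-k}` (top right) and `ρ^k` (bottom left). -/
def betaMat (n : ℕ) (k : ℤ) : Matrix (Fin 2) (Fin 2) ℂ := !![0, rho n ^ (-k); rho n ^ k, 0]

lemma alpha_mul_alpha (n : ℕ) (k l : ℤ) : alphaMat n k * alphaMat n l = alphaMat n (k + l) := by
  simp only [alphaMat, Matrix.mul_fin_two, neg_add, zpow_add₀ (rho_ne_zero n)]; simp

lemma alpha_mul_beta (n : ℕ) (k l : ℤ) : alphaMat n k * betaMat n l = betaMat n (l - k) := by
  simp only [alphaMat, betaMat, Matrix.mul_fin_two, neg_sub, zpow_sub₀ (rho_ne_zero n), zpow_neg]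
  simp [div_eq_mul_inv, mul_comm]

lemma beta_mul_alpha (n : ℕ) (k l : ℤ) : betaMat n k * alphaMat n l = betaMat n (k + l) := by
  simp only [alphaMat, betaMat, Matrix.mul_fin_two, neg_add, zpow_add₀ (rho_ne_zero n)]; simp

lemma beta_mul_beta (n : ℕ) (k l : ℤ) : betaMat n k * betaMat n l = alphaMat n (l - k) := by
  simp only [alphaMat, betaMat, Matrix.mul_fin_two, neg_sub, zpow_sub₀ (rho_ne_zero n), zpow_neg]
  simp [div_eq_mul_inv, mul_comm]

lemma alpha_zero (n : ℕ) : alphaMat n 0 = 1 := by simp [alphaMat, Matrix.one_fin_two]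

/-- The matrix `α_k` as an invertible matrix. -/
def alphaGL (n : ℕ) (k : ℤ) : GL (Fin 2) ℂ where
  val := alphaMat n k
  inv := alphaMat n (-k)
  val_inv := by rw [alpha_mul_alpha, add_neg_cancel, alpha_zero]
  inv_val := by rw [alpha_mul_alpha, neg_add_cancel, alpha_zero]

/-- The matrix `β_k` as an invertible matrix. -/
def betaGL (n : ℕ) (k : ℤ) : GL (Fin 2) ℂ where
  val := betaMat n k
  inv := betaMat n k
  val_inv := by rw [beta_mul_beta, sub_self, alpha_zero]
  inv_val := by rw [beta_mul_beta, sub_self, alpha_zero]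

/-- The group `Γ_n = {α_k, β_l}`, of order `4 n + 2`. -/
def Gam (n : ℕ) : Subgroup (GL (Fin 2) ℂ) where
  carrier := {g | ∃ k : ℤ, g = alphaGL n k ∨ g = betaGL n k}
  one_mem' := ⟨0, Or.inl (Units.ext (alpha_zero n).symm)⟩
  mul_mem' := by
    rintro _ _ ⟨k, rfl | rfl⟩ ⟨l, rfl | rfl⟩
    · exact ⟨k + l, Or.inl (Units.ext (alpha_mul_alpha n k l))⟩
    · exact ⟨l - k, Or.inr (Units.ext (alpha_mul_beta n k l))⟩
    · exact ⟨k + l, Or.inr (Units.ext (beta_mul_alpha n k l))⟩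
    · exact ⟨l - k, Or.inl (Units.ext (beta_mul_beta n k l))⟩
  inv_mem' := by
    rintro _ ⟨k, rfl | rfl⟩
    · exact ⟨-k, Or.inl (Units.ext rfl)⟩
    · exact ⟨k, Or.inr (Units.ext rfl)⟩

/-- `α_k` as an element of `Γ_n`. -/
def alpha (n : ℕ) (k : ℤ) : Gam n := ⟨alphaGL n k, k, Or.inl rfl⟩

/-- `β_k` as an element of `Γ_n`. -/
def beta (n : ℕ) (k : ℤ) : Gam n := ⟨betaGL n k, k, Or.inr rfl⟩

lemma rho_zpow_emod (n : ℕ) (k : ℤ) : rho n ^ (k % ((2 * n + 1 : ℕ) : ℤ)) = rho n ^ k := by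
  conv_rhs => rw [← Int.emod_add_mul_ediv k ((2 * n + 1 : ℕ) : ℤ), zpow_add₀ (rho_ne_zero n),
    zpow_mul, zpow_natCast, rho_pow, one_zpow, mul_one]

instance (n : ℕ) : Finite (Gam n) := by
  have h : ((fun k : ℤ => alphaGL n k) '' Set.Icc 0 (2 * n + 1) ∪
      (fun k : ℤ => betaGL n k) '' Set.Icc 0 (2 * n + 1)).Finite :=
    ((Set.finite_Icc _ _).image _).union ((Set.finite_Icc _ _).image _)
  refine (h.subset ?_).to_subtype
  rintro _ ⟨k, hk⟩
  have hm : k % ((2 * n + 1 : ℕ) : ℤ) ∈ Set.Icc (0 : ℤ) (2 * n + 1) :=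
    ⟨Int.emod_nonneg _ (by omega),
      by have := Int.emod_lt_of_pos k (b := ((2 * n + 1 : ℕ) : ℤ)) (by omega); omega⟩
  rcases hk with rfl | rfl
  · refine Or.inl ⟨_, hm, Units.ext ?_⟩
    simp only [alphaGL, alphaMat, zpow_neg, rho_zpow_emod]
  · refine Or.inr ⟨_, hm, Units.ext ?_⟩
    simp only [betaGL, betaMat, zpow_neg, rho_zpow_emod]

instance (n : ℕ) : Fintype (Gam n) := Fintype.ofFinite _

/-- The action of `Γ_n` on `V = ℂ²` by matrix multiplication. -/
def vrep (n : ℕ) : Representation ℝ (Gam n) V where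
  toFun g := (Matrix.mulVecLin (g : GL (Fin 2) ℂ).val).restrictScalars ℝ
  map_one' := by ext; simp
  map_mul' g h := by ext; simp

/-- The dual action on `V*`: `(g x)(v) = x (g⁻¹ v)`. -/
abbrev wrep (n : ℕ) : Representation ℝ (Gam n) W := (vrep n).dual

/-- The fixed subspace `V^γ`. -/
def Vfix {n : ℕ} (g : Gam n) : Submodule ℝ V := LinearMap.eqLocus (vrep n g) LinearMap.id

/-- The fixed subspace of `γ` on `V*`, i.e. the annihilator of `N^γ`, identified with
the dual of `V^γ`. -/
def Wfix {n : ℕ} (g : Gam n) : Submodule ℝ W := LinearMap.eqLocus (wrep n g) LinearMap.id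

/-- `l(γ)`, the real codimension of `V^γ`. -/
def codim {n : ℕ} (g : Gam n) : ℕ := Module.finrank ℝ (V ⧸ Vfix g)

lemma wrep_one_apply (n : ℕ) (x : W) : wrep n 1 x = x := by
  rw [map_one]; rfl

lemma wrep_mul_apply (n : ℕ) (g h : Gam n) (x : W) :
    wrep n (g * h) x = wrep n g (wrep n h x) := by
  rw [map_mul]; rfl

/-! ### Crossed products -/

/-- The action of `Γ_n` on `T(V*)` by algebra automorphisms. -/
instance (n : ℕ) : MulSemiringAction (Gam n) (TensorAlgebra ℝ W) where
  smul g t := TensorAlgebra.lift ℝ (TensorAlgebra.ι ℝ ∘ₗ wrep n g) t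
  one_smul t := by
    change TensorAlgebra.lift ℝ _ t = AlgHom.id ℝ _ t
    congr 1; ext x : 2
    simpa using! congrArg (TensorAlgebra.ι ℝ) (wrep_one_apply n x)
  mul_smul g h t := by
    change TensorAlgebra.lift ℝ _ t = ((TensorAlgebra.lift ℝ _).comp (TensorAlgebra.lift ℝ _)) t
    congr 1; ext x : 2
    simpa using! congrArg (TensorAlgebra.ι ℝ) (wrep_mul_apply n g h x)
  smul_zero g := map_zero (TensorAlgebra.lift ℝ _)
  smul_add g := map_add (TensorAlgebra.lift ℝ _)
  smul_one g := map_one (TensorAlgebra.lift ℝ _)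
  smul_mul g := map_mul (TensorAlgebra.lift ℝ _)

/-- The action of `Γ_n` on `S(V*)` by algebra automorphisms. -/
instance (n : ℕ) : MulSemiringAction (Gam n) (SymmetricAlgebra ℝ W) where
  smul g t := SymmetricAlgebra.lift (SymmetricAlgebra.ι ℝ W ∘ₗ wrep n g) t
  one_smul t := by
    change SymmetricAlgebra.lift _ t = AlgHom.id ℝ _ t
    congr 1; apply SymmetricAlgebra.algHom_ext; ext x : 1
    simpa using! congrArg (SymmetricAlgebra.ι ℝ W) (wrep_one_apply n x)
  mul_smul g h t := by
    change SymmetricAlgebra.lift _ t =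
      ((SymmetricAlgebra.lift _).comp (SymmetricAlgebra.lift _)) t
    congr 1; apply SymmetricAlgebra.algHom_ext; ext x : 1
    simpa using! congrArg (SymmetricAlgebra.ι ℝ W) (wrep_mul_apply n g h x)
  smul_zero g := map_zero (SymmetricAlgebra.lift _)
  smul_add g := map_add (SymmetricAlgebra.lift _)
  smul_one g := map_one (SymmetricAlgebra.lift _)
  smul_mul g := map_mul (SymmetricAlgebra.lift _)

/-- The crossed product `T(V*) ⋊ Γ_n`; `single g t` is `t g`, with `g t = (g • t) g`. -/
abbrev TCross (n : ℕ) := SkewMonoidAlgebra (TensorAlgebra ℝ W) (Gam n)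

/-- The crossed product `S(V*) ⋊ Γ_n`; `single g f` is `f g`, with `g f = (g • f) g`. -/
abbrev SCross (n : ℕ) := SkewMonoidAlgebra (SymmetricAlgebra ℝ W) (Gam n)

/-! ### Linear Poisson structures -/

/-- Families `(f_γ)` of bilinear maps on `V*`; those with alternating members are the elements of
`⊕_γ M ⊗ ∧²V`. -/
abbrev Cochain (n : ℕ) (M : Type) [AddCommGroup M] [Module ℝ M] := Gam n → W →ₗ[ℝ] W →ₗ[ℝ] M

/-- Elements of `(V* ⊗ ∧²V)^Γ ⊕ (⊕_{l(γ)=2} (V^γ)* ⊗ ∧²N^γ)^Γ`, the linear cocycles. -/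
structure IsLinearCocycle {n : ℕ} (π : Cochain n W) : Prop where
  alt : ∀ g, (π g).IsAlt
  invariant : ∀ g h x y,
    wrep n g (π h (wrep n g⁻¹ x) (wrep n g⁻¹ y)) = π (g * h * g⁻¹) x y
  support : ∀ g, g ≠ 1 → codim g ≠ 2 → π g = 0
  mem_fix : ∀ g, codim g = 2 → ∀ x y, π g x y ∈ Wfix g
  normal : ∀ g, codim g = 2 → ∀ x ∈ Wfix g, ∀ y, π g x y = 0

/-- The double bracket `⟦b, π⟧_γ(x, y, z)`, the sum over `α β = γ` of
`b_α(π_β(x, y), z + β z)` and its cyclic permutations. -/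
def dblBracket {n : ℕ} {M : Type} [AddCommGroup M] [Module ℝ M]
    (b : Cochain n M) (π : Cochain n W) (g : Gam n) (x y z : W) : M :=
  ∑ β : Gam n,
    (b (g * β⁻¹) (π β x y) (z + wrep n β z) + b (g * β⁻¹) (π β y z) (x + wrep n β x)
      + b (g * β⁻¹) (π β z x) (y + wrep n β y))

/-- The projection of `V*` onto the `γ`-fixed vectors along the nontrivial part. -/
def fixProj {n : ℕ} (g : Gam n) : W →ₗ[ℝ] W :=
  (orderOf g : ℝ)⁻¹ • ∑ i ∈ Finset.range (orderOf g), wrep n (g ^ i)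

/-- The projection `pr_γ` of `V* ⊗ ∧³V` onto `(V^γ)* ⊗ ∧^{3-l(γ)} V^γ ⊗ ∧^{l(γ)} N^γ`: values are
projected to the fixed vectors, `l(γ)` of the arguments to the normal part and the others to
the fixed part. -/
def pr {n : ℕ} (g : Gam n) (f : (Fin 3 → W) → W) (x : Fin 3 → W) : W :=
  fixProj g (∑ s ∈ Finset.powersetCard (codim g) (Finset.univ : Finset (Fin 3)),
    f (fun i => if i ∈ s then x i - fixProj g (x i) else fixProj g (x i)))

/-- The `γ`-component `[π, π]_γ = pr_γ ⟦π, π⟧_γ` of the Gerstenhaber bracket. -/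
def gerstenhaber {n : ℕ} (π : Cochain n W) (g : Gam n) (x : Fin 3 → W) : W :=
  pr g (fun u => dblBracket π π g (u 0) (u 1) (u 2)) x

/-- Linear Poisson structures on `S(V*) ⋊ Γ_n`. -/
structure IsLinearPoisson {n : ℕ} (π : Cochain n W) : Prop extends IsLinearCocycle π where
  bracket_eq_zero : ∀ g x, gerstenhaber π g x = 0

/-- The Koszul differential `∂^γ b ∈ V* ⊗ ∧³V` of `b ∈ ∧²V`. -/
def koszul {n : ℕ} (g : Gam n) (b : W →ₗ[ℝ] W →ₗ[ℝ] ℝ) (x y z : W) : W :=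
  b y z • (x - wrep n g x) - b x z • (y - wrep n g y) + b x y • (z - wrep n g z)

/-! ### Deformation quantization -/

/-- An associative, unital, `ℝ[[ħ]]`-bilinear product `a ⋆ b = a b + ∑_{k ≥ 1} ħ^k m_k(a, b)`
on `A[[ħ]]`. -/
structure FormalDeformation (A : Type) [Ring A] [Module ℝ A] where
  m : ℕ → A →ₗ[ℝ] A →ₗ[ℝ] A
  m_zero : ∀ a b, m 0 a b = a * b
  one_left : ∀ k, 1 ≤ k → ∀ a, m k 1 a = 0
  one_right : ∀ k, 1 ≤ k → ∀ a, m k a 1 = 0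
  assoc : ∀ k a b c,
    ∑ p ∈ Finset.HasAntidiagonal.antidiagonal k, m p.1 (m p.2 a b) c =
      ∑ p ∈ Finset.HasAntidiagonal.antidiagonal k, m p.1 a (m p.2 b c)

/-- The product `⋆` on `A[[ħ]]`. -/
def FormalDeformation.star {A : Type} [Ring A] [Module ℝ A] (D : FormalDeformation A)
    (f g : A⟦X⟧) : A⟦X⟧ :=
  PowerSeries.mk fun k => ∑ p ∈ Finset.HasAntidiagonal.antidiagonal k, ∑ q ∈ Finset.HasAntidiagonal.antidiagonal p.2,
    D.m p.1 (PowerSeries.coeff q.1 f) (PowerSeries.coeff q.2 g)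

/-- The element `x ∈ V*` of `S(V*) ⋊ Γ_n`. -/
def xS (n : ℕ) (x : W) : SCross n := SkewMonoidAlgebra.single 1 (SymmetricAlgebra.ι ℝ W x)

/-- The element `γ` of `S(V*) ⋊ Γ_n`. -/
def gS {n : ℕ} (g : Gam n) : SCross n := SkewMonoidAlgebra.single g 1

/-- `ν` is an `ℝΓ`-relative Hochschild 2-cochain whose restriction to the Koszul complex is `π`. -/
structure IsKoszulRep {n : ℕ} (ν : SCross n → SCross n → SCross n) (π : Cochain n W) : Prop where
  left : ∀ g a b, ν (gS g * a) b = gS g * ν a b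
  balanced : ∀ g a b, ν (a * gS g) b = ν a (gS g * b)
  right : ∀ g a b, ν a (b * gS g) = ν a b * gS g
  restrict : ∀ x y, ν (xS n x) (xS n y) - ν (xS n y) (xS n x) =
    ∑ g : Gam n, SkewMonoidAlgebra.single g (SymmetricAlgebra.ι ℝ W (π g x y))

/-- The Hochschild class of `μ` is the one defined by `π`: up to a Hochschild coboundary, `μ` is
`ℝΓ`-relative and restricts to `π` on the Koszul complex. -/
def RepresentsClass {n : ℕ} (μ : SCross n →ₗ[ℝ] SCross n →ₗ[ℝ] SCross n) (π : Cochain n W) :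
    Prop :=
  ∃ φ : SCross n →ₗ[ℝ] SCross n,
    IsKoszulRep (fun a b => μ a b - (a * φ b - φ (a * b) + φ a * b)) π

/-- `D` is a deformation quantization of `S(V*) ⋊ Γ_n` in the direction of `π`. -/
def FormalDeformation.Quantizes {n : ℕ} (D : FormalDeformation (SCross n)) (π : Cochain n W) :
    Prop :=
  RepresentsClass (D.m 1) π

/-! ### The algebra `H` -/

/-- The closure of a two-sided ideal of `R[[ħ]]` in the `ħ`-adic topology. -/
def adicClosure {R : Type} [Ring R] (I : TwoSidedIdeal R⟦X⟧) : TwoSidedIdeal R⟦X⟧ :=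
  TwoSidedIdeal.mk' {f | ∀ N : ℕ, ∃ h : R⟦X⟧, f - PowerSeries.X ^ N * h ∈ I}
    (fun N => ⟨0, by simp⟩)
    (by
      intro f g hf hg N
      obtain ⟨a, ha⟩ := hf N
      obtain ⟨b, hb⟩ := hg N
      refine ⟨a + b, ?_⟩
      have := I.add_mem ha hb
      rwa [show f - PowerSeries.X ^ N * a + (g - PowerSeries.X ^ N * b) =
        f + g - PowerSeries.X ^ N * (a + b) by rw [mul_add]; abel] at this)
    (by
      intro f hf N
      obtain ⟨a, ha⟩ := hf N
      refine ⟨-a, ?_⟩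
      have := I.neg_mem ha
      rwa [show -(f - PowerSeries.X ^ N * a) = -f - PowerSeries.X ^ N * -a by
        rw [mul_neg]; abel] at this)
    (by
      intro f g hg N
      obtain ⟨a, ha⟩ := hg N
      refine ⟨f * a, ?_⟩
      have := I.mul_mem_left f _ ha
      rwa [mul_sub, ← mul_assoc, ((PowerSeries.commute_X f).pow_right N).eq, mul_assoc] at this)
    (by
      intro f g hf N
      obtain ⟨a, ha⟩ := hf N
      refine ⟨a * g, ?_⟩
      have := I.mul_mem_right _ g ha
      rwa [sub_mul, mul_assoc] at this)

/-- The element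
`x ⊗ y - y ⊗ x - ħ ∑_γ π_γ(x, y) γ - ħ² ∑_γ b_γ(x, y) γ` of `(T(V*) ⋊ Γ_n)[[ħ]]`. -/
def relation {n : ℕ} (π : Cochain n W) (b : Cochain n ℝ) (x y : W) : (TCross n)⟦X⟧ :=
  PowerSeries.C (SkewMonoidAlgebra.single 1
      (TensorAlgebra.ι ℝ x * TensorAlgebra.ι ℝ y - TensorAlgebra.ι ℝ y * TensorAlgebra.ι ℝ x))
    - PowerSeries.X * PowerSeries.C
        (∑ g : Gam n, SkewMonoidAlgebra.single g (TensorAlgebra.ι ℝ (π g x y)))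
    - PowerSeries.X ^ 2 * PowerSeries.C
        (∑ g : Gam n, SkewMonoidAlgebra.single g (algebraMap ℝ (TensorAlgebra ℝ W) (b g x y)))

/-- The closed two-sided ideal generated by the relations. -/
def relIdeal {n : ℕ} (π : Cochain n W) (b : Cochain n ℝ) : TwoSidedIdeal (TCross n)⟦X⟧ :=
  adicClosure (TwoSidedIdeal.span {r | ∃ x y : W, r = relation π b x y})

/-- The algebra `H = (T(V*) ⋊ Γ_n)[[ħ]] / ⟨relations⟩`. -/
abbrev H {n : ℕ} (π : Cochain n W) (b : Cochain n ℝ) := (relIdeal π b).ringCon.Quotient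

/-- The quotient map `(T(V*) ⋊ Γ_n)[[ħ]] → H`. -/
def toH {n : ℕ} (π : Cochain n W) (b : Cochain n ℝ) : (TCross n)⟦X⟧ →+* H π b :=
  (relIdeal π b).ringCon.mk'

/-- A scalar `s ∈ ℝ[[ħ]]` as an element of `(T(V*) ⋊ Γ_n)[[ħ]]`. -/
def scalarT (n : ℕ) (s : ℝ⟦X⟧) : (TCross n)⟦X⟧ :=
  PowerSeries.mk fun k => SkewMonoidAlgebra.single 1 (algebraMap ℝ _ (PowerSeries.coeff k s))

/-- A scalar `s ∈ ℝ[[ħ]]` as an element of `(S(V*) ⋊ Γ_n)[[ħ]]`. -/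
def scalarS (n : ℕ) (s : ℝ⟦X⟧) : (SCross n)⟦X⟧ :=
  PowerSeries.mk fun k => SkewMonoidAlgebra.single 1 (algebraMap ℝ _ (PowerSeries.coeff k s))

/-- The bijection `e : H → (S(V*) ⋊ Γ_n)[[ħ]]` is `ℝ[[ħ]]`-linear and reduces modulo `ħ` to the
canonical map induced by `T(V*) ⋊ Γ_n → S(V*) ⋊ Γ_n`. -/
structure IsPBWIso {n : ℕ} {π : Cochain n W} {b : Cochain n ℝ}
    (e : H π b ≃+ (SCross n)⟦X⟧) : Prop where
  linear : ∀ s u, e (toH π b (scalarT n s) * u) = scalarS n s * e u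
  reduces : ∀ g t,
    PowerSeries.constantCoeff (e (toH π b (PowerSeries.C (SkewMonoidAlgebra.single g t)))) =
      SkewMonoidAlgebra.single g (SymmetricAlgebra.algHom ℝ W t)

/-- The PBW property of `H`. -/
def HasPBW {n : ℕ} (π : Cochain n W) (b : Cochain n ℝ) : Prop :=
  ∃ e : H π b ≃+ (SCross n)⟦X⟧, IsPBWIso e

/-! ### Complex coordinates -/

/-- The complex vector field `∂_j = ∂/∂z_j` applied to a real linear function on `ℂ²`. -/
def del (j : Fin 2) (x : W) : ℂ :=
  ((x (Pi.single j 1) : ℂ) - Complex.I * (x (Pi.single j Complex.I) : ℂ)) / 2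

/-- The complex vector field `∂̄_j` applied to a real linear function on `ℂ²`. -/
def delbar (j : Fin 2) (x : W) : ℂ :=
  ((x (Pi.single j 1) : ℂ) + Complex.I * (x (Pi.single j Complex.I) : ℂ)) / 2

/-- `(p ∧ q)(x, y) = p(x) q(y) - q(x) p(y)`. -/
def wedge (p q : W → ℂ) (x y : W) : ℂ := p x * q y - q x * p y

/-- The linear function `c (ρ^k z₁ + ρ^{-k} z₂) - c̄ (ρ^{-k} z̄₁ + ρ^k z̄₂)` at `v = (z₁, z₂)`. -/
def piFun (n : ℕ) (c : ℂ) (k : ℤ) (v : V) : ℂ :=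
  c * (rho n ^ k * v 0 + rho n ^ (-k) * v 1)
    - star c * (rho n ^ (-k) * star (v 0) + rho n ^ k * star (v 1))

/-- The bivector `∂₁∧∂̄₁ - ρ^{-2k} ∂₁∧∂̄₂ - ρ^{2k} ∂₂∧∂̄₁ + ∂₂∧∂̄₂`. -/
def piBivector (n : ℕ) (k : ℤ) (x y : W) : ℂ :=
  wedge (del 0) (delbar 0) x y - rho n ^ (-2 * k) * wedge (del 0) (delbar 1) x y
    - rho n ^ (2 * k) * wedge (del 1) (delbar 0) x y + wedge (del 1) (delbar 1) x y

/-- The bivector `(2n+1)(ρ^k - ρ^{-k}) (-|c|² ∂₂∧∂̄₂ + |c|² ∂₁∧∂̄₁ + c̄² ∂₁∧∂₂ - c² ∂̄₁∧∂̄₂)`. -/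
def BBivector (n : ℕ) (c : ℂ) (k : ℤ) (x y : W) : ℂ :=
  (2 * n + 1) * (rho n ^ k - rho n ^ (-k)) *
    (-(c * star c) * wedge (del 1) (delbar 1) x y + (c * star c) * wedge (del 0) (delbar 0) x y
      + star c ^ 2 * wedge (del 0) (del 1) x y - c ^ 2 * wedge (delbar 0) (delbar 1) x y)

end

end DihedralQuant

/-! The first half is a PBW criterion, the second the verification of its hypotheses in coordinates.

Criterion. H has the PBW property once three identities hold: the symmetric parts of the Jacobi sums
of π cancel, ⟦π,π⟧ = 2∂b, and ⟦b,π⟧ = 0 (`PBWCondition`). Instead of normal forms in H, one builds a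
linear map L from T(V*) ⋊ Γ_n to (S(V*) ⋊ Γ_n)[[ħ]] that reduces to the canonical map and whose
ħ-linear extension `hat L` kills all relations. L is built order by order. In order k the correction
is prescribed on the elements p(xy − yx)q, and by `exists_extension` such data extend to T(V*) if
they agree on disjoint commutators and satisfy a Jacobi identity on overlapping ones; this is a
diamond argument by induction on inversions. The Jacobi identity holds by `defTerm_commutator`: the
cyclic commutator of the deformation term is a combination of relations plus ħ(½⟦π,π⟧ − ∂b) plus
ħ²·½⟦b,π⟧. Averaging over Γ_n × Γ_n makes L a bimodule map, so that the first order term of the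
transported product is Γ_n-relative. The kernel of `hat L` is exactly the closed ideal of relations,
so L induces H ≅ (S(V*) ⋊ Γ_n)[[ħ]], and the product of H is carried over.

Conversely, if H has the PBW property then ħ is regular in H, and the same identity, divided by ħ
twice, gives ⟦π,π⟧ = 2∂b (`HasPBW.dblBracket_eq`). At a nontrivial rotation 1 − γ is onto the
four-dimensional V*, so ∂^γ is injective and b_γ is forced (`eq_zero_of_koszul`).

Verification. A linear cocycle lives at the identity and at the reflections. Since 2n+1 is odd, the
reflections are all conjugate, and their components are governed by one complex number c
(`exists_reflForm`). The Poisson condition gives ⟦π,π⟧ = 0 at 1; at a reflection ⟦π,π⟧ already lies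
in the image of pr, hence vanishes too. At a nontrivial rotation only pairs of reflections
contribute, and averaging over all reflections kills every nonconstant power of ρ; what remains is
2∂B (`IsLinearPoisson.dblBracket_eq`). Finally ⟦B,π⟧ = 0: the vectors π_β(x,y) lie in the radical of
B, and the contribution of π_1 is a rotation-invariant alternating trilinear form, of which only 0
exists. -/

namespace DihedralQuant

noncomputable section

/-! ### Extending maps from the commutator relations to the tensor algebra -/

/-! ### Sorting words by removing descents -/

section Words

variable {κ M : Type*} [LinearOrder κ] [AddCommGroup M]

/-- The number of inversions of a word. -/
def inversions : List κ → ℕ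
  | [] => 0
  | a :: l => l.countP (fun b => decide (b < a)) + inversions l

/-- The letters of `u` see the same multiset to their right before and after the swap, so only the
swapped pair changes the count. This is the termination measure for sorting. -/
lemma inversions_swap_lt (u v : List κ) {a b : κ} (h : b < a) :
    inversions (u ++ b :: a :: v) < inversions (u ++ a :: b :: v) := by
  induction u with
  | nil =>
    simp only [List.nil_append, inversions, List.countP_cons, decide_eq_true_eq, h, if_true,
      not_lt_of_gt h, if_false]
    omega
  | cons c u ih =>
    have hp : (u ++ b :: a :: v).countP (fun x => decide (x < c)) =
        (u ++ a :: b :: v).countP (fun x => decide (x < c)) :=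
      (List.Perm.append_left u (List.Perm.swap a b v)).countP_eq _
    simp only [List.cons_append, inversions]
    omega

open Classical in
/-- The value of a word obtained by successively removing descents, where the exchange of
the descent `a b` between `u` and `v` contributes `f u a b v`. -/
def sortValue (f : List κ → κ → κ → List κ → M) (w : List κ) : M :=
  if h : ∃ p : List κ × κ × κ × List κ, w = p.1 ++ p.2.1 :: p.2.2.1 :: p.2.2.2 ∧ p.2.2.1 < p.2.1 then
    sortValue f (h.choose.1 ++ h.choose.2.2.1 :: h.choose.2.1 :: h.choose.2.2.2) +
      f h.choose.1 h.choose.2.1 h.choose.2.2.1 h.choose.2.2.2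
  else 0
termination_by inversions w
decreasing_by
  conv_rhs => rw [h.choose_spec.1]
  exact inversions_swap_lt _ _ h.choose_spec.2

/-- A diamond lemma: `sortValue` removes an arbitrarily chosen descent, and the point is that the
choice does not matter. Two disjoint descents are reconciled by `far`, two sharing a letter by
`overlap`. Then `skew` and `alt` pass from descents to all adjacent pairs. -/
theorem exists_word_map (f : List κ → κ → κ → List κ → M)
    (alt : ∀ u a v, f u a a v = 0) (skew : ∀ u a b v, f u a b v = -f u b a v)
    (far : ∀ u a b v c d t, f u a b (v ++ c :: d :: t) + f (u ++ b :: a :: v) c d t =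
      f (u ++ a :: b :: v) c d t + f u a b (v ++ d :: c :: t))
    (overlap : ∀ u a b c v, f u a b (c :: v) - f (u ++ [c]) a b v + (f u b c (a :: v) -
      f (u ++ [a]) b c v) + (f u c a (b :: v) - f (u ++ [b]) c a v) = 0) :
    ∃ E : List κ → M, (∀ u a b v, E (u ++ a :: b :: v) = E (u ++ b :: a :: v) + f u a b v) ∧
      E [] = 0 ∧ ∀ a, E [a] = 0 := by
  have key : ∀ N : ℕ, ∀ u a b v, b < a → inversions (u ++ a :: b :: v) = N →
      sortValue f (u ++ a :: b :: v) = sortValue f (u ++ b :: a :: v) + f u a b v := by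
    intro N
    induction N using Nat.strong_induction_on with
    | _ N ih =>
    -- Local confluence: two descents of one word, the second starting `s` letters after the first,
    -- give the same value, provided words with fewer inversions are already settled. The length of
    -- `s` separates equal, overlapping and disjoint descents.
    have agree : ∀ u a b v s c d t, b < a → d < c → u ++ a :: b :: v = (u ++ s) ++ c :: d :: t →
        inversions (u ++ a :: b :: v) = N →
        sortValue f (u ++ b :: a :: v) + f u a b v =
          sortValue f (u ++ s ++ d :: c :: t) + f (u ++ s) c d t := by
      intro u a b v s c d t hba hdc hw hN
      rw [List.append_assoc, List.append_cancel_left_eq] at hw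
      match s with
      | [] =>
        simp only [List.nil_append, List.cons.injEq] at hw
        obtain ⟨rfl, rfl, rfl⟩ := hw
        simp
      -- Overlap a > b > d: the two routes from `a b d` to `d b a` bound the hexagon of S₃. `e1`,
      -- `e2` follow one route, `e3`, `e4` the other, and `overlap` equates the totals.
      | [x] =>
        simp only [List.cons_append, List.nil_append, List.cons.injEq] at hw
        obtain ⟨rfl, rfl, rfl⟩ := hw
        have e1 := ih _ (hN ▸ inversions_swap_lt u (d :: t) hba) (u ++ [b]) a d t (hdc.trans hba)
          (by simp)
        have l1 := (by simpa using inversions_swap_lt (u ++ [b]) t (hdc.trans hba) :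
          inversions (u ++ b :: d :: a :: t) < inversions (u ++ b :: a :: d :: t))
        have e2 := ih _ (hN ▸ l1.trans (inversions_swap_lt u (d :: t) hba)) u b d (a :: t) hdc rfl
        have l0 := (by simpa using inversions_swap_lt (u ++ [a]) t hdc :
          inversions (u ++ a :: d :: b :: t) < inversions (u ++ a :: b :: d :: t))
        have e3 := ih _ (hN ▸ l0) u a d (b :: t) (hdc.trans hba) rfl
        have l2 := inversions_swap_lt u (b :: t) (hdc.trans hba)
        have e4 := ih _ (hN ▸ l2.trans l0) (u ++ [d]) a b t hba (by simp)
        have ov := overlap u a b d t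
        rw [skew u d a, skew (u ++ [b]) d a] at ov
        simp only [List.append_assoc, List.cons_append, List.nil_append] at e1 e2 e3 e4 ov ⊢
        rw [e1, e2, e3, e4]
        rw [← sub_eq_zero, ← ov]
        abel
      | x :: y :: s =>
        simp only [List.cons_append, List.cons.injEq] at hw
        obtain ⟨rfl, rfl, rfl⟩ := hw
        have e1 := ih _ (hN ▸ inversions_swap_lt u (s ++ c :: d :: t) hba)
          (u ++ b :: a :: s) c d t hdc (by simp)
        have l0 := (by simpa using inversions_swap_lt (u ++ a :: b :: s) t hdc :
          inversions (u ++ a :: b :: (s ++ d :: c :: t)) <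
            inversions (u ++ a :: b :: (s ++ c :: d :: t)))
        have e2 := ih _ (hN ▸ l0) u a b (s ++ d :: c :: t) hba rfl
        have hf := far u a b s c d t
        simp only [List.append_assoc, List.cons_append] at e1 e2 hf ⊢
        rw [e1, e2, add_assoc, add_assoc, add_comm (f (u ++ b :: a :: s) c d t), hf]
        abel
    intro u a b v hba hN
    have h : ∃ p : List κ × κ × κ × List κ,
        u ++ a :: b :: v = p.1 ++ p.2.1 :: p.2.2.1 :: p.2.2.2 ∧ p.2.2.1 < p.2.1 :=
      ⟨(u, a, b, v), rfl, hba⟩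
    rw [sortValue, dif_pos h]
    obtain ⟨hw, hdc⟩ := h.choose_spec
    generalize h.choose = p at hw hdc
    obtain ⟨u', c, d, t⟩ := p
    simp only at hw hdc ⊢
    -- The given descent and the chosen one can occur in either order.
    rcases List.append_eq_append_iff.1 hw with ⟨s, rfl, -⟩ | ⟨s, rfl, -⟩
    · exact (agree u a b v s c d t hba hdc hw hN).symm
    · exact agree u' c d t s a b v hdc hba hw.symm (hw ▸ hN)
  refine ⟨sortValue f, fun u a b v => ?_, ?_, fun a => ?_⟩
  · rcases lt_trichotomy b a with h | rfl | h
    · exact key _ u a b v h rfl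
    · rw [alt, add_zero]
    · rw [key _ u b a v h rfl, skew u a b]; abel
  · rw [sortValue, dif_neg]
    rintro ⟨⟨u, c, d, t⟩, h, -⟩
    simp at h
  · rw [sortValue, dif_neg]
    rintro ⟨⟨u, c, d, t⟩, h, -⟩
    have := congrArg List.length h
    simp at this
    omega

end Words

/-! ### From words in a basis to the tensor algebra -/

section TensorAlgebra

open TensorAlgebra

variable {U M : Type*} [AddCommGroup U] [Module ℝ U] [AddCommGroup M] [Module ℝ M]

lemma basis_tensorAlgebra_apply {κ : Type*} (β : Module.Basis κ ℝ U) (w : List κ) :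
    β.tensorAlgebra (FreeMonoid.ofList w) = (w.map fun i => ι ℝ (β i)).prod := by
  rw [Module.Basis.tensorAlgebra, Module.Basis.map_apply]
  change (equivFreeAlgebra β).symm (FreeAlgebra.equivMonoidAlgebraFreeMonoid.symm
    (MonoidAlgebra.single (FreeMonoid.ofList w) 1)) = _
  change (equivFreeAlgebra β).symm (MonoidAlgebra.lift ℝ (FreeAlgebra ℝ κ) (FreeMonoid κ)
    (FreeMonoid.lift (FreeAlgebra.ι ℝ)) (MonoidAlgebra.single (FreeMonoid.ofList w) 1)) = _
  rw [MonoidAlgebra.lift_single, one_smul, FreeMonoid.lift_apply, map_list_prod]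
  simp [Function.comp_def]

/-- A map on the commutator relations that respects disjoint and overlapping pairs of commutators
extends to the tensor algebra. -/
theorem exists_extension
    (Φ : TensorAlgebra ℝ U →ₗ[ℝ] U →ₗ[ℝ] U →ₗ[ℝ] TensorAlgebra ℝ U →ₗ[ℝ] M)
    (alt : ∀ p x q, Φ p x x q = 0)
    (far : ∀ p x y q z w t, Φ p x y (q * (ι ℝ z * ι ℝ w - ι ℝ w * ι ℝ z) * t) =
      Φ (p * (ι ℝ x * ι ℝ y - ι ℝ y * ι ℝ x) * q) z w t)
    (overlap : ∀ p x y z q, Φ p x y (ι ℝ z * q) - Φ (p * ι ℝ z) x y q +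
      (Φ p y z (ι ℝ x * q) - Φ (p * ι ℝ x) y z q) +
      (Φ p z x (ι ℝ y * q) - Φ (p * ι ℝ y) z x q) = 0) :
    ∃ E : TensorAlgebra ℝ U →ₗ[ℝ] M,
      (∀ p x y q, E (p * (ι ℝ x * ι ℝ y - ι ℝ y * ι ℝ x) * q) = Φ p x y q) ∧
      E 1 = 0 ∧ ∀ x, E (ι ℝ x) = 0 := by
  classical
  let β := Module.Basis.ofVectorSpace ℝ U
  let κ := Module.Basis.ofVectorSpaceIndex ℝ U
  -- Any linear order on the basis would do; it only serves to say what a descent is.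
  let _ : LinearOrder κ := linearOrderOfSTO (WellOrderingRel (α := κ))
  let m : List κ → TensorAlgebra ℝ U := fun w => (w.map fun i => ι ℝ (β i)).prod
  have m_append : ∀ u v, m (u ++ v) = m u * m v := fun u v => by simp [m]
  have m_cons : ∀ a v, m (a :: v) = ι ℝ (β a) * m v := fun u v => by simp [m]
  have m_nil : m [] = 1 := rfl
  have skew : ∀ p x y q, Φ p x y q = -Φ p y x q := fun p x y q => by
    have := alt p (x + y) q
    simp only [map_add, LinearMap.add_apply, alt, zero_add, add_zero] at this
    exact eq_neg_of_add_eq_zero_right this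
  obtain ⟨E, hE, hE0, hE1⟩ := exists_word_map (κ := κ) (fun u a b v => Φ (m u) (β a) (β b) (m v))
    (fun u a v => alt _ _ _) (fun u a b v => skew _ _ _ _)
    (fun u a b v c d t => by
      have := far (m u) (β a) (β b) (m v) (β c) (β d) (m t)
      simp only [m_append, m_cons, mul_sub, sub_mul, map_sub, LinearMap.sub_apply,
        mul_assoc] at this ⊢
      rw [← sub_eq_zero] at this ⊢
      rw [← this]; abel)
    (fun u a b c v => by simpa [m_append, m_cons, m_nil] using overlap (m u) (β a) (β b) (β c) (m v))
  let E' : TensorAlgebra ℝ U →ₗ[ℝ] M := β.tensorAlgebra.constr ℝ (fun w => E w.toList)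
  have E'm : ∀ w, E' (m w) = E w := fun w => by
    change E' ((w.map fun i => ι ℝ (β i)).prod) = _
    rw [← basis_tensorAlgebra_apply, Module.Basis.constr_basis]; rfl
  refine ⟨E', ?_, ?_, ?_⟩
  -- Both sides of the claim are linear in all four arguments, so it suffices to compare them on
  -- basis words, where the identity is `hE`.
  · let Ψ : TensorAlgebra ℝ U →ₗ[ℝ] U →ₗ[ℝ] U →ₗ[ℝ] TensorAlgebra ℝ U →ₗ[ℝ] M :=
      LinearMap.mk₂ ℝ (fun p x => LinearMap.mk₂ ℝ
        (fun y q => E' (p * (ι ℝ x * ι ℝ y - ι ℝ y * ι ℝ x) * q))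
        (fun y y' q => by simp only [map_add, mul_add, add_mul, mul_sub, sub_mul, map_sub]; abel)
        (fun r y q => by simp [smul_sub, mul_sub, sub_mul])
        (fun y q q' => by rw [mul_add, map_add])
        (fun r y q => by simp))
        (fun p p' x => by ext y q; simp [add_mul])
        (fun r p x => by ext y q; simp)
        (fun p x x' => by
          ext y q; simp only [LinearMap.mk₂_apply, LinearMap.add_apply, map_add, mul_add, add_mul,
            mul_sub, sub_mul, map_sub]; abel)
        (fun r p x => by ext y q; simp [smul_sub, mul_sub, sub_mul])
    have : Ψ = Φ := by
      refine β.tensorAlgebra.ext fun u => β.ext fun a => β.ext fun b => β.tensorAlgebra.ext fun v => ?_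
      rw [← FreeMonoid.ofList_toList u, ← FreeMonoid.ofList_toList v, basis_tensorAlgebra_apply,
        basis_tensorAlgebra_apply]
      change E' (m u.toList * _ * m v.toList) = Φ (m u.toList) _ _ (m v.toList)
      have h := hE u.toList a b v.toList
      rw [← E'm, ← E'm, m_append, m_append, m_cons, m_cons, m_cons, m_cons] at h
      rw [mul_sub, sub_mul, map_sub, sub_eq_iff_eq_add', mul_assoc, mul_assoc, mul_assoc, mul_assoc, h]
    intro p x y q
    rw [← this]; rfl
  · rw [← m_nil, E'm, hE0]
  · intro x
    have : E' ∘ₗ ι ℝ = 0 := β.ext fun a => by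
      have := E'm [a]
      rw [hE1, m_cons, m_nil, mul_one] at this
      simpa using this
    exact LinearMap.congr_fun this x

end TensorAlgebra

end

end DihedralQuant

namespace DihedralQuant

noncomputable section

/-! ### The relations in the crossed product -/

instance (n : ℕ) : SMulCommClass (Gam n) ℝ (TensorAlgebra ℝ W) :=
  ⟨fun g r t => map_smul (TensorAlgebra.lift ℝ (TensorAlgebra.ι ℝ ∘ₗ wrep n g)) r t⟩

instance (n : ℕ) : SMulCommClass (Gam n) ℝ (SymmetricAlgebra ℝ W) :=
  ⟨fun g r t => map_smul (SymmetricAlgebra.lift (SymmetricAlgebra.ι ℝ W ∘ₗ wrep n g)) r t⟩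

lemma smul_tensorAlgebra_ι {n : ℕ} (g : Gam n) (x : W) :
    g • TensorAlgebra.ι ℝ x = TensorAlgebra.ι ℝ (wrep n g x) :=
  TensorAlgebra.lift_ι_apply _ x

lemma smul_symmetricAlgebra_ι {n : ℕ} (g : Gam n) (x : W) :
    g • SymmetricAlgebra.ι ℝ W x = SymmetricAlgebra.ι ℝ W (wrep n g x) :=
  SymmetricAlgebra.lift_ι_apply _ x

/-- The inclusion of `T(V*)` into `(T(V*) ⋊ Γ_n)[[ħ]]`. -/
def tensorIncl (n : ℕ) : TensorAlgebra ℝ W →ₐ[ℝ] (TCross n)⟦X⟧ where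
  __ := (PowerSeries.C (R := TCross n)).comp SkewMonoidAlgebra.singleOneRingHom
  commutes' r := by
    simp [PowerSeries.algebraMap_apply, SkewMonoidAlgebra.coe_algebraMap,
      SkewMonoidAlgebra.singleOneRingHom]

/-- The inclusion of `V*` into `(T(V*) ⋊ Γ_n)[[ħ]]`. -/
def vecT (n : ℕ) : W →ₗ[ℝ] (TCross n)⟦X⟧ := (tensorIncl n).toLinearMap ∘ₗ TensorAlgebra.ι ℝ

/-- The inclusion of `Γ_n` into `(T(V*) ⋊ Γ_n)[[ħ]]`. -/
def grpT {n : ℕ} (g : Gam n) : (TCross n)⟦X⟧ := PowerSeries.C (SkewMonoidAlgebra.single g 1)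

lemma tensorIncl_apply (n : ℕ) (t : TensorAlgebra ℝ W) :
    tensorIncl n t = PowerSeries.C (SkewMonoidAlgebra.single 1 t) := rfl

lemma tensorIncl_ι (n : ℕ) (x : W) : tensorIncl n (TensorAlgebra.ι ℝ x) = vecT n x := rfl

lemma C_single {n : ℕ} (g : Gam n) (t : TensorAlgebra ℝ W) :
    (PowerSeries.C (SkewMonoidAlgebra.single g t) : (TCross n)⟦X⟧) = tensorIncl n t * grpT g := by
  rw [tensorIncl_apply, grpT, ← map_mul, SkewMonoidAlgebra.single_mul_single]; simp

lemma grpT_mul_tensorIncl {n : ℕ} (g : Gam n) (t : TensorAlgebra ℝ W) :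
    grpT g * tensorIncl n t = tensorIncl n (g • t) * grpT g := by
  simp only [tensorIncl_apply, grpT, ← map_mul, SkewMonoidAlgebra.single_mul_single]; simp

lemma grpT_mul_vecT {n : ℕ} (g : Gam n) (x : W) :
    grpT g * vecT n x = vecT n (wrep n g x) * grpT g := by
  rw [← tensorIncl_ι, grpT_mul_tensorIncl, smul_tensorAlgebra_ι, tensorIncl_ι]

lemma grpT_mul {n : ℕ} (g h : Gam n) : grpT g * grpT h = grpT (g * h) := by
  simp only [grpT, ← map_mul, SkewMonoidAlgebra.single_mul_single, smul_one, mul_one]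

variable {n : ℕ}

/-- The deformation term `∑_γ π_γ(x, y) γ + ħ ∑_γ b_γ(x, y) γ`. -/
def defTerm (π : Cochain n W) (b : Cochain n ℝ) (x y : W) : (TCross n)⟦X⟧ :=
  ∑ g : Gam n, vecT n (π g x y) * grpT g + PowerSeries.X * ∑ g : Gam n, b g x y • grpT g

lemma relation_eq (π : Cochain n W) (b : Cochain n ℝ) (x y : W) :
    relation π b x y = vecT n x * vecT n y - vecT n y * vecT n x -
      PowerSeries.X * defTerm π b x y := by
  have h1 : ∀ g : Gam n, (PowerSeries.C (SkewMonoidAlgebra.single g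
      (algebraMap ℝ (TensorAlgebra ℝ W) (b g x y))) : (TCross n)⟦X⟧) = b g x y • grpT g := fun g => by
    rw [C_single, AlgHom.commutes, Algebra.smul_def]
  rw [relation, ← tensorIncl_apply, map_sub, map_mul, map_mul]
  simp only [map_sum, h1]
  simp only [C_single, defTerm, tensorIncl_ι, mul_add, pow_two, sub_sub, mul_assoc, add_assoc]

/-- The bracket `(x, y) ↦ x y - y x` on `V*` in `(T(V*) ⋊ Γ_n)[[ħ]]`, minus the deformation term,
is bilinear. -/
lemma relation_add_left (π : Cochain n W) (b : Cochain n ℝ) (x x' y : W) :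
    relation π b (x + x') y = relation π b x y + relation π b x' y := by
  simp only [relation_eq, defTerm, map_add, LinearMap.add_apply, add_mul, mul_add, add_smul,
    Finset.sum_add_distrib]
  abel

lemma relation_smul_left (π : Cochain n W) (b : Cochain n ℝ) (r : ℝ) (x y : W) :
    relation π b (r • x) y = r • relation π b x y := by
  simp only [relation_eq, defTerm, map_smul, LinearMap.smul_apply, smul_mul_assoc, mul_smul_comm,
    smul_eq_mul, mul_smul, ← Finset.smul_sum, ← smul_add, ← smul_sub]

lemma relation_add_right (π : Cochain n W) (b : Cochain n ℝ) (x y y' : W) :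
    relation π b x (y + y') = relation π b x y + relation π b x y' := by
  simp only [relation_eq, defTerm, map_add, add_mul, mul_add, add_smul, Finset.sum_add_distrib]
  abel

lemma relation_smul_right (π : Cochain n W) (b : Cochain n ℝ) (r : ℝ) (x y : W) :
    relation π b x (r • y) = r • relation π b x y := by
  simp only [relation_eq, defTerm, map_smul, smul_mul_assoc, mul_smul_comm, smul_eq_mul,
    mul_smul, ← Finset.smul_sum, ← smul_add, ← smul_sub]

/-- The symmetric condition: `∑ π_γ(x, y) (γ z - z)`, summed over cyclic permutations, vanishes
in `S²(V*)`. -/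
def SymmCondition (π : Cochain n W) : Prop :=
  ∀ g x y z, ∀ f : W →ₗ[ℝ] W →ₗ[ℝ] (TCross n)⟦X⟧,
    f (π g x y) (wrep n g z - z) + f (wrep n g z - z) (π g x y) +
    (f (π g y z) (wrep n g x - x) + f (wrep n g x - x) (π g y z)) +
    (f (π g z x) (wrep n g y - y) + f (wrep n g y - y) (π g z x)) = 0

/-- The sum of the products of `b_γ(π_β(x, y), z + β z)` with `γ β`. -/
lemma sum_comp {N : Type} [AddCommGroup N] [Module ℝ N] (b : Cochain n N) (π : Cochain n W)
    (F : N →ₗ[ℝ] (TCross n)⟦X⟧) (x y z : W) :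
    ∑ g : Gam n, F (dblBracket b π g x y z) * grpT g =
      ∑ g : Gam n, (∑ h : Gam n, F (b h (π g x y) (z + wrep n g z)) * grpT h) * grpT g +
      ∑ g : Gam n, (∑ h : Gam n, F (b h (π g y z) (x + wrep n g x)) * grpT h) * grpT g +
      ∑ g : Gam n, (∑ h : Gam n, F (b h (π g z x) (y + wrep n g y)) * grpT h) * grpT g := by
  have key : ∀ x y z : W, ∑ g : Gam n, ∑ h : Gam n,
      F (b (g * h⁻¹) (π h x y) (z + wrep n h z)) * grpT g =
      ∑ g : Gam n, (∑ h : Gam n, F (b h (π g x y) (z + wrep n g z)) * grpT h) * grpT g := by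
    intro x y z
    rw [Finset.sum_comm]
    refine Finset.sum_congr rfl fun h _ => ?_
    rw [Finset.sum_mul, ← Equiv.sum_comp (Equiv.mulRight h)]
    refine Finset.sum_congr rfl fun g _ => ?_
    simp [mul_assoc, grpT_mul]
  rw [← key, ← key, ← key]
  simp only [dblBracket, map_sum, map_add, Finset.sum_mul, add_mul, Finset.sum_add_distrib]

/-- The commutator of the deformation term with a vector, summed over cyclic permutations. -/
theorem defTerm_commutator (π : Cochain n W) (b : Cochain n ℝ) (hb : ∀ g, (b g).IsAlt)
    (hs : SymmCondition π) (x y z : W) :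
    (defTerm π b x y * vecT n z - vecT n z * defTerm π b x y) +
      (defTerm π b y z * vecT n x - vecT n x * defTerm π b y z) +
      (defTerm π b z x * vecT n y - vecT n y * defTerm π b z x) =
    (1 / 2 : ℝ) • (∑ g : Gam n, relation π b (π g x y) (z + wrep n g z) * grpT g +
      ∑ g : Gam n, relation π b (π g y z) (x + wrep n g x) * grpT g +
      ∑ g : Gam n, relation π b (π g z x) (y + wrep n g y) * grpT g) +
    PowerSeries.X * ∑ g : Gam n, vecT n ((1 / 2 : ℝ) • dblBracket π π g x y z -
      koszul g (b g) x y z) * grpT g +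
    PowerSeries.X ^ 2 * ∑ g : Gam n, ((1 / 2 : ℝ) * dblBracket b π g x y z) • grpT g := by
  have hd : ∀ x y z : W, ∑ g : Gam n, relation π b (π g x y) (z + wrep n g z) * grpT g =
      ∑ g : Gam n, (vecT n (π g x y) * vecT n (z + wrep n g z) -
        vecT n (z + wrep n g z) * vecT n (π g x y)) * grpT g -
      PowerSeries.X * ∑ g : Gam n,
        (∑ h : Gam n, vecT n (π h (π g x y) (z + wrep n g z)) * grpT h) * grpT g -
      PowerSeries.X ^ 2 * ∑ g : Gam n,
        (∑ h : Gam n, Algebra.linearMap ℝ (TCross n)⟦X⟧ (b h (π g x y) (z + wrep n g z)) *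
          grpT h) * grpT g := by
    intro x y z
    simp only [Finset.mul_sum, ← Finset.sum_sub_distrib]
    refine Finset.sum_congr rfl fun g _ => ?_
    simp only [relation_eq, defTerm, Algebra.linearMap_apply, ← Algebra.smul_def, sub_mul, mul_add,
      add_mul, pow_two, mul_assoc]
    abel
  -- Moving z leftwards past γ turns it into γz. In the scalar part this leaves b_γ(x,y)(γz − z)γ, a
  -- summand of the Koszul differential up to sign.
  have hL : ∀ x y z : W, defTerm π b x y * vecT n z - vecT n z * defTerm π b x y =
      ∑ g : Gam n, (vecT n (π g x y) * vecT n (wrep n g z) - vecT n z * vecT n (π g x y)) *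
        grpT g + PowerSeries.X * ∑ g : Gam n, vecT n (b g x y • (wrep n g z - z)) * grpT g := by
    intro x y z
    have hX := (PowerSeries.commute_X (vecT n z)).eq
    simp only [defTerm, add_mul, mul_add, ← mul_assoc, hX]
    simp only [mul_assoc, Finset.sum_mul, Finset.mul_sum, grpT_mul_vecT, sub_mul, smul_mul_assoc,
      mul_smul_comm, map_smul, map_sub, smul_sub, mul_sub, Finset.sum_sub_distrib]
    abel
  have hk : ∀ g : Gam n, koszul g (b g) x y z =
      -(b g x y • (wrep n g z - z) + b g y z • (wrep n g x - x) +
        b g z x • (wrep n g y - y)) := by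
    intro g
    rw [koszul, ← (hb g).neg x z]
    simp only [smul_sub, neg_smul]
    abel
  -- With v = π_γ(x,y), v·γz − z·v = ½[v, z + γz] + ½(v(γz − z) + (γz − z)v). The symmetric halves
  -- cancel cyclically by `hs`; the commutator halves are the origin of the factor ½ and of the
  -- arguments z + γz in the double bracket.
  have hsym : ∀ g : Gam n,
      (vecT n (π g x y) * vecT n (wrep n g z) - vecT n z * vecT n (π g x y)) +
      (vecT n (π g y z) * vecT n (wrep n g x) - vecT n x * vecT n (π g y z)) +
      (vecT n (π g z x) * vecT n (wrep n g y) - vecT n y * vecT n (π g z x)) =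
      (1 / 2 : ℝ) • ((vecT n (π g x y) * vecT n (z + wrep n g z) -
          vecT n (z + wrep n g z) * vecT n (π g x y)) +
        (vecT n (π g y z) * vecT n (x + wrep n g x) -
          vecT n (x + wrep n g x) * vecT n (π g y z)) +
        (vecT n (π g z x) * vecT n (y + wrep n g y) -
          vecT n (y + wrep n g y) * vecT n (π g z x))) := by
    intro g
    have h := hs g x y z ((LinearMap.mul ℝ (TCross n)⟦X⟧).compl₁₂ (vecT n) (vecT n))
    simp only [map_sub, LinearMap.sub_apply, LinearMap.compl₁₂_apply, LinearMap.mul_apply'] at h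
    have two : ∀ a b : (TCross n)⟦X⟧, a + a = b → a = (1 / 2 : ℝ) • b := by
      rintro a _ rfl
      rw [← two_smul ℝ a, smul_smul]; norm_num
    apply two
    simp only [map_add, mul_add, add_mul]
    rw [← sub_eq_zero, ← h]
    abel
  rw [hL, hL, hL, hd, hd, hd]
  have s1 := sum_comp π π (vecT n) x y z
  have s2 := sum_comp b π (Algebra.linearMap ℝ (TCross n)⟦X⟧) x y z
  have e1 : PowerSeries.X * ∑ g : Gam n, vecT n ((1 / 2 : ℝ) • dblBracket π π g x y z -
      koszul g (b g) x y z) * grpT g = (1 / 2 : ℝ) • (PowerSeries.X *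
        ∑ g : Gam n, vecT n (dblBracket π π g x y z) * grpT g) +
      (PowerSeries.X * ∑ g : Gam n, vecT n (b g x y • (wrep n g z - z)) * grpT g +
      PowerSeries.X * ∑ g : Gam n, vecT n (b g y z • (wrep n g x - x)) * grpT g +
      PowerSeries.X * ∑ g : Gam n, vecT n (b g z x • (wrep n g y - y)) * grpT g) := by
    rw [← mul_add, ← mul_add, ← mul_smul_comm, ← mul_add, Finset.smul_sum,
      ← Finset.sum_add_distrib, ← Finset.sum_add_distrib, ← Finset.sum_add_distrib]
    refine congrArg _ (Finset.sum_congr rfl fun g _ => ?_)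
    rw [hk g, ← smul_mul_assoc, ← map_smul, ← add_mul, ← add_mul, ← add_mul, ← map_add, ← map_add,
      ← map_add, sub_neg_eq_add]
  have e2 : PowerSeries.X ^ 2 * ∑ g : Gam n, ((1 / 2 : ℝ) * dblBracket b π g x y z) • grpT g =
      (1 / 2 : ℝ) • (PowerSeries.X ^ 2 *
        ∑ g : Gam n, Algebra.linearMap ℝ (TCross n)⟦X⟧ (dblBracket b π g x y z) * grpT g) := by
    rw [← mul_smul_comm, Finset.smul_sum]
    refine congrArg _ (Finset.sum_congr rfl fun g _ => ?_)
    rw [Algebra.linearMap_apply, ← Algebra.smul_def, smul_smul]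
  have e3 : ∑ g : Gam n, (vecT n (π g x y) * vecT n (wrep n g z) - vecT n z * vecT n (π g x y)) *
        grpT g +
      ∑ g : Gam n, (vecT n (π g y z) * vecT n (wrep n g x) - vecT n x * vecT n (π g y z)) *
        grpT g +
      ∑ g : Gam n, (vecT n (π g z x) * vecT n (wrep n g y) - vecT n y * vecT n (π g z x)) *
        grpT g =
      (1 / 2 : ℝ) • (∑ g : Gam n, (vecT n (π g x y) * vecT n (z + wrep n g z) -
        vecT n (z + wrep n g z) * vecT n (π g x y)) * grpT g +
      ∑ g : Gam n, (vecT n (π g y z) * vecT n (x + wrep n g x) -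
        vecT n (x + wrep n g x) * vecT n (π g y z)) * grpT g +
      ∑ g : Gam n, (vecT n (π g z x) * vecT n (y + wrep n g y) -
        vecT n (y + wrep n g y) * vecT n (π g z x)) * grpT g) := by
    simp only [← Finset.sum_add_distrib, Finset.smul_sum]
    refine Finset.sum_congr rfl fun g _ => ?_
    rw [← add_mul, ← add_mul, hsym g, ← add_mul, ← add_mul, smul_mul_assoc]
  rw [e1, e2, s1, s2, ← sub_eq_zero]
  rw [← sub_eq_zero] at e3
  rw [← e3]
  simp only [mul_add, smul_add, smul_sub]
  abel

/-- The Jacobi identity for commutators turns commutators of relations into commutators of the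
deformation term. -/
lemma relation_commutator (π : Cochain n W) (b : Cochain n ℝ) (x y z : W) :
    (relation π b x y * vecT n z - vecT n z * relation π b x y) +
      (relation π b y z * vecT n x - vecT n x * relation π b y z) +
      (relation π b z x * vecT n y - vecT n y * relation π b z x) +
    PowerSeries.X * ((defTerm π b x y * vecT n z - vecT n z * defTerm π b x y) +
      (defTerm π b y z * vecT n x - vecT n x * defTerm π b y z) +
      (defTerm π b z x * vecT n y - vecT n y * defTerm π b z x)) = 0 := by
  have hX : ∀ x f, vecT n x * (PowerSeries.X * f) = PowerSeries.X * (vecT n x * f) := fun x f => by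
    rw [← mul_assoc, (PowerSeries.commute_X (vecT n x)).eq, mul_assoc]
  simp only [relation_eq, sub_mul, mul_sub, hX, mul_add, mul_assoc]
  abel

/-- The relations are permuted by `Γ_n`. -/
lemma grpT_mul_relation {π : Cochain n W} {b : Cochain n ℝ}
    (hπ : ∀ g h x y, wrep n g (π h (wrep n g⁻¹ x) (wrep n g⁻¹ y)) = π (g * h * g⁻¹) x y)
    (hb : ∀ g h x y, b h (wrep n g⁻¹ x) (wrep n g⁻¹ y) = b (g * h * g⁻¹) x y)
    (g : Gam n) (x y : W) :
    grpT g * relation π b x y = relation π b (wrep n g x) (wrep n g y) * grpT g := by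
  have hi : ∀ x, wrep n g⁻¹ (wrep n g x) = x := fun x => by
    rw [← wrep_mul_apply, inv_mul_cancel, wrep_one_apply]
  have hπ' : ∀ h, wrep n g (π h x y) = π (g * h * g⁻¹) (wrep n g x) (wrep n g y) := fun h => by
    rw [← hπ, hi, hi]
  have hb' : ∀ h, b h x y = b (g * h * g⁻¹) (wrep n g x) (wrep n g y) := fun h => by
    rw [← hb, hi, hi]
  have hX := (PowerSeries.commute_X (grpT g)).eq
  have hv : ∀ x f, grpT g * (vecT n x * f) = vecT n (wrep n g x) * (grpT g * f) := fun x f => by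
    rw [← mul_assoc, grpT_mul_vecT, mul_assoc]
  have h1 : grpT g * ∑ h : Gam n, vecT n (π h x y) * grpT h =
      (∑ h : Gam n, vecT n (π h (wrep n g x) (wrep n g y)) * grpT h) * grpT g := by
    rw [Finset.mul_sum, Finset.sum_mul]
    refine Fintype.sum_equiv (MulAut.conj g).toEquiv _ _ fun h => ?_
    rw [hv, hπ', grpT_mul, mul_assoc (vecT n _), grpT_mul]
    simp
  have h2 : grpT g * ∑ h : Gam n, b h x y • grpT h =
      (∑ h : Gam n, b h (wrep n g x) (wrep n g y) • grpT h) * grpT g := by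
    rw [Finset.mul_sum, Finset.sum_mul]
    refine Fintype.sum_equiv (MulAut.conj g).toEquiv _ _ fun h => ?_
    rw [mul_smul_comm, smul_mul_assoc, grpT_mul, grpT_mul, hb' h]
    simp
  have hdef : grpT g * defTerm π b x y = defTerm π b (wrep n g x) (wrep n g y) * grpT g := by
    rw [defTerm, defTerm, mul_add, add_mul, h1, ← mul_assoc _ PowerSeries.X, hX, mul_assoc, h2,
      mul_assoc]
  rw [relation_eq, relation_eq, mul_sub, sub_mul, ← mul_assoc _ PowerSeries.X, hX, mul_assoc, hdef]
  simp only [mul_sub, sub_mul, mul_assoc, hv, grpT_mul_vecT]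

end

end DihedralQuant

namespace DihedralQuant

noncomputable section

/-! ### Extending maps to power series -/

section Hat

variable {R S : Type*} [Ring R] [Algebra ℝ R] [Ring S] [Algebra ℝ S]

/-- An additive map that commutes with `X` is determined by its values on constants. -/
lemma coeff_of_map_X_mul {R S : Type*} [Ring R] [Ring S] (G : R⟦X⟧ →+ S⟦X⟧)
    (hG : ∀ f, G (PowerSeries.X * f) = PowerSeries.X * G f) (k : ℕ) (f : R⟦X⟧) :
    PowerSeries.coeff k (G f) = ∑ p ∈ Finset.HasAntidiagonal.antidiagonal k,
      PowerSeries.coeff p.1 (G (PowerSeries.C (PowerSeries.coeff p.2 f))) := by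
  induction k generalizing f with
  | zero =>
    conv_lhs => rw [PowerSeries.eq_X_mul_shift_add_const f]
    simp [hG]
  | succ k ih =>
    rw [Finset.Nat.sum_antidiagonal_succ']
    conv_lhs => rw [PowerSeries.eq_X_mul_shift_add_const f]
    rw [map_add, hG, map_add, PowerSeries.coeff_succ_X_mul, ih]
    simp [add_comm]

/-- The `ħ`-linear extension of a linear map to power series. -/
def hat (L : R →ₗ[ℝ] S⟦X⟧) : R⟦X⟧ →ₗ[ℝ] S⟦X⟧ where
  toFun f := PowerSeries.mk fun k => ∑ p ∈ Finset.HasAntidiagonal.antidiagonal k,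
    PowerSeries.coeff p.1 (L (PowerSeries.coeff p.2 f))
  map_add' f g := by ext k; simp [Finset.sum_add_distrib]
  map_smul' r f := by ext k; simp [Finset.smul_sum]

lemma coeff_hat (L : R →ₗ[ℝ] S⟦X⟧) (k : ℕ) (f : R⟦X⟧) :
    PowerSeries.coeff k (hat L f) = ∑ p ∈ Finset.HasAntidiagonal.antidiagonal k,
      PowerSeries.coeff p.1 (L (PowerSeries.coeff p.2 f)) := by
  simp [hat]

lemma hat_C (L : R →ₗ[ℝ] S⟦X⟧) (t : R) : hat L (PowerSeries.C t) = L t := by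
  ext k
  rw [coeff_hat, Finset.sum_eq_single (k, 0)]
  · simp
  · rintro ⟨i, j⟩ hij hne
    have : j ≠ 0 := by rintro rfl; simp at hij; simp [hij] at hne
    simp [PowerSeries.coeff_C, this]
  · simp

lemma hat_X_mul (L : R →ₗ[ℝ] S⟦X⟧) (f : R⟦X⟧) :
    hat L (PowerSeries.X * f) = PowerSeries.X * hat L f := by
  ext k
  rw [coeff_hat]
  cases k with
  | zero => simp
  | succ k =>
    rw [Finset.Nat.sum_antidiagonal_succ', PowerSeries.coeff_succ_X_mul, coeff_hat]
    simp [PowerSeries.coeff_succ_X_mul]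

lemma hat_unique (L : R →ₗ[ℝ] S⟦X⟧) (G : R⟦X⟧ →+ S⟦X⟧)
    (hG : ∀ f, G (PowerSeries.X * f) = PowerSeries.X * G f)
    (hC : ∀ t, G (PowerSeries.C t) = L t) (f : R⟦X⟧) : G f = hat L f := by
  ext k
  rw [coeff_of_map_X_mul G hG, coeff_hat]
  simp [hC]

lemma coeff_hat_congr {L L' : R →ₗ[ℝ] S⟦X⟧} {k : ℕ}
    (h : ∀ j ≤ k, ∀ t, PowerSeries.coeff j (L t) = PowerSeries.coeff j (L' t)) (f : R⟦X⟧) :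
    PowerSeries.coeff k (hat L f) = PowerSeries.coeff k (hat L' f) := by
  rw [coeff_hat, coeff_hat]
  exact Finset.sum_congr rfl fun p hp => h _ (by have := Finset.HasAntidiagonal.mem_antidiagonal.1 hp; omega) _

/-- Taking a coefficient, as a real linear map. -/
def coeffLin (k : ℕ) : S⟦X⟧ →ₗ[ℝ] S where
  toFun := PowerSeries.coeff k
  map_add' := map_add _
  map_smul' r f := PowerSeries.coeff_smul k f r

/-- The linear map `t ↦ ħ^k E(t)`. -/
def monomialLin (k : ℕ) (E : R →ₗ[ℝ] S) : R →ₗ[ℝ] S⟦X⟧ where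
  toFun t := PowerSeries.monomial k (E t)
  map_add' s t := by rw [map_add, map_add]
  map_smul' r t := by
    ext j
    simp only [map_smul, PowerSeries.coeff_monomial, RingHom.id_apply, PowerSeries.coeff_smul]
    split_ifs <;> simp

lemma coeff_monomialLin (j k : ℕ) (E : R →ₗ[ℝ] S) (t : R) :
    PowerSeries.coeff j (monomialLin k E t) = if j = k then E t else 0 :=
  PowerSeries.coeff_monomial _ _ _

lemma coeff_hat_monomialLin_of_lt {j k : ℕ} (h : j < k) (E : R →ₗ[ℝ] S) (f : R⟦X⟧) :
    PowerSeries.coeff j (hat (monomialLin k E) f) = 0 := by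
  rw [coeff_hat]
  refine Finset.sum_eq_zero fun p hp => ?_
  have := Finset.HasAntidiagonal.mem_antidiagonal.1 hp
  rw [coeff_monomialLin, if_neg (by omega)]

lemma coeff_hat_monomialLin_self (k : ℕ) (E : R →ₗ[ℝ] S) (f : R⟦X⟧) :
    PowerSeries.coeff k (hat (monomialLin k E) f) = E (PowerSeries.coeff 0 f) := by
  rw [coeff_hat, Finset.sum_eq_single (k, 0)]
  · simp [coeff_monomialLin]
  · rintro ⟨i, j⟩ hij hne
    rw [coeff_monomialLin, if_neg]
    rintro rfl
    simp at hij; simp [hij] at hne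
  · simp

lemma hat_add (L L' : R →ₗ[ℝ] S⟦X⟧) (f : R⟦X⟧) : hat (L + L') f = hat L f + hat L' f := by
  ext k; simp [coeff_hat, Finset.sum_add_distrib]

end Hat

/-! ### The PBW map -/

variable {n : ℕ}

/-- Conditions under which `H` has the PBW property. -/
structure PBWCondition (π : Cochain n W) (b : Cochain n ℝ) : Prop where
  alt_left : ∀ g, (π g).IsAlt
  alt_right : ∀ g, (b g).IsAlt
  inv_left : ∀ g h x y,
    wrep n g (π h (wrep n g⁻¹ x) (wrep n g⁻¹ y)) = π (g * h * g⁻¹) x y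
  inv_right : ∀ g h x y, b h (wrep n g⁻¹ x) (wrep n g⁻¹ y) = b (g * h * g⁻¹) x y
  symm : SymmCondition π
  dbl_left : ∀ g x y z, dblBracket π π g x y z = (2 : ℝ) • koszul g (b g) x y z
  dbl_right : ∀ g x y z, dblBracket b π g x y z = 0

/-- The inclusion of `T(V*)` into `S(V*) ⋊ Γ_n` through `S(V*)`. -/
def tensorToCross (n : ℕ) : TensorAlgebra ℝ W →ₐ[ℝ] SCross n where
  __ := (SkewMonoidAlgebra.singleOneRingHom : SymmetricAlgebra ℝ W →+* SCross n).comp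
    (SymmetricAlgebra.algHom ℝ W).toRingHom
  commutes' r := by
    change SkewMonoidAlgebra.single 1 (SymmetricAlgebra.algHom ℝ W (algebraMap ℝ _ r)) = _
    rw [AlgHom.commutes, SkewMonoidAlgebra.coe_algebraMap]; rfl

lemma tensorToCross_apply (t : TensorAlgebra ℝ W) :
    tensorToCross n t = SkewMonoidAlgebra.single 1 (SymmetricAlgebra.algHom ℝ W t) := rfl

lemma algHom_smul (g : Gam n) (t : TensorAlgebra ℝ W) :
    SymmetricAlgebra.algHom ℝ W (g • t) = g • SymmetricAlgebra.algHom ℝ W t := by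
  induction t using TensorAlgebra.induction with
  | algebraMap r => simp [smul_algebraMap]
  | ι x =>
    rw [smul_tensorAlgebra_ι]
    exact (smul_symmetricAlgebra_ι g x).symm
  | mul a b ha hb => rw [smul_mul', map_mul, ha, hb, map_mul, smul_mul']
  | add a b ha hb => rw [smul_add, map_add, ha, hb, map_add, smul_add]

/-- The canonical map `T(V*) ⋊ Γ_n → S(V*) ⋊ Γ_n`. -/
def canon (n : ℕ) : TCross n →ₐ[ℝ] SCross n :=
  SkewMonoidAlgebra.liftNCAlgHom (tensorToCross n)
    (SkewMonoidAlgebra.of (SymmetricAlgebra ℝ W) (Gam n)) (by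
      intro t g
      rw [tensorToCross_apply, tensorToCross_apply, SkewMonoidAlgebra.of_apply,
        SkewMonoidAlgebra.single_mul_single, SkewMonoidAlgebra.single_mul_single, algHom_smul]
      simp)

lemma canon_single (g : Gam n) (t : TensorAlgebra ℝ W) :
    canon n (SkewMonoidAlgebra.single g t) =
      SkewMonoidAlgebra.single g (SymmetricAlgebra.algHom ℝ W t) := by
  have : canon n (SkewMonoidAlgebra.single g t) = tensorToCross n t *
      SkewMonoidAlgebra.of (SymmetricAlgebra ℝ W) (Gam n) g :=
    SkewMonoidAlgebra.liftNC_single _ _ _ _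
  rw [this, tensorToCross_apply, SkewMonoidAlgebra.of_apply, SkewMonoidAlgebra.single_mul_single]
  simp

/-- `L` kills the relations modulo `ħ^k`. -/
def KillsRelations (π : Cochain n W) (b : Cochain n ℝ) (k : ℕ)
    (L : TCross n →ₗ[ℝ] (SCross n)⟦X⟧) : Prop :=
  ∀ P Q x y, ∀ j < k, PowerSeries.coeff j (hat L (P * relation π b x y * Q)) = 0

variable {π : Cochain n W} {b : Cochain n ℝ}

lemma mul_mul_eq_of_split {R : Type*} [Ring R] (P Q : R⟦X⟧) {r : R⟦X⟧} :
    P * r * Q = PowerSeries.X * ((PowerSeries.mk fun p => PowerSeries.coeff (p + 1) P) * r * Q +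
      PowerSeries.C (PowerSeries.constantCoeff P) * r *
        PowerSeries.mk fun p => PowerSeries.coeff (p + 1) Q) +
      PowerSeries.C (PowerSeries.constantCoeff P) * r *
        PowerSeries.C (PowerSeries.constantCoeff Q) := by
  set P' := PowerSeries.mk fun p => PowerSeries.coeff (p + 1) P with hP'
  set Q' := PowerSeries.mk fun p => PowerSeries.coeff (p + 1) Q with hQ'
  have hP : P = PowerSeries.X * P' + PowerSeries.C (PowerSeries.constantCoeff P) :=
    PowerSeries.eq_X_mul_shift_add_const P
  have hQ : Q = Q' * PowerSeries.X + PowerSeries.C (PowerSeries.constantCoeff Q) :=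
    PowerSeries.eq_shift_mul_X_add_const Q
  rw [mul_add, PowerSeries.X_mul (φ := _ * Q')]
  conv_lhs => rw [hP, add_mul, add_mul]
  conv_lhs => enter [2]; rw [hQ]
  simp only [mul_add, mul_assoc, add_assoc]

/-- By `mul_mul_eq_of_split`, whatever is not constant in `P` or `Q` carries a factor ħ, which
lowers the order to be checked by one; induct on the order. -/
lemma killsRelations_of_C {k : ℕ} {L : TCross n →ₗ[ℝ] (SCross n)⟦X⟧}
    (h : ∀ p q x y, ∀ j < k, PowerSeries.coeff j
      (hat L (PowerSeries.C p * relation π b x y * PowerSeries.C q)) = 0) :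
    KillsRelations π b k L := by
  intro P Q x y j
  induction j generalizing P Q with
  | zero =>
    intro hj
    rw [mul_mul_eq_of_split P Q, map_add, map_add, h _ _ _ _ _ hj, hat_X_mul]
    simp
  | succ j ih =>
    intro hj
    rw [mul_mul_eq_of_split P Q, map_add, map_add, h _ _ _ _ _ hj, hat_X_mul,
      PowerSeries.coeff_succ_X_mul, map_add, map_add, ih _ _ (by omega), ih _ _ (by omega)]
    simp

/-- A factor ħ gains one order. Hence, when the obstruction in order k is examined, every term
ħ·(relation) may be dropped. -/
lemma KillsRelations.coeff_X_mul {k : ℕ} {L : TCross n →ₗ[ℝ] (SCross n)⟦X⟧}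
    (h : KillsRelations π b k L) (P Q : (TCross n)⟦X⟧) (x y : W) :
    PowerSeries.coeff k (hat L (PowerSeries.X * (P * relation π b x y * Q))) = 0 := by
  rw [hat_X_mul]
  cases k with
  | zero => simp
  | succ k => rw [PowerSeries.coeff_succ_X_mul]; exact h _ _ _ _ _ (by omega)

/-- The obstruction in degree `k`, as a multilinear map. -/
def obstruction (π : Cochain n W) (b : Cochain n ℝ) (k : ℕ)
    (L : TCross n →ₗ[ℝ] (SCross n)⟦X⟧) (g : Gam n) :
    TensorAlgebra ℝ W →ₗ[ℝ] W →ₗ[ℝ] W →ₗ[ℝ] TensorAlgebra ℝ W →ₗ[ℝ] SCross n :=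
  LinearMap.mk₂ ℝ (fun p x => LinearMap.mk₂ ℝ
    (fun y q => -(coeffLin k ∘ₗ hat L)
      (tensorIncl n p * relation π b x y * (tensorIncl n q * grpT g)))
    (fun y y' q => by rw [relation_add_right, mul_add, add_mul, map_add, neg_add])
    (fun r y q => by rw [relation_smul_right, mul_smul_comm, smul_mul_assoc, map_smul, smul_neg])
    (fun y q q' => by rw [map_add, add_mul, mul_add, map_add, neg_add])
    (fun r y q => by rw [map_smul, smul_mul_assoc, mul_smul_comm, map_smul, smul_neg]))
    (fun p p' x => by
      ext y q; simp only [LinearMap.mk₂_apply, LinearMap.add_apply]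
      rw [map_add, add_mul, add_mul, map_add, neg_add])
    (fun r p x => by
      ext y q; simp only [LinearMap.mk₂_apply, LinearMap.smul_apply]
      rw [map_smul, smul_mul_assoc, smul_mul_assoc, map_smul, smul_neg])
    (fun p x x' => by
      ext y q; simp only [LinearMap.mk₂_apply, LinearMap.add_apply]
      rw [relation_add_left, mul_add, add_mul, map_add, neg_add])
    (fun r p x => by
      ext y q; simp only [LinearMap.mk₂_apply, LinearMap.smul_apply]
      rw [relation_smul_left, mul_smul_comm, smul_mul_assoc, map_smul, smul_neg])

lemma obstruction_apply (k : ℕ) (L : TCross n →ₗ[ℝ] (SCross n)⟦X⟧) (g : Gam n)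
    (p q : TensorAlgebra ℝ W) (x y : W) :
    obstruction π b k L g p x y q = -PowerSeries.coeff k (hat L
      (tensorIncl n p * relation π b x y * (tensorIncl n q * grpT g))) := rfl

lemma relation_self (hπ : ∀ g, (π g).IsAlt) (hb : ∀ g, (b g).IsAlt) (x : W) :
    relation π b x x = 0 := by
  have h1 : ∀ g, π g x x = 0 := fun g => hπ g x
  have h2 : ∀ g, b g x x = 0 := fun g => hb g x
  simp [relation_eq, defTerm, h1, h2]

lemma tensorIncl_commutator (x y : W) :
    tensorIncl n (TensorAlgebra.ι ℝ x * TensorAlgebra.ι ℝ y -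
      TensorAlgebra.ι ℝ y * TensorAlgebra.ι ℝ x) =
      relation π b x y + PowerSeries.X * defTerm π b x y := by
  rw [relation_eq, map_sub, map_mul, map_mul]
  simp [tensorIncl_ι]

/-- The obstruction in each degree vanishes. -/
theorem exists_correction_aux (hc : PBWCondition π b) {k : ℕ}
    {L : TCross n →ₗ[ℝ] (SCross n)⟦X⟧} (hL : KillsRelations π b k L) (g : Gam n) :
    ∃ E : TensorAlgebra ℝ W →ₗ[ℝ] SCross n,
      (∀ p x y q, E (p * (TensorAlgebra.ι ℝ x * TensorAlgebra.ι ℝ y -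
        TensorAlgebra.ι ℝ y * TensorAlgebra.ι ℝ x) * q) = -PowerSeries.coeff k (hat L
          (tensorIncl n p * relation π b x y * (tensorIncl n q * grpT g)))) ∧
      E 1 = 0 ∧ ∀ x, E (TensorAlgebra.ι ℝ x) = 0 := by
  refine exists_extension (obstruction π b k L g) ?_ ?_ ?_
  · intro p x q
    simp [obstruction_apply, relation_self hc.alt_left hc.alt_right]
  · intro p x y q z w t
    rw [obstruction_apply, obstruction_apply, neg_inj, ← sub_eq_zero, ← map_sub, ← map_sub]
    simp only [map_mul, tensorIncl_commutator (π := π) (b := b)]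
    -- Each commutator is a relation plus ħ times the deformation term. The products containing both
    -- relations cancel, so the difference is ħ times multiples of relations.
    have h : tensorIncl n p * relation π b x y * (tensorIncl n q *
          (relation π b z w + PowerSeries.X * defTerm π b z w) * tensorIncl n t * grpT g) -
        tensorIncl n p * (relation π b x y + PowerSeries.X * defTerm π b x y) * tensorIncl n q *
          relation π b z w * (tensorIncl n t * grpT g) =
        PowerSeries.X * (tensorIncl n p * relation π b x y *
          (tensorIncl n q * defTerm π b z w * tensorIncl n t * grpT g)) -
        PowerSeries.X * ((tensorIncl n p * defTerm π b x y * tensorIncl n q) *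
          relation π b z w * (tensorIncl n t * grpT g)) := by
      simp only [mul_add, add_mul, ← mul_assoc, ← PowerSeries.X_mul]
      simp only [mul_assoc, PowerSeries.X_mul]
      abel
    rw [h, map_sub, map_sub, hL.coeff_X_mul, hL.coeff_X_mul, sub_zero]
  · intro p x y z q
    simp only [obstruction_apply, map_mul, tensorIncl_ι]
    have h := relation_commutator π b x y z
    rw [defTerm_commutator π b hc.alt_right hc.symm] at h
    simp only [hc.dbl_left, hc.dbl_right] at h
    -- Under the PBW conditions the terms with the double brackets disappear, and only ħ times a sum
    -- of relations is left.
    have h2 : ∀ v : W, (1 / 2 : ℝ) • (2 : ℝ) • v - v = 0 := fun v => by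
      rw [smul_smul]; norm_num
    simp only [h2, map_zero, zero_mul, Finset.sum_const_zero, mul_zero, zero_smul, add_zero] at h
    have h3 := congrArg (fun f => PowerSeries.coeff k (hat L
      (tensorIncl n p * f * (tensorIncl n q * grpT g)))) h
    have h4 : ∀ x y z : W, PowerSeries.coeff k (hat L (PowerSeries.X *
        (tensorIncl n p * (∑ g : Gam n, relation π b (π g x y) (z + wrep n g z) * grpT g) *
          (tensorIncl n q * grpT g)))) = 0 := by
      intro x y z
      simp only [Finset.mul_sum, Finset.sum_mul, map_sum]
      refine Finset.sum_eq_zero fun h _ => ?_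
      rw [← mul_assoc (tensorIncl n p), mul_assoc _ (grpT h)]
      exact hL.coeff_X_mul _ _ _ _
    have h5 : ∀ a f c : (TCross n)⟦X⟧, a * (PowerSeries.X * ((1 / 2 : ℝ) • f)) * c =
        (1 / 2 : ℝ) • (PowerSeries.X * (a * f * c)) := by
      intro a f c
      rw [mul_smul_comm, mul_smul_comm, smul_mul_assoc, ← mul_assoc a, ← PowerSeries.X_mul]
      simp only [mul_assoc]
    rw [mul_add, add_mul, h5, mul_zero, zero_mul, map_zero, map_zero, map_add, map_add, map_smul,
      PowerSeries.coeff_smul] at h3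
    have h6 : ∀ u v w s c : (TCross n)⟦X⟧, PowerSeries.X * (s * (u + v + w) * c) =
        PowerSeries.X * (s * u * c) + PowerSeries.X * (s * v * c) +
          PowerSeries.X * (s * w * c) := by
      intro u v w s c
      simp only [mul_add, add_mul]
    rw [h6, map_add, map_add, map_add, map_add, h4, h4, h4, add_zero, add_zero, smul_zero,
      add_zero] at h3
    rw [← neg_eq_zero, ← h3]
    simp only [mul_add, add_mul, map_add, mul_sub, sub_mul, map_sub, mul_assoc]
    abel

/-- The corrections on the components T(V*)γ are independent and are simply added up. A group
element to the left of a relation is moved to its right using invariance, which reduces the general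
case to the one treated componentwise. -/
theorem exists_correction (hc : PBWCondition π b) {k : ℕ}
    {L : TCross n →ₗ[ℝ] (SCross n)⟦X⟧} (hL : KillsRelations π b k L) :
    ∃ E : TCross n →ₗ[ℝ] SCross n, KillsRelations π b (k + 1) (L + monomialLin k E) ∧
      (∀ g, E (SkewMonoidAlgebra.single g 1) = 0) ∧
      ∀ g x, E (SkewMonoidAlgebra.single g (TensorAlgebra.ι ℝ x)) = 0 := by
  choose E hE hE0 hE1 using exists_correction_aux hc hL
  -- The component of `f` at `g` is corrected by `E g`.
  let F : TCross n →ₗ[ℝ] SCross n :=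
    { toFun := fun f => ∑ g : Gam n, E g (f.coeff g)
      map_add' := fun f f' => by simp [Finset.sum_add_distrib]
      map_smul' := fun r f => by simp [Finset.smul_sum] }
  have hF : ∀ g t, F (SkewMonoidAlgebra.single g t) = E g t := by
    intro g t
    change ∑ h : Gam n, E h ((SkewMonoidAlgebra.single g t).coeff h) = _
    rw [Finset.sum_eq_single g]
    · simp
    · intro h _ hne
      rw [SkewMonoidAlgebra.coeff_single, Finsupp.single_eq_of_ne hne, map_zero]
    · simp
  refine ⟨F, killsRelations_of_C ?_, fun g => by rw [hF, hE0], fun g x => by rw [hF, hE1]⟩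
  intro p q x y j hj
  rw [hat_add, map_add]
  rcases Nat.lt_succ_iff_lt_or_eq.1 hj with hj | rfl
  · rw [hL _ _ _ _ _ hj, coeff_hat_monomialLin_of_lt hj, add_zero]
  rw [coeff_hat_monomialLin_self]
  have h0 : PowerSeries.coeff 0 (PowerSeries.C p * relation π b x y * PowerSeries.C q) =
      p * SkewMonoidAlgebra.single 1 (TensorAlgebra.ι ℝ x * TensorAlgebra.ι ℝ y -
        TensorAlgebra.ι ℝ y * TensorAlgebra.ι ℝ x) * q := by
    simp [relation]
  rw [h0]
  clear h0
  induction p using SkewMonoidAlgebra.induction_on with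
  | zero => simp
  | add p p' hp hp' =>
    rw [map_add, add_mul, add_mul, add_mul, add_mul, map_add, map_add, map_add, add_add_add_comm,
      hp, hp', add_zero]
  | single g p =>
  induction q using SkewMonoidAlgebra.induction_on with
  | zero => simp
  | add q q' hq hq' =>
    rw [map_add, mul_add, mul_add, map_add, map_add, map_add, add_add_add_comm, hq, hq', add_zero]
  | single h q =>
  rw [SkewMonoidAlgebra.single_mul_single, SkewMonoidAlgebra.single_mul_single, hF, smul_sub,
    smul_mul', smul_mul', smul_tensorAlgebra_ι, smul_tensorAlgebra_ι, mul_one, hE, C_single,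
    C_single, mul_assoc (tensorIncl n p), grpT_mul_relation hc.inv_left hc.inv_right]
  simp only [mul_assoc]
  rw [← mul_assoc (grpT g), grpT_mul_tensorIncl, mul_assoc, grpT_mul, add_neg_cancel]

end

end DihedralQuant

namespace DihedralQuant

noncomputable section

variable {n : ℕ} {π : Cochain n W} {b : Cochain n ℝ}

/-! ### The limit of the approximations and its average over the group -/

instance (n : ℕ) : SMulCommClass ℝ (SCross n)⟦X⟧ (SCross n)⟦X⟧ := Algebra.to_smulCommClass

instance (n : ℕ) : IsScalarTower ℝ (SCross n)⟦X⟧ (SCross n)⟦X⟧ := IsScalarTower.right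

/-- Approximations of the PBW map: maps that kill the relations modulo `ħ^(k+1)`, reduce to the
canonical map and are normalized on `Γ_n` and `V*`. -/
structure IsPBWApprox (π : Cochain n W) (b : Cochain n ℝ) (k : ℕ)
    (L : TCross n →ₗ[ℝ] (SCross n)⟦X⟧) : Prop where
  kills : KillsRelations π b (k + 1) L
  coeff_zero : ∀ t, PowerSeries.coeff 0 (L t) = canon n t
  map_grp : ∀ g, L (SkewMonoidAlgebra.single g 1) = PowerSeries.C (SkewMonoidAlgebra.single g 1)
  map_vec : ∀ g x, L (SkewMonoidAlgebra.single g (TensorAlgebra.ι ℝ x)) =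
    PowerSeries.C (SkewMonoidAlgebra.single g (SymmetricAlgebra.ι ℝ W x))

lemma canon_relation_coeff_zero (P Q : (TCross n)⟦X⟧) (x y : W) :
    canon n (PowerSeries.coeff 0 (P * relation π b x y * Q)) = 0 := by
  have h : PowerSeries.coeff 0 (P * relation π b x y * Q) = PowerSeries.coeff 0 P *
      SkewMonoidAlgebra.single 1 (TensorAlgebra.ι ℝ x * TensorAlgebra.ι ℝ y -
        TensorAlgebra.ι ℝ y * TensorAlgebra.ι ℝ x) * PowerSeries.coeff 0 Q := by
    simp [relation]
  rw [h, map_mul, map_mul, canon_single, map_sub, map_mul, map_mul, mul_comm, sub_self]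
  simp

lemma isPBWApprox_zero : IsPBWApprox π b 0 (monomialLin 0 (canon n).toLinearMap) where
  kills P Q x y j hj := by
    obtain rfl : j = 0 := by omega
    rw [coeff_hat_monomialLin_self]
    exact canon_relation_coeff_zero P Q x y
  coeff_zero t := by rw [coeff_monomialLin]; rfl
  map_grp g := by
    change PowerSeries.monomial 0 (canon n _) = _
    rw [canon_single, map_one, PowerSeries.monomial_zero_eq_C_apply]
  map_vec g x := by
    change PowerSeries.monomial 0 (canon n _) = _
    rw [canon_single, PowerSeries.monomial_zero_eq_C_apply]; rfl

/-- The correction sits in degree k + 1 only and vanishes on words of length at most one, so neither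
the lower coefficients nor the normalizations are disturbed. -/
lemma IsPBWApprox.exists_succ (hc : PBWCondition π b) {k : ℕ}
    {L : TCross n →ₗ[ℝ] (SCross n)⟦X⟧} (hL : IsPBWApprox π b k L) :
    ∃ L', IsPBWApprox π b (k + 1) L' ∧
      ∀ j ≤ k, ∀ t, PowerSeries.coeff j (L' t) = PowerSeries.coeff j (L t) := by
  obtain ⟨E, hE, hE0, hE1⟩ := exists_correction hc hL.kills
  have h : ∀ j ≤ k, ∀ t, PowerSeries.coeff j ((L + monomialLin (k + 1) E) t) =
      PowerSeries.coeff j (L t) := fun j hj t => by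
    rw [LinearMap.add_apply, map_add, coeff_monomialLin, if_neg (by omega), add_zero]
  refine ⟨L + monomialLin (k + 1) E, ⟨hE, fun t => ?_, fun g => ?_, fun g x => ?_⟩, h⟩
  · rw [h 0 (by omega), hL.coeff_zero]
  · change L _ + PowerSeries.monomial (k + 1) (E _) = _
    rw [hE0, map_zero, add_zero, hL.map_grp]
  · change L _ + PowerSeries.monomial (k + 1) (E _) = _
    rw [hE1, map_zero, add_zero, hL.map_vec]

lemma exists_isPBWApprox_all (hc : PBWCondition π b) :
    ∃ L : TCross n →ₗ[ℝ] (SCross n)⟦X⟧, ∀ k, IsPBWApprox π b k L := by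
  choose f hf hf' using fun (k : ℕ) (L : {L // IsPBWApprox π b k L}) => L.2.exists_succ hc
  let s : ∀ k, {L // IsPBWApprox π b k L} := fun k =>
    Nat.rec ⟨_, isPBWApprox_zero⟩ (fun k L => ⟨f k L, hf k L⟩) k
  have hs : ∀ k m, ∀ j ≤ k, ∀ t, PowerSeries.coeff j ((s (k + m)).1 t) =
      PowerSeries.coeff j ((s k).1 t) := by
    intro k m
    induction m with
    | zero => intro j _ t; rfl
    | succ m ih =>
      intro j hj t
      rw [← ih j hj t]
      exact hf' (k + m) (s (k + m)) j (by omega) t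
  -- Diagonal limit: the coefficient of ħ^k no longer changes after stage k.
  let L : TCross n →ₗ[ℝ] (SCross n)⟦X⟧ :=
    { toFun := fun t => PowerSeries.mk fun k => PowerSeries.coeff k ((s k).1 t)
      map_add' := fun t t' => by ext k; simp
      map_smul' := fun r t => by ext k; simp }
  have hL : ∀ k t, PowerSeries.coeff k (L t) = PowerSeries.coeff k ((s k).1 t) :=
    fun k t => by simp [L]
  refine ⟨L, fun k => ⟨fun P Q x y j _ => ?_, fun t => ?_, fun g => ?_, fun g x => ?_⟩⟩
  · rw [coeff_hat_congr (L' := (s j).1)]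
    · exact (s j).2.kills _ _ _ _ _ (by omega)
    · intro i hi t
      obtain ⟨m, rfl⟩ := Nat.exists_eq_add_of_le hi
      rw [hL, hs _ _ _ le_rfl]
  · rw [hL, (s 0).2.coeff_zero]
  · ext j : 1
    rw [hL, (s j).2.map_grp]
  · ext j : 1
    rw [hL, (s j).2.map_vec]

/-- A PBW map: a map `T(V*) ⋊ Γ_n → (S(V*) ⋊ Γ_n)[[ħ]]` of `Γ_n`-bimodules that kills the
relations and reduces to the canonical map. -/
structure IsPBWMap (π : Cochain n W) (b : Cochain n ℝ)
    (L : TCross n →ₗ[ℝ] (SCross n)⟦X⟧) : Prop where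
  kills : ∀ P Q x y, hat L (P * relation π b x y * Q) = 0
  coeff_zero : ∀ t, PowerSeries.coeff 0 (L t) = canon n t
  map_one : L 1 = 1
  map_vec : ∀ x, L (SkewMonoidAlgebra.single 1 (TensorAlgebra.ι ℝ x)) = PowerSeries.C (xS n x)
  map_left : ∀ g t, L (SkewMonoidAlgebra.single g 1 * t) = PowerSeries.C (gS g) * L t
  map_right : ∀ g t, L (t * SkewMonoidAlgebra.single g 1) = L t * PowerSeries.C (gS g)

lemma gS_mul (g h : Gam n) : gS g * gS h = gS (g * h) := by
  simp [gS, SkewMonoidAlgebra.single_mul_single]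

lemma gS_one : gS (1 : Gam n) = 1 := SkewMonoidAlgebra.single_one_one

/-- The translate `t ↦ g⁻¹ L(g t h) h⁻¹`. -/
def translate (L : TCross n →ₗ[ℝ] (SCross n)⟦X⟧) (g h : Gam n) :
    TCross n →ₗ[ℝ] (SCross n)⟦X⟧ :=
  LinearMap.mulLeftRight ℝ (PowerSeries.C (gS g⁻¹), PowerSeries.C (gS h⁻¹)) ∘ₗ L ∘ₗ
    LinearMap.mulLeftRight ℝ (SkewMonoidAlgebra.single g 1, SkewMonoidAlgebra.single h 1)

lemma translate_apply (L : TCross n →ₗ[ℝ] (SCross n)⟦X⟧) (g h : Gam n) (t : TCross n) :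
    translate L g h t = PowerSeries.C (gS g⁻¹) *
      L (SkewMonoidAlgebra.single g 1 * t * SkewMonoidAlgebra.single h 1) *
        PowerSeries.C (gS h⁻¹) := rfl

lemma hat_translate (L : TCross n →ₗ[ℝ] (SCross n)⟦X⟧) (g h : Gam n) (f : (TCross n)⟦X⟧) :
    hat (translate L g h) f = PowerSeries.C (gS g⁻¹) * hat L (grpT g * f * grpT h) *
      PowerSeries.C (gS h⁻¹) := by
  let G : (TCross n)⟦X⟧ →+ (SCross n)⟦X⟧ :=
    { toFun := fun f => PowerSeries.C (gS g⁻¹) * hat L (grpT g * f * grpT h) *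
        PowerSeries.C (gS h⁻¹)
      map_zero' := by simp
      map_add' := fun f f' => by simp only [mul_add, add_mul, map_add] }
  refine (hat_unique _ G (fun f => ?_) (fun t => ?_) f).symm
  · change PowerSeries.C (gS g⁻¹) * hat L (grpT g * (PowerSeries.X * f) * grpT h) *
        PowerSeries.C (gS h⁻¹) = PowerSeries.X * (PowerSeries.C (gS g⁻¹) *
          hat L (grpT g * f * grpT h) * PowerSeries.C (gS h⁻¹))
    rw [← mul_assoc (grpT g), ← PowerSeries.X_mul, mul_assoc PowerSeries.X, mul_assoc PowerSeries.X, hat_X_mul,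
      ← mul_assoc _ PowerSeries.X, ← PowerSeries.X_mul]
    simp only [mul_assoc]
  · change PowerSeries.C (gS g⁻¹) * hat L (grpT g * PowerSeries.C t * grpT h) *
        PowerSeries.C (gS h⁻¹) = _
    rw [grpT, grpT, ← map_mul, ← map_mul, hat_C, translate_apply]

/-- Average the translates over Γ_n × Γ_n. Each translate still kills the relations, since group
elements can be absorbed into `P` and `Q`. The normalizations on γ and on xγ make every translate
fix 1 and V*, hence so does the average. -/
theorem exists_isPBWMap (hc : PBWCondition π b) : ∃ L, IsPBWMap π b L := by
  obtain ⟨L, hL⟩ := exists_isPBWApprox_all hc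
  set N : ℝ := ((Fintype.card (Gam n) : ℕ) : ℝ) with hN
  have hN0 : N ≠ 0 := by rw [hN]; exact_mod_cast Fintype.card_ne_zero
  have avg : ∀ {U : Type} [AddCommGroup U] [Module ℝ U] (F : Gam n → Gam n → U) (u : U),
      (∀ g h, F g h = u) → (N⁻¹ * N⁻¹) • ∑ g, ∑ h, F g h = u := by
    intro U _ _ F u hF
    simp only [hF, Finset.sum_const, Finset.card_univ, ← Nat.cast_smul_eq_nsmul ℝ, smul_smul, ← hN]
    rw [show N⁻¹ * N⁻¹ * (N * N) = 1 by field_simp, one_smul]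
  let M : TCross n →ₗ[ℝ] (SCross n)⟦X⟧ := (N⁻¹ * N⁻¹) • ∑ g, ∑ h, translate L g h
  have hM : ∀ t, M t = (N⁻¹ * N⁻¹) • ∑ g, ∑ h, translate L g h t := fun t => by
    simp only [M, LinearMap.smul_apply, LinearMap.sum_apply]
  refine ⟨M, fun P Q x y => ?_, fun t => ?_, ?_, fun x => ?_, fun a t => ?_, fun a t => ?_⟩
  · have h0 : ∀ g h, hat (translate L g h) (P * relation π b x y * Q) = 0 := by
      intro g h
      rw [hat_translate, ← mul_assoc (grpT g), ← mul_assoc (grpT g), mul_assoc _ Q]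
      have : hat L (grpT g * P * relation π b x y * (Q * grpT h)) = 0 := by
        ext j
        rw [(hL j).kills _ _ _ _ _ (by omega), map_zero]
      rw [this, mul_zero, zero_mul]
    ext k : 1
    rw [coeff_hat]
    simp only [hM, PowerSeries.coeff_smul, map_sum]
    rw [← Finset.smul_sum, Finset.sum_comm]
    simp only [Finset.sum_comm (s := Finset.HasAntidiagonal.antidiagonal k), ← coeff_hat, h0,
      map_zero, Finset.sum_const_zero, smul_zero]
  · rw [hM, PowerSeries.coeff_smul, map_sum]
    simp only [map_sum]
    refine avg _ _ fun g h => ?_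
    rw [translate_apply, PowerSeries.coeff_mul_C, PowerSeries.coeff_C_mul, (hL 0).coeff_zero,
      map_mul, map_mul, canon_single, canon_single, map_one]
    change gS g⁻¹ * (gS g * _ * gS h) * gS h⁻¹ = _
    rw [← mul_assoc, ← mul_assoc, gS_mul, inv_mul_cancel, gS_one, one_mul, mul_assoc, gS_mul,
      mul_inv_cancel, gS_one, mul_one]
  · rw [hM]
    refine avg _ _ fun g h => ?_
    rw [translate_apply, mul_one, SkewMonoidAlgebra.single_mul_single, smul_one, mul_one,
      (hL 0).map_grp, ← map_mul, ← map_mul]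
    change PowerSeries.C (gS g⁻¹ * gS (g * h) * gS h⁻¹) = 1
    rw [gS_mul, gS_mul]
    simp [gS_one]
  · rw [hM]
    refine avg _ _ fun g h => ?_
    rw [translate_apply, SkewMonoidAlgebra.single_mul_single, SkewMonoidAlgebra.single_mul_single,
      smul_one, mul_one, one_mul, mul_one, smul_tensorAlgebra_ι, (hL 0).map_vec, ← map_mul,
      ← map_mul, gS, gS, SkewMonoidAlgebra.single_mul_single, SkewMonoidAlgebra.single_mul_single,
      smul_symmetricAlgebra_ι, ← wrep_mul_apply, smul_one, mul_one, one_mul, inv_mul_cancel,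
      wrep_one_apply, xS]
    simp
  · rw [hM, hM, mul_smul_comm, Finset.mul_sum]
    congr 1
    -- Left multiplication by `a` is absorbed by the substitution g ↦ ga in the average.
    refine Fintype.sum_equiv (Equiv.mulRight a) _ _ fun g => ?_
    rw [Finset.mul_sum]
    refine Finset.sum_congr rfl fun h _ => ?_
    rw [translate_apply, translate_apply, ← mul_assoc (PowerSeries.C (gS a)),
      ← mul_assoc (PowerSeries.C (gS a)), ← map_mul, gS_mul, ← mul_assoc (SkewMonoidAlgebra.single g 1),
      SkewMonoidAlgebra.single_mul_single]
    simp
  · rw [hM, hM, smul_mul_assoc, Finset.sum_mul]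
    congr 1
    refine Finset.sum_congr rfl fun g _ => ?_
    rw [Finset.sum_mul]
    refine Fintype.sum_equiv (Equiv.mulLeft a) _ _ fun h => ?_
    rw [translate_apply, translate_apply, mul_assoc _ (PowerSeries.C _) (PowerSeries.C _),
      ← map_mul, gS_mul, ← mul_assoc (SkewMonoidAlgebra.single g 1),
      mul_assoc _ (SkewMonoidAlgebra.single a 1), SkewMonoidAlgebra.single_mul_single]
    simp

end

end DihedralQuant

namespace DihedralQuant

noncomputable section

variable {n : ℕ} {π : Cochain n W} {b : Cochain n ℝ}

/-! ### The isomorphism between `H` and `(S(V*) ⋊ Γ_n)[[ħ]]` -/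

lemma mem_adicClosure {R : Type} [Ring R] {I : TwoSidedIdeal R⟦X⟧} {f : R⟦X⟧} :
    f ∈ adicClosure I ↔ ∀ N : ℕ, ∃ h : R⟦X⟧, f - PowerSeries.X ^ N * h ∈ I :=
  TwoSidedIdeal.mem_mk' _ _ _ _ _ _ _

lemma le_adicClosure {R : Type} [Ring R] {I : TwoSidedIdeal R⟦X⟧} {f : R⟦X⟧} (hf : f ∈ I) :
    f ∈ adicClosure I :=
  mem_adicClosure.2 fun N => ⟨0, by simpa using hf⟩

lemma relation_mem (π : Cochain n W) (b : Cochain n ℝ) (x y : W) :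
    relation π b x y ∈ relIdeal π b :=
  le_adicClosure (TwoSidedIdeal.subset_span ⟨x, y, rfl⟩)

lemma toH_eq_zero_iff {f : (TCross n)⟦X⟧} : toH π b f = 0 ↔ f ∈ relIdeal π b :=
  (RingCon.eq _).trans (TwoSidedIdeal.mem_iff _ _).symm

lemma toH_surjective : Function.Surjective (toH π b) := RingCon.mk'_surjective _

lemma hat_X_pow_mul (L : TCross n →ₗ[ℝ] (SCross n)⟦X⟧) (N : ℕ) (f : (TCross n)⟦X⟧) :
    hat L (PowerSeries.X ^ N * f) = PowerSeries.X ^ N * hat L f := by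
  induction N with
  | zero => rw [pow_zero, one_mul, pow_zero, one_mul]
  | succ N ih => rw [pow_succ', mul_assoc, hat_X_mul, ih, pow_succ', mul_assoc]

section PBWMap

variable {L : TCross n →ₗ[ℝ] (SCross n)⟦X⟧}

/-- The two-sided ideal is additively generated by the elements P·r·Q, which are killed by
assumption; `hat L` is ħ-adically continuous, so the closure is killed as well. -/
lemma IsPBWMap.hat_eq_zero (hL : IsPBWMap π b L) {f : (TCross n)⟦X⟧} (hf : f ∈ relIdeal π b) :
    hat L f = 0 := by
  have h1 : ∀ i ∈ TwoSidedIdeal.span {r | ∃ x y : W, r = relation π b x y}, hat L i = 0 := by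
    intro i hi
    rw [TwoSidedIdeal.mem_span_iff_mem_addSubgroup_closure] at hi
    induction hi using AddSubgroup.closure_induction with
    | mem x hx =>
      obtain ⟨_, ⟨P, -, _, ⟨x, y, rfl⟩, rfl⟩, Q, -, rfl⟩ := hx
      exact hL.kills P Q x y
    | zero => exact map_zero _
    | add x y _ _ hx hy => rw [map_add, hx, hy, add_zero]
    | neg x _ hx => rw [map_neg, hx, neg_zero]
  ext k
  obtain ⟨h, hh⟩ := mem_adicClosure.1 hf (k + 1)
  have h2 := h1 _ hh
  rw [map_sub, sub_eq_zero, hat_X_pow_mul] at h2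
  rw [h2, PowerSeries.coeff_X_pow_mul', if_neg (by omega), map_zero]

lemma IsPBWMap.coeff_zero_hat (hL : IsPBWMap π b L) (f : (TCross n)⟦X⟧) :
    PowerSeries.coeff 0 (hat L f) = canon n (PowerSeries.coeff 0 f) := by
  rw [coeff_hat]
  simp [hL.coeff_zero]

lemma canon_surjective : Function.Surjective (canon n) := by
  intro a
  induction a using SkewMonoidAlgebra.induction_on with
  | zero => exact ⟨0, map_zero _⟩
  | single g s =>
    obtain ⟨t, rfl⟩ := SymmetricAlgebra.algHom_surjective ℝ W s
    exact ⟨_, canon_single g t⟩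
  | add a a' ha ha' =>
    obtain ⟨t, rfl⟩ := ha
    obtain ⟨t', rfl⟩ := ha'
    exact ⟨t + t', map_add _ _ _⟩

lemma coeff_canon (t : TCross n) (g : Gam n) :
    (canon n t).coeff g = SymmetricAlgebra.algHom ℝ W (t.coeff g) := by
  classical
  induction t using SkewMonoidAlgebra.induction_on with
  | zero => rw [map_zero, SkewMonoidAlgebra.coeff_zero, SkewMonoidAlgebra.coeff_zero]; exact (map_zero _).symm
  | single h t =>
    rw [canon_single, SkewMonoidAlgebra.coeff_single, SkewMonoidAlgebra.coeff_single,
      Finsupp.single_apply, Finsupp.single_apply]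
    split_ifs
    · rfl
    · exact (map_zero _).symm
  | add a a' ha ha' =>
    rw [map_add, SkewMonoidAlgebra.coeff_add, SkewMonoidAlgebra.coeff_add, Finsupp.add_apply,
      Finsupp.add_apply, ha, ha', map_add]

lemma mem_sup_ker_iff {I : TwoSidedIdeal (TCross n)⟦X⟧} {f : (TCross n)⟦X⟧} :
    f ∈ I ⊔ TwoSidedIdeal.ker (PowerSeries.constantCoeff (R := TCross n)) ↔
      ∃ f', f - PowerSeries.X * f' ∈ I := by
  rw [TwoSidedIdeal.mem_sup]
  constructor
  · rintro ⟨i, hi, z, hz, rfl⟩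
    rw [TwoSidedIdeal.mem_ker] at hz
    refine ⟨PowerSeries.mk fun p => PowerSeries.coeff (p + 1) z, ?_⟩
    have := PowerSeries.eq_X_mul_shift_add_const z
    rw [hz, map_zero, add_zero] at this
    rwa [← this, add_sub_cancel_right]
  · rintro ⟨f', h⟩
    exact ⟨_, h, PowerSeries.X * f', by rw [TwoSidedIdeal.mem_ker]; simp, sub_add_cancel _ _⟩

/-- The kernel of the canonical map lies in the ideal of the relations modulo `ħ`. -/
lemma exists_of_canon_eq_zero (π : Cochain n W) (b : Cochain n ℝ) {f : (TCross n)⟦X⟧}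
    (hf : canon n (PowerSeries.coeff 0 f) = 0) :
    ∃ f', f - PowerSeries.X * f' ∈
      TwoSidedIdeal.span {r | ∃ x y : W, r = relation π b x y} := by
  rw [← mem_sup_ker_iff]
  set J := TwoSidedIdeal.span {r | ∃ x y : W, r = relation π b x y} ⊔
    TwoSidedIdeal.ker (PowerSeries.constantCoeff (R := TCross n)) with hJ
  have hX : ∀ g : (TCross n)⟦X⟧, PowerSeries.X * g ∈ J := fun g =>
    mem_sup_ker_iff.2 ⟨g, by rw [sub_self]; exact zero_mem _⟩
  have hT : ∀ t : TensorAlgebra ℝ W, SymmetricAlgebra.algHom ℝ W t = 0 → tensorIncl n t ∈ J := by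
    intro t ht
    have h1 := (RingCon.eq _).1 (ht.trans (map_zero (SymmetricAlgebra.algHom ℝ W)).symm)
    -- The symmetric algebra is the quotient by the congruence generated by xy ~ yx, so only these
    -- generators need checking; each commutator is a relation plus a multiple of ħ.
    have h2 : TensorAlgebra.symRingCon ℝ W ≤ (J.comap (tensorIncl n)).ringCon := by
      unfold TensorAlgebra.symRingCon
      refine RingCon.ringConGen_le.2 fun p q hpq => ?_
      induction hpq with | mul_comm x y
      rw [TwoSidedIdeal.rel_iff, TwoSidedIdeal.mem_comap, tensorIncl_commutator (π := π) (b := b)]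
      exact J.add_mem (TwoSidedIdeal.mem_sup_left (TwoSidedIdeal.subset_span ⟨x, y, rfl⟩)) (hX _)
    have h3 := h2 h1
    rw [TwoSidedIdeal.rel_iff, sub_zero] at h3
    rwa [TwoSidedIdeal.mem_comap] at h3
  rw [PowerSeries.eq_X_mul_shift_add_const f]
  refine J.add_mem (hX _) ?_
  rw [← PowerSeries.coeff_zero_eq_constantCoeff_apply]
  set t := PowerSeries.coeff 0 f
  have ht : t = ∑ g : Gam n, SkewMonoidAlgebra.single g (t.coeff g) := by
    conv_lhs => rw [← SkewMonoidAlgebra.sum_single t]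
    rw [SkewMonoidAlgebra.sum_def, Finsupp.sum_fintype]
    simp
  rw [ht, map_sum]
  refine TwoSidedIdeal.finsetSum_mem _ _ _ fun g _ => ?_
  rw [C_single]
  refine J.mul_mem_right _ _ (hT _ ?_)
  rw [← coeff_canon, hf, SkewMonoidAlgebra.coeff_zero, Finsupp.zero_apply]

/-- The constant term of `f` is killed by the canonical map, so modulo relations f = ħf', and f' is
again in the kernel because ħ is regular. Repeating this places `f` within ħ^N of the ideal for
every N; this is where the ħ-adic closure is needed. -/
lemma IsPBWMap.mem_of_hat_eq_zero (hL : IsPBWMap π b L) {f : (TCross n)⟦X⟧} (hf : hat L f = 0) :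
    f ∈ relIdeal π b := by
  refine mem_adicClosure.2 fun N => ?_
  induction N generalizing f with
  | zero => exact ⟨f, by simp⟩
  | succ N ih =>
    have h0 : canon n (PowerSeries.coeff 0 f) = 0 := by
      rw [← hL.coeff_zero_hat, hf, map_zero]
    obtain ⟨f', hf'⟩ := exists_of_canon_eq_zero π b h0
    have h1 : hat L f' = 0 := by
      have := hL.hat_eq_zero (le_adicClosure hf')
      rw [map_sub, hf, hat_X_mul, zero_sub, neg_eq_zero] at this
      exact PowerSeries.X_mul_cancel (this.trans (mul_zero _).symm)
    obtain ⟨h, hh⟩ := ih h1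
    refine ⟨h, ?_⟩
    have := TwoSidedIdeal.add_mem _ hf' (TwoSidedIdeal.mul_mem_left _ PowerSeries.X _ hh)
    rwa [mul_sub, sub_add_sub_cancel, ← mul_assoc, ← pow_succ'] at this

/-- The residual of `a` after subtracting the image of a lift of its constant coefficient. -/
def residual (L : TCross n →ₗ[ℝ] (SCross n)⟦X⟧) (a : (SCross n)⟦X⟧) : (SCross n)⟦X⟧ :=
  PowerSeries.mk fun k => PowerSeries.coeff (k + 1)
    (a - L (Function.surjInv canon_surjective (PowerSeries.coeff 0 a)))

/-- Successive approximation: lift the constant coefficient through the canonical map, subtract,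
divide by ħ, repeat. The successive lifts are the coefficients of the preimage. -/
lemma IsPBWMap.hat_surjective (hL : IsPBWMap π b L) : Function.Surjective (hat L) := by
  intro a
  let s := Function.surjInv (canon_surjective (n := n))
  let F : (SCross n)⟦X⟧ → (TCross n)⟦X⟧ := fun a =>
    PowerSeries.mk fun k => s (PowerSeries.coeff 0 ((residual L)^[k] a))
  have hF : ∀ a, F a = PowerSeries.X * F (residual L a) + PowerSeries.C (s (PowerSeries.coeff 0 a)) := by
    intro a
    conv_lhs => rw [PowerSeries.eq_X_mul_shift_add_const (F a)]
    congr 2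
    ext k; simp [F]
  have ha : ∀ a, a = PowerSeries.X * residual L a + L (s (PowerSeries.coeff 0 a)) := by
    intro a
    rw [← sub_eq_iff_eq_add]
    conv_lhs => rw [PowerSeries.eq_X_mul_shift_add_const (a - _)]
    have : PowerSeries.constantCoeff (a - L (s (PowerSeries.coeff 0 a))) = 0 := by
      rw [← PowerSeries.coeff_zero_eq_constantCoeff_apply, map_sub, hL.coeff_zero,
        Function.surjInv_eq canon_surjective, sub_self]
    rw [this, map_zero, add_zero]
    rfl
  refine ⟨F a, ?_⟩
  ext k : 1
  induction k generalizing a with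
  | zero =>
    rw [hF, map_add, map_add, hat_X_mul, hat_C]
    conv_rhs => rw [ha a]
    simp
  | succ k ih =>
    rw [hF, map_add, map_add, hat_X_mul, hat_C, PowerSeries.coeff_succ_X_mul, ih]
    conv_rhs => rw [ha a]
    rw [map_add, PowerSeries.coeff_succ_X_mul]

/-- The map `H → (S(V*) ⋊ Γ_n)[[ħ]]` induced by a PBW map. -/
def IsPBWMap.equiv (hL : IsPBWMap π b L) : H π b ≃+ (SCross n)⟦X⟧ :=
  have key : ∀ f, hat L (Function.surjInv (toH_surjective (π := π) (b := b)) (toH π b f)) =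
      hat L f := fun f => by
    rw [← sub_eq_zero, ← map_sub]
    apply hL.hat_eq_zero
    rw [← toH_eq_zero_iff, map_sub, Function.surjInv_eq toH_surjective, sub_self]
  AddEquiv.ofBijective
    ({  toFun := fun u => hat L (Function.surjInv toH_surjective u)
        map_zero' := by rw [← map_zero (toH π b), key, map_zero]
        map_add' := fun u w => by
          obtain ⟨f, rfl⟩ := toH_surjective u
          obtain ⟨g, rfl⟩ := toH_surjective w
          rw [← map_add, key, key, key, map_add] } : H π b →+ (SCross n)⟦X⟧)
    (by
      constructor
      · rw [injective_iff_map_eq_zero]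
        intro u hu
        obtain ⟨f, rfl⟩ := toH_surjective u
        exact toH_eq_zero_iff.2 (hL.mem_of_hat_eq_zero ((key f).symm.trans hu))
      · intro a
        obtain ⟨f, rfl⟩ := hL.hat_surjective a
        exact ⟨toH π b f, key f⟩)

lemma IsPBWMap.equiv_toH (hL : IsPBWMap π b L) (f : (TCross n)⟦X⟧) :
    hL.equiv (toH π b f) = hat L f := by
  change hat L _ = _
  rw [← sub_eq_zero, ← map_sub]
  apply hL.hat_eq_zero
  rw [← toH_eq_zero_iff, map_sub, Function.surjInv_eq toH_surjective, sub_self]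

lemma hat_scalarT_mul (L : TCross n →ₗ[ℝ] (SCross n)⟦X⟧) (s : ℝ⟦X⟧) (f : (TCross n)⟦X⟧) :
    hat L (scalarT n s * f) = scalarS n s * hat L f := by
  set s' := fun s : ℝ⟦X⟧ => PowerSeries.mk fun k => PowerSeries.coeff (k + 1) s with hs'
  have hT : ∀ s, scalarT n s = PowerSeries.X * scalarT n (s' s) +
      algebraMap ℝ (TCross n)⟦X⟧ (PowerSeries.constantCoeff s) := by
    intro s
    conv_lhs => rw [PowerSeries.eq_X_mul_shift_add_const (scalarT n s)]
    congr 1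
    · congr 1; ext k : 1; simp [scalarT, hs']
    · rw [PowerSeries.algebraMap_apply, SkewMonoidAlgebra.coe_algebraMap]; simp [scalarT]
  have hS : ∀ s, scalarS n s = PowerSeries.X * scalarS n (s' s) +
      algebraMap ℝ (SCross n)⟦X⟧ (PowerSeries.constantCoeff s) := by
    intro s
    conv_lhs => rw [PowerSeries.eq_X_mul_shift_add_const (scalarS n s)]
    congr 1
    · congr 1; ext k : 1; simp [scalarS, hs']
    · rw [PowerSeries.algebraMap_apply, SkewMonoidAlgebra.coe_algebraMap]; simp [scalarS]
  have hsmul : ∀ (r : ℝ) (f : (TCross n)⟦X⟧), hat L (r • f) = r • hat L f := fun r f => by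
    ext k : 1
    rw [PowerSeries.coeff_smul, coeff_hat, coeff_hat, Finset.smul_sum]
    refine Finset.sum_congr rfl fun p _ => ?_
    rw [PowerSeries.coeff_smul, _root_.map_smul, PowerSeries.coeff_smul]
  ext k : 1
  induction k generalizing s with
  | zero =>
    rw [hT, hS, add_mul, add_mul, map_add, map_add, map_add, ← Algebra.smul_def, ← Algebra.smul_def,
      hsmul, mul_assoc, hat_X_mul, mul_assoc]
    simp
  | succ k ih =>
    rw [hT, hS, add_mul, add_mul, map_add, map_add, map_add, ← Algebra.smul_def, ← Algebra.smul_def,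
      hsmul, mul_assoc, hat_X_mul, mul_assoc, PowerSeries.coeff_succ_X_mul,
      PowerSeries.coeff_succ_X_mul, ih]

lemma IsPBWMap.isPBWIso_equiv (hL : IsPBWMap π b L) : IsPBWIso hL.equiv where
  linear s u := by
    obtain ⟨f, rfl⟩ := toH_surjective u
    rw [← map_mul, hL.equiv_toH, hL.equiv_toH, hat_scalarT_mul]
  reduces g t := by
    rw [hL.equiv_toH, hat_C, ← PowerSeries.coeff_zero_eq_constantCoeff_apply, hL.coeff_zero,
      canon_single]

lemma IsPBWMap.hat_grpT_mul (hL : IsPBWMap π b L) (g : Gam n) (f : (TCross n)⟦X⟧) :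
    hat L (grpT g * f) = PowerSeries.C (gS g) * hat L f := by
  ext k : 1
  rw [PowerSeries.coeff_C_mul, coeff_hat, coeff_hat, Finset.mul_sum]
  refine Finset.sum_congr rfl fun p _ => ?_
  rw [grpT, PowerSeries.coeff_C_mul, hL.map_left, PowerSeries.coeff_C_mul]

lemma IsPBWMap.hat_mul_grpT (hL : IsPBWMap π b L) (g : Gam n) (f : (TCross n)⟦X⟧) :
    hat L (f * grpT g) = hat L f * PowerSeries.C (gS g) := by
  ext k : 1
  rw [PowerSeries.coeff_mul_C, coeff_hat, coeff_hat, Finset.sum_mul]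
  refine Finset.sum_congr rfl fun p _ => ?_
  rw [grpT, PowerSeries.coeff_mul_C, hL.map_right, PowerSeries.coeff_mul_C]

/-! ### The star product -/

/-- The product transported from `H`. -/
def IsPBWMap.prod (hL : IsPBWMap π b L) (f g : (SCross n)⟦X⟧) : (SCross n)⟦X⟧ :=
  hL.equiv (hL.equiv.symm f * hL.equiv.symm g)

/-- Since `hat L` is onto, this reduces all properties of the transported product to properties of
the product of (T(V*) ⋊ Γ_n)[[ħ]]. -/
lemma IsPBWMap.prod_hat (hL : IsPBWMap π b L) (f g : (TCross n)⟦X⟧) :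
    hL.prod (hat L f) (hat L g) = hat L (f * g) := by
  rw [IsPBWMap.prod, ← hL.equiv_toH, ← hL.equiv_toH, AddEquiv.symm_apply_apply,
    AddEquiv.symm_apply_apply, ← map_mul, hL.equiv_toH]

lemma IsPBWMap.prod_assoc (hL : IsPBWMap π b L) (f g h : (SCross n)⟦X⟧) :
    hL.prod (hL.prod f g) h = hL.prod f (hL.prod g h) := by
  simp only [IsPBWMap.prod, AddEquiv.symm_apply_apply, mul_assoc]

/-- The product transported from `H`, as a biadditive map. -/
def IsPBWMap.prodHom (hL : IsPBWMap π b L) : (SCross n)⟦X⟧ →+ (SCross n)⟦X⟧ →+ (SCross n)⟦X⟧ :=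
  AddMonoidHom.mk' (fun f => AddMonoidHom.mk' (hL.prod f) fun g h => by
      simp only [IsPBWMap.prod, map_add, mul_add])
    fun f g => by
      ext1 h
      change hL.prod (f + g) h = hL.prod f h + hL.prod g h
      simp only [IsPBWMap.prod, map_add, add_mul]

lemma IsPBWMap.prodHom_apply (hL : IsPBWMap π b L) (f g : (SCross n)⟦X⟧) :
    hL.prodHom f g = hL.prod f g := rfl

lemma IsPBWMap.X_mul_prod (hL : IsPBWMap π b L) (f g : (SCross n)⟦X⟧) :
    hL.prod (PowerSeries.X * f) g = PowerSeries.X * hL.prod f g := by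
  obtain ⟨f, rfl⟩ := hL.hat_surjective f
  obtain ⟨g, rfl⟩ := hL.hat_surjective g
  rw [← hat_X_mul, hL.prod_hat, hL.prod_hat, mul_assoc, hat_X_mul]

lemma IsPBWMap.prod_X_mul (hL : IsPBWMap π b L) (f g : (SCross n)⟦X⟧) :
    hL.prod f (PowerSeries.X * g) = PowerSeries.X * hL.prod f g := by
  obtain ⟨f, rfl⟩ := hL.hat_surjective f
  obtain ⟨g, rfl⟩ := hL.hat_surjective g
  rw [← hat_X_mul, hL.prod_hat, hL.prod_hat, ← mul_assoc, ← PowerSeries.X_mul, mul_assoc, hat_X_mul]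

lemma IsPBWMap.smul_prod (hL : IsPBWMap π b L) (r : ℝ) (f g : (SCross n)⟦X⟧) :
    hL.prod (r • f) g = r • hL.prod f g := by
  obtain ⟨f, rfl⟩ := hL.hat_surjective f
  obtain ⟨g, rfl⟩ := hL.hat_surjective g
  rw [← map_smul, hL.prod_hat, hL.prod_hat, smul_mul_assoc, map_smul]

lemma IsPBWMap.prod_smul (hL : IsPBWMap π b L) (r : ℝ) (f g : (SCross n)⟦X⟧) :
    hL.prod f (r • g) = r • hL.prod f g := by
  obtain ⟨f, rfl⟩ := hL.hat_surjective f
  obtain ⟨g, rfl⟩ := hL.hat_surjective g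
  rw [← map_smul, hL.prod_hat, hL.prod_hat, mul_smul_comm, map_smul]

lemma IsPBWMap.coeff_prod_left (hL : IsPBWMap π b L) (k : ℕ) (f g : (SCross n)⟦X⟧) :
    PowerSeries.coeff k (hL.prod f g) = ∑ p ∈ Finset.HasAntidiagonal.antidiagonal k,
      PowerSeries.coeff p.1 (hL.prod (PowerSeries.C (PowerSeries.coeff p.2 f)) g) :=
  coeff_of_map_X_mul (hL.prodHom.flip g) (fun f => hL.X_mul_prod f g) k f

lemma IsPBWMap.coeff_prod_right (hL : IsPBWMap π b L) (k : ℕ) (f g : (SCross n)⟦X⟧) :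
    PowerSeries.coeff k (hL.prod f g) = ∑ p ∈ Finset.HasAntidiagonal.antidiagonal k,
      PowerSeries.coeff p.1 (hL.prod f (PowerSeries.C (PowerSeries.coeff p.2 g))) :=
  coeff_of_map_X_mul (hL.prodHom f) (fun g => hL.prod_X_mul f g) k g

lemma C_smul {A : Type*} [Ring A] [Algebra ℝ A] (r : ℝ) (a : A) :
    (PowerSeries.C (r • a) : A⟦X⟧) = r • PowerSeries.C a := by
  ext k
  simp only [PowerSeries.coeff_C, PowerSeries.coeff_smul]
  split_ifs <;> simp

lemma IsPBWMap.hat_one (hL : IsPBWMap π b L) : hat L 1 = 1 := by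
  rw [← _root_.map_one PowerSeries.C, hat_C, hL.map_one]

lemma IsPBWMap.hat_vecT (hL : IsPBWMap π b L) (x : W) :
    hat L (vecT n x) = PowerSeries.C (xS n x) := by
  rw [← tensorIncl_ι, tensorIncl_apply, hat_C, hL.map_vec]

lemma IsPBWMap.one_prod (hL : IsPBWMap π b L) (f : (SCross n)⟦X⟧) : hL.prod 1 f = f := by
  obtain ⟨f, rfl⟩ := hL.hat_surjective f
  rw [← hL.hat_one, hL.prod_hat, one_mul]

lemma IsPBWMap.prod_one (hL : IsPBWMap π b L) (f : (SCross n)⟦X⟧) : hL.prod f 1 = f := by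
  obtain ⟨f, rfl⟩ := hL.hat_surjective f
  rw [← hL.hat_one, hL.prod_hat, mul_one]

/-- The formal deformation of `S(V*) ⋊ Γ_n` transported from `H`. -/
def IsPBWMap.deformation (hL : IsPBWMap π b L) : FormalDeformation (SCross n) where
  m k := LinearMap.mk₂ ℝ
    (fun a a' => PowerSeries.coeff k (hL.prod (PowerSeries.C a) (PowerSeries.C a')))
    (fun a a' c => by
      rw [map_add, ← hL.prodHom_apply, map_add, AddMonoidHom.add_apply, map_add]; rfl)
    (fun r a c => by rw [C_smul, hL.smul_prod, PowerSeries.coeff_smul])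
    (fun a c c' => by
      rw [map_add, ← hL.prodHom_apply, map_add, map_add]; rfl)
    (fun r a c => by rw [C_smul, hL.prod_smul, PowerSeries.coeff_smul])
  m_zero a a' := by
    change PowerSeries.coeff 0 (hL.prod _ _) = _
    obtain ⟨f, hf⟩ := hL.hat_surjective (PowerSeries.C a)
    obtain ⟨g, hg⟩ := hL.hat_surjective (PowerSeries.C a')
    rw [← hf, ← hg, hL.prod_hat, hL.coeff_zero_hat, PowerSeries.coeff_zero_eq_constantCoeff_apply,
      map_mul, map_mul, ← PowerSeries.coeff_zero_eq_constantCoeff_apply,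
      ← PowerSeries.coeff_zero_eq_constantCoeff_apply,
      ← hL.coeff_zero_hat, ← hL.coeff_zero_hat, hf, hg, PowerSeries.coeff_zero_C,
      PowerSeries.coeff_zero_C]
  one_left k hk a := by
    change PowerSeries.coeff k (hL.prod _ _) = _
    rw [_root_.map_one, hL.one_prod, PowerSeries.coeff_C, if_neg (by omega)]
  one_right k hk a := by
    change PowerSeries.coeff k (hL.prod _ _) = _
    rw [_root_.map_one, hL.prod_one, PowerSeries.coeff_C, if_neg (by omega)]
  assoc k a a' a'' := by
    change ∑ p ∈ Finset.HasAntidiagonal.antidiagonal k, PowerSeries.coeff p.1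
        (hL.prod (PowerSeries.C (PowerSeries.coeff p.2 (hL.prod _ _))) (PowerSeries.C a'')) =
      ∑ p ∈ Finset.HasAntidiagonal.antidiagonal k, PowerSeries.coeff p.1
        (hL.prod (PowerSeries.C a) (PowerSeries.C (PowerSeries.coeff p.2 (hL.prod _ _))))
    rw [← hL.coeff_prod_left, ← hL.coeff_prod_right, hL.prod_assoc]

lemma IsPBWMap.deformation_m (hL : IsPBWMap π b L) (k : ℕ) (a a' : SCross n) :
    hL.deformation.m k a a' =
      PowerSeries.coeff k (hL.prod (PowerSeries.C a) (PowerSeries.C a')) := rfl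

lemma IsPBWMap.deformation_star (hL : IsPBWMap π b L) (f g : (SCross n)⟦X⟧) :
    hL.deformation.star f g = hL.prod f g := by
  ext k : 1
  rw [FormalDeformation.star, PowerSeries.coeff_mk, hL.coeff_prod_left]
  simp only [hL.deformation_m]
  simp only [hL.coeff_prod_right _ (PowerSeries.C _) g]
  rw [Finset.sum_sigma', Finset.sum_sigma']
  -- Both sides sum over the orders of ⋆, `f` and `g` with total k; they differ in which two of the
  -- three are grouped together.
  refine Finset.sum_bij' (fun x _ => ⟨(x.1.1 + x.2.2, x.2.1), (x.1.1, x.2.2)⟩)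
    (fun x _ => ⟨(x.2.1, x.1.2 + x.2.2), (x.1.2, x.2.2)⟩) ?_ ?_ ?_ ?_ ?_
  · rintro ⟨⟨i, j⟩, p, q⟩ h
    simp only [Finset.mem_sigma, Finset.HasAntidiagonal.mem_antidiagonal] at h ⊢
    exact ⟨by omega, trivial⟩
  · rintro ⟨⟨i, j⟩, p, q⟩ h
    simp only [Finset.mem_sigma, Finset.HasAntidiagonal.mem_antidiagonal] at h ⊢
    exact ⟨by omega, trivial⟩
  · rintro ⟨⟨i, j⟩, p, q⟩ h
    simp only [Finset.mem_sigma, Finset.HasAntidiagonal.mem_antidiagonal] at h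
    obtain ⟨h1, rfl⟩ := h
    rfl
  · rintro ⟨⟨i, j⟩, p, q⟩ h
    simp only [Finset.mem_sigma, Finset.HasAntidiagonal.mem_antidiagonal] at h
    obtain ⟨h1, rfl⟩ := h
    rfl
  · intro x _
    rfl

lemma IsPBWMap.C_gS_prod (hL : IsPBWMap π b L) (g : Gam n) (f f' : (SCross n)⟦X⟧) :
    hL.prod (PowerSeries.C (gS g) * f) f' = PowerSeries.C (gS g) * hL.prod f f' := by
  obtain ⟨f, rfl⟩ := hL.hat_surjective f
  obtain ⟨f', rfl⟩ := hL.hat_surjective f'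
  rw [← hL.hat_grpT_mul, hL.prod_hat, hL.prod_hat, mul_assoc, hL.hat_grpT_mul]

lemma IsPBWMap.prod_C_gS (hL : IsPBWMap π b L) (g : Gam n) (f f' : (SCross n)⟦X⟧) :
    hL.prod f (f' * PowerSeries.C (gS g)) = hL.prod f f' * PowerSeries.C (gS g) := by
  obtain ⟨f, rfl⟩ := hL.hat_surjective f
  obtain ⟨f', rfl⟩ := hL.hat_surjective f'
  rw [← hL.hat_mul_grpT, hL.prod_hat, hL.prod_hat, ← mul_assoc, hL.hat_mul_grpT]

lemma IsPBWMap.prod_balanced (hL : IsPBWMap π b L) (g : Gam n) (f f' : (SCross n)⟦X⟧) :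
    hL.prod (f * PowerSeries.C (gS g)) f' = hL.prod f (PowerSeries.C (gS g) * f') := by
  obtain ⟨f, rfl⟩ := hL.hat_surjective f
  obtain ⟨f', rfl⟩ := hL.hat_surjective f'
  rw [← hL.hat_mul_grpT, ← hL.hat_grpT_mul, hL.prod_hat, hL.prod_hat, mul_assoc]

lemma canon_coeff_zero_defTerm (x y : W) :
    canon n (PowerSeries.coeff 0 (defTerm π b x y)) =
      ∑ g : Gam n, SkewMonoidAlgebra.single g (SymmetricAlgebra.ι ℝ W (π g x y)) := by
  rw [defTerm, map_add, PowerSeries.coeff_zero_X_mul, add_zero, map_sum, map_sum]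
  refine Finset.sum_congr rfl fun g _ => ?_
  rw [← tensorIncl_ι, ← C_single, PowerSeries.coeff_zero_C, canon_single]
  rfl

/-- The deformation transported from `H` is a quantization along `π`. -/
theorem IsPBWMap.quantizes (hL : IsPBWMap π b L) : hL.deformation.Quantizes π := by
  -- No coboundary correction is needed: L is a Γ_n-bimodule map, so the first order term is already
  -- relative.
  refine ⟨0, ?_⟩
  simp only [LinearMap.zero_apply, mul_zero, zero_mul, add_zero, sub_zero, hL.deformation_m]
  refine ⟨fun g a c => ?_, fun g a c => ?_, fun g a c => ?_, fun x y => ?_⟩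
  · rw [map_mul, hL.C_gS_prod, PowerSeries.coeff_C_mul]
  · rw [map_mul, map_mul, hL.prod_balanced]
  · rw [map_mul, hL.prod_C_gS, PowerSeries.coeff_mul_C]
  · rw [← map_sub, ← hL.hat_vecT, ← hL.hat_vecT, hL.prod_hat, hL.prod_hat, ← map_sub]
    have h : vecT n x * vecT n y - vecT n y * vecT n x =
        relation π b x y + PowerSeries.X * defTerm π b x y := by
      rw [relation_eq, sub_add_cancel]
    rw [h, map_add, hL.hat_eq_zero (relation_mem π b x y), zero_add, hat_X_mul,
      PowerSeries.coeff_succ_X_mul, hL.coeff_zero_hat, canon_coeff_zero_defTerm]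

end PBWMap

/-- Under the PBW conditions, `H` is a deformation quantization along `π`. -/
theorem PBWCondition.exists_quantization (hc : PBWCondition π b) :
    ∃ D : FormalDeformation (SCross n), D.Quantizes π ∧
      ∃ e : H π b ≃+ PowerSeries (SCross n), IsPBWIso e ∧
        ∀ u w, e (u * w) = D.star (e u) (e w) := by
  obtain ⟨L, hL⟩ := exists_isPBWMap hc
  refine ⟨hL.deformation, hL.quantizes, hL.equiv, hL.isPBWIso_equiv, fun u w => ?_⟩
  rw [hL.deformation_star, IsPBWMap.prod, AddEquiv.symm_apply_apply, AddEquiv.symm_apply_apply]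

/-! ### The PBW property forces the double bracket to be a coboundary -/

lemma scalarT_X : scalarT n PowerSeries.X = PowerSeries.X := by
  ext k : 1
  rw [scalarT, PowerSeries.coeff_mk, PowerSeries.coeff_X, PowerSeries.coeff_X]
  split_ifs
  · rw [map_one, SkewMonoidAlgebra.one_def]
  · rw [map_zero, SkewMonoidAlgebra.single_zero]

lemma scalarS_X : scalarS n PowerSeries.X = PowerSeries.X := by
  ext k : 1
  rw [scalarS, PowerSeries.coeff_mk, PowerSeries.coeff_X, PowerSeries.coeff_X]
  split_ifs
  · rw [map_one, SkewMonoidAlgebra.one_def]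
  · rw [map_zero, SkewMonoidAlgebra.single_zero]

/-- Regularity of ħ, which holds in any power series ring, passes to H through the linear
isomorphism. -/
lemma HasPBW.toH_X_mul (h : HasPBW π b) {f : (TCross n)⟦X⟧}
    (hf : toH π b (PowerSeries.X * f) = 0) : toH π b f = 0 := by
  obtain ⟨e, he⟩ := h
  have h1 := he.linear PowerSeries.X (toH π b f)
  rw [scalarT_X, scalarS_X, ← map_mul, hf, map_zero] at h1
  have h2 : e (toH π b f) = 0 := PowerSeries.X_mul_cancel (h1.symm.trans (mul_zero _).symm)
  exact (AddEquiv.map_eq_zero_iff e).1 h2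

lemma IsPBWIso.constantCoeff_toH {e : H π b ≃+ (SCross n)⟦X⟧} (he : IsPBWIso e)
    (f : (TCross n)⟦X⟧) : PowerSeries.constantCoeff (e (toH π b f)) =
      canon n (PowerSeries.coeff 0 f) := by
  have h1 := he.linear PowerSeries.X
    (toH π b (PowerSeries.mk fun p => PowerSeries.coeff (p + 1) f))
  rw [scalarT_X, scalarS_X, ← map_mul] at h1
  rw [PowerSeries.eq_X_mul_shift_add_const f, map_add, map_add, map_add, h1]
  have h2 : ∀ t : TCross n, PowerSeries.constantCoeff (e (toH π b (PowerSeries.C t))) =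
      canon n t := by
    intro t
    induction t using SkewMonoidAlgebra.induction_on with
    | zero => simp
    | single g t => rw [he.reduces, canon_single]
    | add s t hs ht => rw [map_add, map_add, map_add, map_add, hs, ht, map_add]
  rw [h2]
  simp

/-- Evaluation at each point of V extends to an algebra map S(V*) → ℝ, and these evaluations
separate linear forms. -/
lemma symmetricAlgebra_ι_injective : Function.Injective (SymmetricAlgebra.ι ℝ W) := by
  rw [injective_iff_map_eq_zero]
  intro x hx
  refine LinearMap.ext fun v => ?_
  have h := congrArg (SymmetricAlgebra.lift (Module.Dual.eval ℝ V v)) hx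
  rwa [SymmetricAlgebra.lift_ι_apply, map_zero] at h

end

end DihedralQuant

namespace DihedralQuant

noncomputable section

variable {n : ℕ} {π : Cochain n W} {b : Cochain n ℝ}

/-- Relations vanish in H, so `relation_commutator` and `defTerm_commutator` leave an equation
divisible by ħ². Cancelling ħ twice and reducing modulo ħ makes ½⟦π,π⟧ − ∂b vanish in S(V*) ⋊ Γ_n.
-/
theorem HasPBW.dblBracket_eq (h : HasPBW π b) (hb : ∀ g, (b g).IsAlt) (hs : SymmCondition π)
    (g : Gam n) (x y z : W) :
    dblBracket π π g x y z = (2 : ℝ) • koszul g (b g) x y z := by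
  have hz : ∀ x y : W, toH π b (relation π b x y) = 0 := fun x y =>
    toH_eq_zero_iff.2 (relation_mem π b x y)
  have hsmul : ∀ (r : ℝ) (f : (TCross n)⟦X⟧), toH π b f = 0 → toH π b (r • f) = 0 := by
    intro r f hf
    rw [Algebra.smul_def, map_mul, hf, mul_zero]
  have h1 := congrArg (toH π b) (relation_commutator π b x y z)
  rw [map_add, map_zero] at h1
  have hc : ∀ x y v : W, toH π b (relation π b x y * vecT n v - vecT n v * relation π b x y) = 0 :=
    fun x y v => by rw [map_sub, map_mul, map_mul, hz, zero_mul, mul_zero, sub_self]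
  rw [map_add, map_add, hc, hc, hc, add_zero, add_zero, zero_add] at h1
  have h3 := h.toH_X_mul h1
  rw [defTerm_commutator π b hb hs] at h3
  obtain ⟨e, he⟩ := id h
  have hrel : toH π b ((1 / 2 : ℝ) • (∑ g : Gam n, relation π b (π g x y) (z + wrep n g z) * grpT g +
      ∑ g : Gam n, relation π b (π g y z) (x + wrep n g x) * grpT g +
      ∑ g : Gam n, relation π b (π g z x) (y + wrep n g y) * grpT g)) = 0 := by
    refine hsmul _ _ ?_
    simp only [map_add, map_sum, map_mul, hz, zero_mul, Finset.sum_const_zero, add_zero]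
  rw [add_assoc, map_add, hrel, zero_add, pow_two, mul_assoc, ← mul_add] at h3
  -- Second cancellation of ħ. The term with ⟦b,π⟧ keeps one factor ħ and drops out of the constant
  -- coefficient.
  have h4 := congrArg (fun u => PowerSeries.constantCoeff (e u)) (h.toH_X_mul h3)
  simp only [he.constantCoeff_toH, map_add, map_zero, PowerSeries.coeff_zero_X_mul, add_zero,
    map_sum] at h4
  have h5 := congrArg (fun a : SCross n => a.coeff g) h4
  simp only [← tensorIncl_ι, ← C_single, PowerSeries.coeff_zero_C, canon_single] at h5
  rw [SkewMonoidAlgebra.coeff_zero, Finsupp.zero_apply] at h5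
  classical
  have hsum : ∀ (s : Finset (Gam n)) (F : Gam n → SymmetricAlgebra ℝ W),
      (∑ h ∈ s, SkewMonoidAlgebra.single h (F h)).coeff g = if g ∈ s then F g else 0 := by
    intro s F
    induction s using Finset.induction_on with
    | empty => rw [Finset.sum_empty, SkewMonoidAlgebra.coeff_zero]; simp
    | insert a s ha ih =>
      rw [Finset.sum_insert ha, SkewMonoidAlgebra.coeff_add, Finsupp.add_apply, ih,
        SkewMonoidAlgebra.coeff_single, Finsupp.single_apply]
      by_cases hag : a = g
      · subst hag; simp [ha]
      · simp [hag, Ne.symm hag]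
  rw [hsum, if_pos (Finset.mem_univ _)] at h5
  have h6 := symmetricAlgebra_ι_injective (h5.trans (map_zero _).symm)
  rw [sub_eq_zero] at h6
  rw [← h6, smul_smul]
  norm_num

end

end DihedralQuant

namespace DihedralQuant

noncomputable section

variable {n : ℕ}

/-! ### Complex coordinates on `V*` -/

lemma del_add (j : Fin 2) (x y : W) : del j (x + y) = del j x + del j y := by
  simp only [del, LinearMap.add_apply, Complex.ofReal_add]; ring

lemma del_smul (j : Fin 2) (r : ℝ) (x : W) : del j (r • x) = r * del j x := by
  simp only [del, LinearMap.smul_apply, smul_eq_mul, Complex.ofReal_mul]; ring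

lemma del_zero (j : Fin 2) : del j 0 = 0 := by simp [del]

lemma del_neg (j : Fin 2) (x : W) : del j (-x) = -del j x := by
  simp only [del, LinearMap.neg_apply, Complex.ofReal_neg]; ring

lemma del_sub (j : Fin 2) (x y : W) : del j (x - y) = del j x - del j y := by
  rw [sub_eq_add_neg, del_add, del_neg, sub_eq_add_neg]

lemma del_sum {ι : Type*} (j : Fin 2) (s : Finset ι) (f : ι → W) :
    del j (∑ i ∈ s, f i) = ∑ i ∈ s, del j (f i) := by
  classical
  induction s using Finset.induction_on with
  | empty => simp [del_zero]
  | insert a s ha ih => rw [Finset.sum_insert ha, Finset.sum_insert ha, del_add, ih]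

lemma delbar_eq (j : Fin 2) (x : W) : delbar j x = starRingEnd ℂ (del j x) := by
  simp only [del, delbar, map_div₀, map_sub, map_mul, Complex.conj_ofReal, Complex.conj_I,
    map_ofNat]
  ring

/-- A real linear function in complex coordinates. -/
lemma ofReal_apply_eq (x : W) (v : V) : ((x v : ℝ) : ℂ) =
    del 0 x * v 0 + del 1 x * v 1 + starRingEnd ℂ (del 0 x * v 0 + del 1 x * v 1) := by
  have hv : v = (v 0).re • (Pi.single 0 1 : V) + (v 0).im • (Pi.single 0 Complex.I : V) +
      ((v 1).re • (Pi.single 1 1 : V) + (v 1).im • (Pi.single 1 Complex.I : V)) := by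
    ext j
    fin_cases j <;> apply Complex.ext <;> simp
  rw [Complex.add_conj]
  refine congrArg _ ?_
  conv_lhs => rw [hv]
  simp [del]
  ring

/-- The linear function with given complex coordinates. -/
def toW (a b : ℂ) : W where
  toFun v := 2 * (a * v 0 + b * v 1).re
  map_add' v w := by simp; ring
  map_smul' r v := by simp; ring

lemma del_zero_toW (a b : ℂ) : del 0 (toW a b) = a := by
  apply Complex.ext <;> simp [del, toW]

lemma del_one_toW (a b : ℂ) : del 1 (toW a b) = b := by
  apply Complex.ext <;> simp [del, toW]

lemma del_ext {x y : W} (h0 : del 0 x = del 0 y) (h1 : del 1 x = del 1 y) : x = y := by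
  refine LinearMap.ext fun v => Complex.ofReal_injective ?_
  rw [ofReal_apply_eq, ofReal_apply_eq, h0, h1]

lemma alpha_inv (k : ℤ) : (alpha n k)⁻¹ = alpha n (-k) := Subtype.ext (Units.ext rfl)

lemma beta_inv (k : ℤ) : (beta n k)⁻¹ = beta n k := Subtype.ext (Units.ext rfl)

lemma alpha_mul (k l : ℤ) : alpha n k * alpha n l = alpha n (k + l) :=
  Subtype.ext (Units.ext (alpha_mul_alpha n k l))

lemma alpha_mul_beta' (k l : ℤ) : alpha n k * beta n l = beta n (l - k) :=
  Subtype.ext (Units.ext (alpha_mul_beta n k l))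

lemma beta_mul_alpha' (k l : ℤ) : beta n k * alpha n l = beta n (k + l) :=
  Subtype.ext (Units.ext (beta_mul_alpha n k l))

lemma beta_mul (k l : ℤ) : beta n k * beta n l = alpha n (l - k) :=
  Subtype.ext (Units.ext (beta_mul_beta n k l))

lemma alpha_zero' : alpha n 0 = 1 := Subtype.ext (Units.ext (alpha_zero n))

lemma exists_eq_alpha_or_beta (g : Gam n) : ∃ k : ℤ, g = alpha n k ∨ g = beta n k := by
  obtain ⟨g, k, hk | hk⟩ := g
  · exact ⟨k, Or.inl (Subtype.ext hk)⟩
  · exact ⟨k, Or.inr (Subtype.ext hk)⟩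

lemma isPrimitiveRoot_rho (n : ℕ) : IsPrimitiveRoot (rho n) (2 * n + 1) := by
  have := Complex.isPrimitiveRoot_exp (2 * n + 1) (by omega)
  rw [rho]
  convert this using 3
  push_cast
  ring

lemma rho_zpow_eq_one_iff {k : ℤ} : rho n ^ k = 1 ↔ (2 * n + 1 : ℤ) ∣ k := by
  rw [(isPrimitiveRoot_rho n).zpow_eq_one_iff_dvd]
  push_cast
  rfl

lemma rho_zpow_mul_neg (k : ℤ) : rho n ^ k * rho n ^ (-k) = 1 := by
  rw [← zpow_add₀ (rho_ne_zero n), add_neg_cancel, zpow_zero]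

lemma conj_rho_zpow (k : ℤ) : starRingEnd ℂ (rho n ^ k) = rho n ^ (-k) := by
  have h : starRingEnd ℂ (rho n) = (rho n)⁻¹ :=
    (Complex.inv_eq_conj (Complex.norm_eq_one_of_pow_eq_one (rho_pow n) (by omega))).symm
  rw [map_zpow₀, h, inv_zpow, zpow_neg]

lemma alpha_eq_one_iff {k : ℤ} : alpha n k = 1 ↔ (2 * n + 1 : ℤ) ∣ k := by
  rw [← rho_zpow_eq_one_iff]
  constructor
  · intro h
    have := congrArg (fun g : Gam n => (g : GL (Fin 2) ℂ).val 0 0) h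
    simpa [alpha, alphaGL, alphaMat] using this
  · intro h
    refine Subtype.ext (Units.ext ?_)
    simp [alpha, alphaGL, alphaMat, h, zpow_neg, Matrix.one_fin_two]

lemma beta_ne_alpha (k l : ℤ) : beta n k ≠ alpha n l := by
  intro h
  have := congrArg (fun g : Gam n => (g : GL (Fin 2) ℂ).val 0 0) h
  simp only [alpha, alphaGL, alphaMat, beta, betaGL, betaMat] at this
  simp at this
  exact zpow_ne_zero l (rho_ne_zero n) this.symm

lemma beta_ne_one (k : ℤ) : beta n k ≠ 1 := alpha_zero' (n := n) ▸ beta_ne_alpha k 0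

lemma alpha_congr {k l : ℤ} (h : (2 * n + 1 : ℤ) ∣ k - l) : alpha n k = alpha n l := by
  rw [← mul_inv_eq_one, alpha_inv, alpha_mul, ← sub_eq_add_neg, alpha_eq_one_iff]
  exact h

lemma beta_eq_iff {k l : ℤ} : beta n k = beta n l ↔ (2 * n + 1 : ℤ) ∣ k - l := by
  rw [← mul_inv_eq_one, beta_inv, beta_mul, alpha_eq_one_iff, ← dvd_neg, neg_sub]

/-- The number n + 1 inverts 2 modulo 2n + 1, so every index may be taken even. -/
lemma alpha_two_mul (k : ℤ) : alpha n k = alpha n (2 * ((n + 1) * k)) :=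
  alpha_congr ⟨-k, by ring⟩

lemma beta_two_mul (k : ℤ) : beta n k = beta n (2 * ((n + 1) * k)) :=
  beta_eq_iff.2 ⟨-k, by ring⟩

lemma wrep_alpha (k : ℤ) (x : W) :
    wrep n (alpha n k) x = toW (rho n ^ (-k) * del 0 x) (rho n ^ k * del 1 x) := by
  refine LinearMap.ext fun v => Complex.ofReal_injective ?_
  rw [ofReal_apply_eq (toW _ _), del_zero_toW, del_one_toW]
  refine (ofReal_apply_eq x _).trans ?_
  have h0 : (vrep n (alpha n k)⁻¹ v) 0 = rho n ^ (-k) * v 0 := by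
    simp [vrep, alpha, alphaGL, alphaMat, Matrix.mulVec, dotProduct, Fin.sum_univ_two]
  have h1 : (vrep n (alpha n k)⁻¹ v) 1 = rho n ^ k * v 1 := by
    simp [vrep, alpha, alphaGL, alphaMat, Matrix.mulVec, dotProduct, Fin.sum_univ_two]
  rw [h0, h1]
  simp only [map_add, map_mul]
  ring

lemma wrep_beta (k : ℤ) (x : W) :
    wrep n (beta n k) x = toW (rho n ^ k * del 1 x) (rho n ^ (-k) * del 0 x) := by
  refine LinearMap.ext fun v => Complex.ofReal_injective ?_
  rw [ofReal_apply_eq (toW _ _), del_zero_toW, del_one_toW]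
  refine (ofReal_apply_eq x _).trans ?_
  have h0 : (vrep n (beta n k)⁻¹ v) 0 = rho n ^ (-k) * v 1 := by
    simp [vrep, beta, betaGL, betaMat, Matrix.mulVec, dotProduct, Fin.sum_univ_two]
  have h1 : (vrep n (beta n k)⁻¹ v) 1 = rho n ^ k * v 0 := by
    simp [vrep, beta, betaGL, betaMat, Matrix.mulVec, dotProduct, Fin.sum_univ_two]
  rw [h0, h1]
  simp only [map_add, map_mul]
  ring

lemma del_zero_alpha (k : ℤ) (x : W) : del 0 (wrep n (alpha n k) x) = rho n ^ (-k) * del 0 x := by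
  rw [wrep_alpha, del_zero_toW]

lemma del_one_alpha (k : ℤ) (x : W) : del 1 (wrep n (alpha n k) x) = rho n ^ k * del 1 x := by
  rw [wrep_alpha, del_one_toW]

lemma del_zero_beta (k : ℤ) (x : W) : del 0 (wrep n (beta n k) x) = rho n ^ k * del 1 x := by
  rw [wrep_beta, del_zero_toW]

lemma del_one_beta (k : ℤ) (x : W) : del 1 (wrep n (beta n k) x) = rho n ^ (-k) * del 0 x := by
  rw [wrep_beta, del_one_toW]

/-! ### Fixed spaces -/

lemma codim_one : codim (1 : Gam n) = 0 := by
  have h : Vfix (1 : Gam n) = ⊤ := by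
    rw [Vfix, map_one]
    exact LinearMap.eqLocus_same _
  rw [codim, h]
  exact Module.finrank_zero_of_subsingleton

lemma codim_beta (k : ℤ) : codim (beta n k) = 2 := by
  let f : V →ₗ[ℝ] ℂ :=
    { toFun := fun v => v 1 - rho n ^ k * v 0
      map_add' := fun v w => by simp; ring
      map_smul' := fun r v => by simp; ring }
  have hf : Function.Surjective f := fun a => ⟨Pi.single 1 a, by simp [f]⟩
  have hk : Vfix (beta n k) = LinearMap.ker f := by
    ext v
    have h0 : vrep n (beta n k) v 0 = rho n ^ (-k) * v 1 := by
      simp [vrep, beta, betaGL, betaMat, Matrix.mulVec, dotProduct, Fin.sum_univ_two]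
    have h1 : vrep n (beta n k) v 1 = rho n ^ k * v 0 := by
      simp [vrep, beta, betaGL, betaMat, Matrix.mulVec, dotProduct, Fin.sum_univ_two]
    have hr := rho_zpow_mul_neg (n := n) k
    rw [LinearMap.mem_ker]
    change vrep n (beta n k) v = v ↔ v 1 - rho n ^ k * v 0 = 0
    constructor
    · intro h
      rw [← h1, h, sub_self]
    · intro h
      funext j
      fin_cases j
      · refine h0.trans ?_
        change _ = v 0
        linear_combination rho n ^ (-k) * h + v 0 * hr
      · refine h1.trans ?_
        change _ = v 1
        linear_combination -h
  rw [codim, hk, (f.quotKerEquivOfSurjective hf).finrank_eq, Complex.finrank_real_complex]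

/-- Neither eigenvalue ρ^k, ρ^{-k} is 1, so no nonzero vector is fixed and the codimension is 4.
Thus cocycles vanish at nontrivial rotations. -/
lemma codim_alpha {k : ℤ} (hk : ¬ (2 * n + 1 : ℤ) ∣ k) : codim (alpha n k) ≠ 2 := by
  have h : Vfix (alpha n k) = ⊥ := by
    rw [eq_bot_iff]
    intro v hv
    have hv' : vrep n (alpha n k) v = v := hv
    have h0 : vrep n (alpha n k) v 0 = rho n ^ k * v 0 := by
      simp [vrep, alpha, alphaGL, alphaMat, Matrix.mulVec, dotProduct, Fin.sum_univ_two]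
    have h1 : vrep n (alpha n k) v 1 = rho n ^ (-k) * v 1 := by
      simp [vrep, alpha, alphaGL, alphaMat, Matrix.mulVec, dotProduct, Fin.sum_univ_two]
    rw [hv'] at h0 h1
    rw [← rho_zpow_eq_one_iff] at hk
    have hk' : rho n ^ (-k) ≠ 1 := by rwa [zpow_neg, ne_eq, inv_eq_one]
    rw [Submodule.mem_bot]
    funext j
    fin_cases j
    · exact (mul_left_eq_self₀.1 h0.symm).resolve_left hk
    · exact (mul_left_eq_self₀.1 h1.symm).resolve_left hk'
  rw [codim, h, (Submodule.quotEquivOfEqBot _ rfl).finrank_eq, Module.finrank_pi_fintype]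
  simp [Complex.finrank_real_complex]

lemma mem_Wfix_beta_iff {k : ℤ} {x : W} : x ∈ Wfix (beta n k) ↔ del 0 x = rho n ^ k * del 1 x := by
  change wrep n (beta n k) x = x ↔ _
  constructor
  · intro h
    conv_lhs => rw [← h]
    rw [del_zero_beta]
  · intro h
    refine del_ext ?_ ?_
    · rw [del_zero_beta, h]
    · rw [del_one_beta, h]
      linear_combination del 1 x * rho_zpow_mul_neg (n := n) k

lemma fixProj_one (x : W) : fixProj (1 : Gam n) x = x := by
  rw [fixProj, orderOf_one, Finset.sum_range_one, pow_zero, Nat.cast_one, inv_one, one_smul,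
    wrep_one_apply]

lemma fixProj_beta (k : ℤ) (x : W) :
    fixProj (beta n k) x = (1 / 2 : ℝ) • (x + wrep n (beta n k) x) := by
  have h : orderOf (beta n k) = 2 :=
    orderOf_eq_prime (by rw [pow_two, beta_mul, sub_self, alpha_zero']) (beta_ne_one k)
  rw [fixProj, h, Finset.sum_range_succ, Finset.sum_range_one, pow_zero, pow_one,
    LinearMap.smul_apply, LinearMap.add_apply, wrep_one_apply]
  norm_num

end

end DihedralQuant

namespace DihedralQuant

noncomputable section

variable {n : ℕ} {π : Cochain n W} {c : ℂ}

/-! ### The components of a linear cocycle -/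

lemma rho_zpow_two_mul (k : ℤ) : rho n ^ (2 * k) = rho n ^ k * rho n ^ k := by
  rw [two_mul, zpow_add₀ (rho_ne_zero n)]

lemma rho_zpow_neg_two_mul (k : ℤ) : rho n ^ (-2 * k) = rho n ^ (-k) * rho n ^ (-k) := by
  rw [← zpow_add₀ (rho_ne_zero n)]; congr 1; ring

/-- The complex linear form on `V*` vanishing on the vectors fixed by `β_{2k}`. -/
def nrm (n : ℕ) (k : ℤ) (x : W) : ℂ := del 0 x - rho n ^ (2 * k) * del 1 x

/-- With ν = `nrm n k` this is ν ∧ ν̄. From this form one reads off that the bivector is imaginary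
and that its wedge with ν vanishes. -/
lemma piBivector_eq (k : ℤ) (x y : W) : piBivector n k x y =
    nrm n k x * starRingEnd ℂ (nrm n k y) - nrm n k y * starRingEnd ℂ (nrm n k x) := by
  simp only [piBivector, nrm, wedge, delbar_eq, map_sub, map_mul, conj_rho_zpow]
  rw [← neg_mul]
  rw [rho_zpow_two_mul, rho_zpow_neg_two_mul]
  have hr := rho_zpow_mul_neg (n := n) k
  linear_combination (-(rho n ^ k * rho n ^ (-k)) - 1) * (del 1 x * starRingEnd ℂ (del 1 y) -
    del 1 y * starRingEnd ℂ (del 1 x)) * hr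

lemma conj_piBivector (k : ℤ) (x y : W) :
    starRingEnd ℂ (piBivector n k x y) = -piBivector n k x y := by
  simp only [piBivector_eq, map_sub, map_mul, Complex.conj_conj]
  ring

lemma piBivector_cyclic (k : ℤ) (x y z : W) :
    piBivector n k x y * nrm n k z + piBivector n k y z * nrm n k x +
      piBivector n k z x * nrm n k y = 0 := by
  simp only [piBivector_eq]
  ring

/-- The components of `π` at the reflections, in complex coordinates. -/
def ReflForm (π : Cochain n W) (c : ℂ) : Prop := ∀ (k : ℤ) (x y : W),
  del 0 (π (beta n (2 * k)) x y) = c * rho n ^ k * piBivector n k x y ∧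
    del 1 (π (beta n (2 * k)) x y) = c * rho n ^ (-k) * piBivector n k x y

/-- By normality π factors through the quotient of V* by the fixed vectors, a real plane with
complex coordinate `nrm n 0`. An alternating form on a plane is the determinant times its value on
the basis 1, i. -/
lemma IsLinearCocycle.apply_beta_zero (hπ : IsLinearCocycle π) (x y : W) :
    π (beta n 0) x y = ((nrm n 0 x).re * (nrm n 0 y).im - (nrm n 0 x).im * (nrm n 0 y).re) •
      π (beta n 0) (toW 1 0) (toW Complex.I 0) := by
  have hd : ∀ x, ∃ w ∈ Wfix (beta n 0),
      x = (nrm n 0 x).re • toW 1 0 + (nrm n 0 x).im • toW Complex.I 0 + w := by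
    intro x
    refine ⟨x - ((nrm n 0 x).re • toW 1 0 + (nrm n 0 x).im • toW Complex.I 0), ?_,
      (add_sub_cancel _ _).symm⟩
    rw [mem_Wfix_beta_iff]
    simp only [del_sub, del_add, del_smul, del_zero_toW, del_one_toW, zpow_zero, mul_zero, mul_one,
      add_zero, one_mul, sub_zero]
    rw [Complex.re_add_im, nrm]
    simp
  obtain ⟨w, hw, hx⟩ := hd x
  obtain ⟨u, hu, hy⟩ := hd y
  have hk := hπ.normal (beta n 0) (codim_beta 0)
  have hk' : ∀ x ∈ Wfix (beta n 0), ∀ y, π (beta n 0) y x = 0 := fun x hx y => by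
    rw [← (hπ.alt _).neg, hk x hx, neg_zero]
  have hs : π (beta n 0) (toW Complex.I 0) (toW 1 0) = -π (beta n 0) (toW 1 0) (toW Complex.I 0) :=
    ((hπ.alt _).neg _ _).symm
  conv_lhs => rw [hx, hy]
  simp only [map_add, LinearMap.add_apply, hk w hw, hk' u hu, map_smul, LinearMap.smul_apply,
    (hπ.alt _).self_eq_zero, smul_zero, add_zero, zero_add, hs, smul_neg, smul_smul]
  module

/-- Conjugation by α_{-k} carries β_0 to β_{2k}, so everything is determined at β_0. There the value
lies in the fixed vectors, whose two complex coordinates agree: one complex parameter. -/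
lemma IsLinearCocycle.exists_reflForm (hπ : IsLinearCocycle π) : ∃ c, ReflForm π c := by
  set p := π (beta n 0) (toW 1 0) (toW Complex.I 0) with hp
  have hfix := hπ.mem_fix (beta n 0) (codim_beta 0) (toW 1 0) (toW Complex.I 0)
  rw [mem_Wfix_beta_iff, zpow_zero, one_mul, ← hp] at hfix
  -- The factor i/2 comes from Re a·Im b − Im a·Re b = (i/2)(ab̄ − bā).
  refine ⟨Complex.I / 2 * del 0 p, fun k x y => ?_⟩
  have hinv := hπ.invariant (alpha n (-k)) (beta n 0) x y
  rw [alpha_inv, neg_neg, alpha_mul_beta', beta_mul_alpha', zero_sub, neg_neg, ← two_mul,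
    hπ.apply_beta_zero, ← hp] at hinv
  have hN : ∀ x, nrm n 0 (wrep n (alpha n k) x) = rho n ^ (-k) * nrm n k x := by
    intro x
    simp only [nrm, del_zero_alpha, del_one_alpha, mul_zero, zpow_zero, one_mul, rho_zpow_two_mul]
    linear_combination (rho n ^ k * del 1 x) * rho_zpow_mul_neg (n := n) k
  have hD : (((nrm n 0 (wrep n (alpha n k) x)).re * (nrm n 0 (wrep n (alpha n k) y)).im -
      (nrm n 0 (wrep n (alpha n k) x)).im * (nrm n 0 (wrep n (alpha n k) y)).re : ℝ) : ℂ) =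
      Complex.I / 2 * piBivector n k x y := by
    have h1 : ∀ a b : ℂ, ((a.re * b.im - a.im * b.re : ℝ) : ℂ) =
        Complex.I / 2 * (a * starRingEnd ℂ b - b * starRingEnd ℂ a) := by
      intro a b
      apply Complex.ext <;> simp <;> ring
    rw [h1, hN, hN, piBivector_eq]
    simp only [map_mul, conj_rho_zpow, neg_neg]
    linear_combination Complex.I / 2 * (nrm n k x * starRingEnd ℂ (nrm n k y) -
      nrm n k y * starRingEnd ℂ (nrm n k x)) * rho_zpow_mul_neg (n := n) k
  rw [← hinv, del_zero_alpha, del_one_alpha, del_smul, del_smul, hD, ← hfix, neg_neg]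
  constructor <;> ring

/-- The bivector is imaginary, so conjugating the holomorphic half changes its sign; hence the minus
sign in `piFun`. -/
lemma ReflForm.ofReal_apply (hc : ReflForm π c) (k : ℤ) (x y : W) (v : V) :
    ((π (beta n (2 * k)) x y v : ℝ) : ℂ) = piFun n c k v * piBivector n k x y := by
  rw [ofReal_apply_eq, (hc k x y).1, (hc k x y).2, piFun]
  simp only [map_add, map_mul, conj_piBivector, conj_rho_zpow, neg_neg, Complex.star_def]
  ring

lemma IsLinearCocycle.apply_alpha (hπ : IsLinearCocycle π) {k : ℤ}
    (hk : ¬ (2 * n + 1 : ℤ) ∣ k) : π (alpha n k) = 0 :=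
  hπ.support _ (mt alpha_eq_one_iff.1 hk) (codim_alpha hk)

/-- A component at a reflection is a bivector times a vector. -/
lemma ReflForm.exists_eq_smul (hc : ReflForm π c) (k : ℤ) : ∃ (ω : W → W → ℝ) (l : W),
    (∀ x y, π (beta n (2 * k)) x y = ω x y • l) ∧
      ∀ x y, (ω x y : ℂ) = Complex.I * piBivector n k x y := by
  have hω : ∀ x y, ((Complex.I * piBivector n k x y).re : ℂ) = Complex.I * piBivector n k x y :=
    fun x y => Complex.conj_eq_iff_re.1 (by
      rw [map_mul, conj_piBivector, Complex.conj_I, neg_mul_neg])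
  refine ⟨fun x y => (Complex.I * piBivector n k x y).re,
    toW (-Complex.I * (c * rho n ^ k)) (-Complex.I * (c * rho n ^ (-k))), fun x y => ?_, hω⟩
  refine del_ext ?_ ?_
  · rw [del_smul, hω, del_zero_toW, (hc k x y).1]
    linear_combination (c * rho n ^ k * piBivector n k x y) * Complex.I_mul_I
  · rw [del_smul, hω, del_one_toW, (hc k x y).2]
    linear_combination (c * rho n ^ (-k) * piBivector n k x y) * Complex.I_mul_I

/-- Either γz − z or π_γ vanishes unless γ is a reflection. There π_γ is ω ⊗ l with ω proportional
to ν ∧ ν̄, and γz − z depends only on ν(z), so the cyclic sum vanishes by `piBivector_cyclic`. -/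
theorem IsLinearCocycle.symmCondition (hπ : IsLinearCocycle π) (hc : ReflForm π c) :
    SymmCondition π := by
  intro g x y z f
  obtain ⟨k, rfl | rfl⟩ := exists_eq_alpha_or_beta g
  · by_cases hk : (2 * n + 1 : ℤ) ∣ k
    · rw [alpha_eq_one_iff.2 hk]
      simp only [wrep_one_apply, sub_self, map_zero, LinearMap.zero_apply, add_zero]
    · simp only [hπ.apply_alpha hk, map_zero, LinearMap.zero_apply, add_zero]
  · rw [beta_two_mul]
    set m : ℤ := (n + 1) * k
    obtain ⟨ω, l, hω, hω'⟩ := hc.exists_eq_smul m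
    have key : ω x y • (wrep n (beta n (2 * m)) z - z) + ω y z • (wrep n (beta n (2 * m)) x - x) +
        ω z x • (wrep n (beta n (2 * m)) y - y) = 0 := by
      have hcyc := piBivector_cyclic (n := n) m x y z
      have hr := rho_zpow_mul_neg (n := n) (2 * m)
      simp only [nrm] at hcyc
      refine del_ext ?_ ?_
      · simp only [del_add, del_smul, del_sub, del_zero_beta, hω', del_zero]
        linear_combination -Complex.I * hcyc
      · simp only [del_add, del_smul, del_sub, del_one_beta, hω', del_zero]
        linear_combination Complex.I * rho n ^ (-(2 * m)) * hcyc + Complex.I * (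
          piBivector n m x y * del 1 z + piBivector n m y z * del 1 x +
          piBivector n m z x * del 1 y) * hr
    have h1 := congrArg (fun w => f l w + f w l) key
    simp only [map_add, map_smul, LinearMap.add_apply, LinearMap.smul_apply, map_zero,
      LinearMap.zero_apply, add_zero] at h1
    simp only [hω, map_smul, LinearMap.smul_apply]
    rw [← h1]
    abel

end

end DihedralQuant

namespace DihedralQuant

noncomputable section

variable {n : ℕ} {π : Cochain n W} {c : ℂ}

/-! ### The second order term -/

/-- The complex valued form on `V*` whose real rank two bivector is the second order term. -/
def eta (c : ℂ) (x : W) : ℂ := starRingEnd ℂ c * del 0 x + c * starRingEnd ℂ (del 1 x)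

/-- The imaginary bivector attached to `eta`. -/
def etaWedge (c : ℂ) (x y : W) : ℂ :=
  eta c x * starRingEnd ℂ (eta c y) - eta c y * starRingEnd ℂ (eta c x)

lemma eta_add (x y : W) : eta c (x + y) = eta c x + eta c y := by
  simp only [eta, del_add, map_add]; ring

lemma eta_smul (r : ℝ) (x : W) : eta c (r • x) = r * eta c x := by
  simp only [eta, del_smul, map_mul, Complex.conj_ofReal]; ring

lemma conj_etaWedge (x y : W) : starRingEnd ℂ (etaWedge c x y) = -etaWedge c x y := by
  simp only [etaWedge, map_sub, map_mul, Complex.conj_conj]; ring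

lemma etaWedge_alpha (k : ℤ) (x y : W) :
    etaWedge c (wrep n (alpha n k) x) (wrep n (alpha n k) y) = etaWedge c x y := by
  have h : ∀ x, eta c (wrep n (alpha n k) x) = rho n ^ (-k) * eta c x := fun x => by
    simp only [eta, del_zero_alpha, del_one_alpha, map_mul, conj_rho_zpow]; ring
  simp only [etaWedge, h, map_mul, conj_rho_zpow, neg_neg]
  linear_combination (eta c x * starRingEnd ℂ (eta c y) - eta c y * starRingEnd ℂ (eta c x)) *
    rho_zpow_mul_neg (n := n) k

lemma etaWedge_beta (k : ℤ) (x y : W) :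
    etaWedge c (wrep n (beta n k) x) (wrep n (beta n k) y) = -etaWedge c x y := by
  have h : ∀ x, eta c (wrep n (beta n k) x) = rho n ^ k * starRingEnd ℂ (eta c x) := fun x => by
    simp only [eta, del_zero_beta, del_one_beta, map_mul, map_add, conj_rho_zpow, neg_neg,
      Complex.conj_conj]
    ring
  simp only [etaWedge, h, map_mul, conj_rho_zpow, Complex.conj_conj]
  linear_combination (eta c y * starRingEnd ℂ (eta c x) - eta c x * starRingEnd ℂ (eta c y)) *
    rho_zpow_mul_neg (n := n) k

/-- The scalar factor of the second order term at a group element. -/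
def rotFactor (g : Gam n) : ℂ :=
  (2 * n + 1) * (((g : GL (Fin 2) ℂ).val 0 0) ^ (n + 1) -
    starRingEnd ℂ (((g : GL (Fin 2) ℂ).val 0 0) ^ (n + 1)))

/-- The second order term of the quantization. -/
def secondOrder (n : ℕ) (c : ℂ) : Cochain n ℝ := fun g =>
  LinearMap.mk₂ ℝ (fun x y => (rotFactor g * etaWedge c x y).re)
    (fun x y z => by
      rw [← Complex.add_re]; congr 1; simp only [etaWedge, eta_add, map_add]; ring)
    (fun r x y => by
      rw [smul_eq_mul, ← Complex.re_ofReal_mul]; congr 1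
      simp only [etaWedge, eta_smul, map_mul, Complex.conj_ofReal]; ring)
    (fun x y z => by
      rw [← Complex.add_re]; congr 1; simp only [etaWedge, eta_add, map_add]; ring)
    (fun r x y => by
      rw [smul_eq_mul, ← Complex.re_ofReal_mul]; congr 1
      simp only [etaWedge, eta_smul, map_mul, Complex.conj_ofReal]; ring)

/-- Both factors are purely imaginary, so taking the real part loses nothing. -/
lemma ofReal_secondOrder (g : Gam n) (x y : W) :
    ((secondOrder n c g x y : ℝ) : ℂ) = rotFactor g * etaWedge c x y := by
  refine Complex.conj_eq_iff_re.1 ?_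
  simp only [rotFactor, map_mul, map_sub, map_add, conj_etaWedge, Complex.conj_conj, map_natCast,
    map_one, map_ofNat]
  ring

/-- The exponent n + 1 halves the index modulo 2n + 1: it recovers ρ^k from the matrix entry ρ^{2k},
so the factor depends on the group element alone. -/
lemma rotFactor_alpha (k : ℤ) :
    rotFactor (alpha n (2 * k)) = (2 * n + 1) * (rho n ^ k - rho n ^ (-k)) := by
  have h : ((alpha n (2 * k) : GL (Fin 2) ℂ).val 0 0) ^ (n + 1) = rho n ^ k := by
    have h0 : (alpha n (2 * k) : GL (Fin 2) ℂ).val 0 0 = rho n ^ (2 * k) := by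
      simp [alpha, alphaGL, alphaMat]
    rw [h0, ← zpow_natCast, ← zpow_mul,
      show 2 * k * ((n + 1 : ℕ) : ℤ) = k + ((2 * n + 1 : ℕ) : ℤ) * k by push_cast; ring,
      zpow_add₀ (rho_ne_zero n), zpow_mul, zpow_natCast, rho_pow, one_zpow, mul_one]
  rw [rotFactor, h, conj_rho_zpow]

lemma rotFactor_beta (k : ℤ) : rotFactor (beta n k) = 0 := by
  simp [rotFactor, beta, betaGL, betaMat]

lemma rotFactor_one : rotFactor (1 : Gam n) = 0 := by simp [rotFactor]

lemma secondOrder_eq_zero {g : Gam n} (hg : rotFactor g = 0) : secondOrder n c g = 0 := by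
  refine LinearMap.ext fun x => LinearMap.ext fun y => Complex.ofReal_injective ?_
  rw [ofReal_secondOrder, hg, zero_mul]
  simp

lemma secondOrder_beta (k : ℤ) : secondOrder n c (beta n k) = 0 :=
  secondOrder_eq_zero (rotFactor_beta k)

lemma secondOrder_isAlt (g : Gam n) : (secondOrder n c g).IsAlt := fun x =>
  Complex.ofReal_injective (by rw [ofReal_secondOrder, etaWedge, sub_self, mul_zero]; simp)

lemma secondOrder_alpha (k : ℤ) (x y : W) :
    ((secondOrder n c (alpha n (2 * k)) x y : ℝ) : ℂ) = BBivector n c k x y := by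
  rw [ofReal_secondOrder, rotFactor_alpha, BBivector, etaWedge]
  simp only [eta, wedge, delbar_eq, map_add, map_mul, Complex.conj_conj, Complex.star_def]
  ring

/-- Conjugation by a reflection inverts a rotation and thus negates `rotFactor`; it also negates
`etaWedge`, and the signs cancel. Rotations leave both factors unchanged. -/
lemma secondOrder_invariant (g h : Gam n) (x y : W) :
    secondOrder n c h (wrep n g⁻¹ x) (wrep n g⁻¹ y) = secondOrder n c (g * h * g⁻¹) x y := by
  apply Complex.ofReal_injective
  rw [ofReal_secondOrder, ofReal_secondOrder]
  obtain ⟨k, rfl | rfl⟩ := exists_eq_alpha_or_beta g <;>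
    obtain ⟨l, rfl | rfl⟩ := exists_eq_alpha_or_beta h
  · rw [alpha_inv, etaWedge_alpha, alpha_mul, alpha_mul, add_neg_cancel_comm]
  · rw [alpha_inv, alpha_mul_beta', beta_mul_alpha', rotFactor_beta, rotFactor_beta, zero_mul,
      zero_mul]
  · rw [beta_inv, etaWedge_beta, beta_mul_alpha', beta_mul, sub_add_cancel_left, alpha_two_mul l,
      alpha_two_mul (-l), rotFactor_alpha, rotFactor_alpha,
      show ((n : ℤ) + 1) * -l = -((n + 1) * l) by ring, neg_neg]
    ring
  · rw [beta_inv, beta_mul, alpha_mul_beta', rotFactor_beta, rotFactor_beta, zero_mul, zero_mul]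

/-! ### Vanishing of the double bracket at the reflections and at the identity -/

lemma IsLinearPoisson.dblBracket_one (hπ : IsLinearPoisson π) (x y z : W) :
    dblBracket π π 1 x y z = 0 := by
  have h := hπ.bracket_eq_zero 1 ![x, y, z]
  rw [gerstenhaber, pr, codim_one, Finset.powersetCard_zero, Finset.sum_singleton, fixProj_one] at h
  simpa [fixProj_one] using h

/-- A factorization of a reflection contains exactly one rotation, and among rotations only the
identity carries a component of π. -/
lemma IsLinearCocycle.dblBracket_beta (hπ : IsLinearCocycle π) (k : ℤ) (x y z : W) :
    dblBracket π π (beta n k) x y z =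
      (π (beta n k) (π 1 x y) (z + z) + π (beta n k) (π 1 y z) (x + x) +
        π (beta n k) (π 1 z x) (y + y)) +
      (π 1 (π (beta n k) x y) (z + wrep n (beta n k) z) +
        π 1 (π (beta n k) y z) (x + wrep n (beta n k) x) +
        π 1 (π (beta n k) z x) (y + wrep n (beta n k) y)) := by
  rw [dblBracket, Fintype.sum_eq_add 1 (beta n k) (beta_ne_one k).symm]
  · simp only [inv_one, mul_one, wrep_one_apply, mul_inv_cancel]
  · rintro h ⟨h1, h2⟩
    obtain ⟨l, rfl | rfl⟩ := exists_eq_alpha_or_beta h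
    · rw [hπ.apply_alpha (mt alpha_eq_one_iff.2 h1)]
      simp
    · rw [beta_inv, beta_mul, hπ.apply_alpha (mt beta_eq_iff.2 h2)]
      simp

lemma fixProj_mem (k : ℤ) (x : W) : fixProj (beta n k) x ∈ Wfix (beta n k) := by
  change wrep n (beta n k) (fixProj (beta n k) x) = fixProj (beta n k) x
  rw [fixProj_beta, map_smul, map_add, ← wrep_mul_apply, beta_mul, sub_self, alpha_zero',
    wrep_one_apply, add_comm]

lemma fixProj_of_mem {k : ℤ} {x : W} (hx : x ∈ Wfix (beta n k)) : fixProj (beta n k) x = x := by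
  have h : wrep n (beta n k) x = x := hx
  rw [fixProj_beta, h, ← two_smul ℝ x, smul_smul]
  norm_num

/-- The bracket at a reflection lies in the image of the projection: its values are fixed, and it
sees exactly two normal parts and one fixed part of its arguments. So the vanishing of its
projection is its own vanishing. -/
lemma IsLinearPoisson.dblBracket_beta_eq_zero (hπ : IsLinearPoisson π) (k : ℤ) (x y z : W) :
    dblBracket π π (beta n k) x y z = 0 := by
  set g := beta n k with hg
  set p := fixProj g with hp
  have hpp : ∀ x, p (p x) = p x := fun x => fixProj_of_mem (fixProj_mem k x)
  have hl : ∀ x y, π g (p x) y = 0 := fun x y => hπ.normal g (codim_beta k) _ (fixProj_mem k x) y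
  have hr : ∀ x y, π g y (p x) = 0 := fun x y => by rw [← (hπ.alt g).neg, hl, neg_zero]
  have hv : ∀ x y, p (π g x y) = π g x y := fun x y =>
    fixProj_of_mem (hπ.mem_fix g (codim_beta k) x y)
  have hpw : ∀ x, wrep n g x = p x + p x - x := fun x => by
    rw [hp, fixProj_beta]; module
  have hinv : ∀ x y, wrep n g (π 1 x y) = π 1 (wrep n g x) (wrep n g y) := fun x y => by
    have := hπ.invariant g 1 (wrep n g x) (wrep n g y)
    rwa [← wrep_mul_apply, ← wrep_mul_apply, inv_mul_cancel, wrep_one_apply, wrep_one_apply,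
      mul_one, mul_inv_cancel] at this
  -- Parity under the involution `g`: the fixed part of the invariant form π_1 comes from arguments
  -- of equal type, the normal part from mixed ones.
  have hp1 : ∀ x y, p (π 1 x y) = π 1 (p x) (p y) + π 1 (x - p x) (y - p y) := fun x y => by
    have h1 := hinv x y
    rw [hpw, hpw, hpw] at h1
    have h2 : p (π 1 x y) + p (π 1 x y) = π 1 x y + π 1 (p x + p x - x) (p y + p y - y) := by
      rw [← h1]; abel
    have h3 : (2 : ℝ) • p (π 1 x y) =
        (2 : ℝ) • (π 1 (p x) (p y) + π 1 (x - p x) (y - p y)) := by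
      rw [two_smul, h2]
      simp only [map_add, map_sub, LinearMap.add_apply, LinearMap.sub_apply]
      module
    exact smul_right_injective W (two_ne_zero (α := ℝ)) h3
  have hπ1 : ∀ x y, π g (π 1 x y) = π g (π 1 (p x) (y - p y) + π 1 (x - p x) (p y)) := fun x y => by
    have h1 : π 1 x y = p (π 1 x y) + (π 1 (p x) (y - p y) + π 1 (x - p x) (p y)) := by
      rw [hp1]
      simp only [map_sub, LinearMap.sub_apply]
      abel
    have h2 : π g (p (π 1 x y)) = 0 := LinearMap.ext fun z => hl _ z
    conv_lhs => rw [h1, map_add, h2, zero_add]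
  -- The bracket rewritten so that every term visibly has two normal arguments and one fixed
  -- argument.
  set F : W → W → W → W := fun x y z =>
    (π g (π 1 (p x) (y - p y) + π 1 (x - p x) (p y)) (z - p z + (z - p z)) +
      π g (π 1 (p y) (z - p z) + π 1 (y - p y) (p z)) (x - p x + (x - p x)) +
      π g (π 1 (p z) (x - p x) + π 1 (z - p z) (p x)) (y - p y + (y - p y))) +
    (π 1 (π g (x - p x) (y - p y)) (p z + p z) + π 1 (π g (y - p y) (z - p z)) (p x + p x) +
      π 1 (π g (z - p z) (x - p x)) (p y + p y)) with hF
  have key : ∀ x y z, dblBracket π π g x y z = F x y z := by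
    intro x y z
    have h1 : ∀ x y, π g (x - p x) (y - p y) = π g x y := fun x y => by
      simp only [map_sub, LinearMap.sub_apply, hr, hl, sub_zero]
    have h2 : ∀ a z, π g a (z - p z + (z - p z)) = π g a (z + z) := fun a z => by
      simp only [map_add, map_sub, hr, sub_zero]
    have h3 : ∀ z, z + wrep n g z = p z + p z := fun z => by rw [hpw]; abel
    rw [hg, hπ.dblBracket_beta, ← hg, hπ1 x y, hπ1 y z, hπ1 z x, h3, h3, h3]
    simp only [hF, h1, h2]
  have hfix : ∀ x y z, p (F x y z) = F x y z := by
    intro x y z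
    have h1 : ∀ x y z, p (π 1 (π g x y) (p z + p z)) = π 1 (π g x y) (p z + p z) := by
      intro x y z
      rw [hp1, hv, sub_self, map_add p, hpp]
      simp
    simp only [hF, map_add p, hv, h1]
  have hbr := hπ.bracket_eq_zero g ![x, y, z]
  have hset : Finset.powersetCard 2 (Finset.univ : Finset (Fin 3)) = {{0, 1}, {0, 2}, {1, 2}} := by
    decide
  rw [gerstenhaber, pr, hg, codim_beta, ← hg, ← hp, hset, Finset.sum_insert (by decide),
    Finset.sum_insert (by decide), Finset.sum_singleton] at hbr
  simp [key] at hbr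
  simp only [hfix] at hbr
  rw [key, ← hbr]
  simp only [hF, map_sub, map_add, hpp, sub_self, sub_zero, map_zero, add_zero, zero_add,
    LinearMap.zero_apply, LinearMap.add_apply, LinearMap.sub_apply]
  abel

end

end DihedralQuant

namespace DihedralQuant

noncomputable section

variable {n : ℕ} {π : Cochain n W} {c : ℂ}

/-! ### The double bracket at the rotations -/

/-- As 2 is invertible modulo 2n + 1, the β_{2j} with 0 ≤ j ≤ 2n list each reflection once. -/
lemma sum_eq_sum_beta {M : Type*} [AddCommMonoid M] (f : Gam n → M)
    (hf : ∀ k, f (alpha n k) = 0) :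
    ∑ h, f h = ∑ j ∈ Finset.range (2 * n + 1), f (beta n (2 * (j : ℤ))) := by
  refine (Finset.sum_of_injOn (fun j : ℕ => beta n (2 * (j : ℤ))) ?_ ?_ ?_ ?_).symm
  · intro i hi j hj h
    have h1 : (2 * n + 1 : ℤ) ∣ 2 * ((i : ℤ) - j) := by
      rw [mul_sub]; exact beta_eq_iff.1 h
    have h2 : (2 * n + 1 : ℤ) ∣ (i : ℤ) - j := by
      have h3 : IsCoprime (2 * n + 1 : ℤ) 2 := ⟨1, -n, by ring⟩
      exact h3.dvd_of_dvd_mul_left h1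
    have hi' := Finset.mem_range.1 (Finset.mem_coe.1 hi)
    have hj' := Finset.mem_range.1 (Finset.mem_coe.1 hj)
    have h4 := Int.eq_zero_of_abs_lt_dvd h2 (by rw [abs_lt]; constructor <;> omega)
    omega
  · intro j _
    exact Finset.mem_coe.2 (Finset.mem_univ _)
  · intro h _ hh
    obtain ⟨k, rfl | rfl⟩ := exists_eq_alpha_or_beta h
    · exact hf k
    · refine absurd ?_ hh
      have h0 : 0 ≤ ((n + 1) * k) % (2 * n + 1 : ℤ) := Int.emod_nonneg _ (by omega)
      have h1 : ((n + 1) * k) % (2 * n + 1 : ℤ) < 2 * n + 1 := Int.emod_lt_of_pos _ (by omega)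
      refine ⟨(((n + 1) * k) % (2 * n + 1 : ℤ)).toNat, ?_, ?_⟩
      · simp only [Finset.coe_range, Set.mem_Iio]
        omega
      · change beta n (2 * ((((n + 1) * k) % (2 * n + 1 : ℤ)).toNat : ℤ)) = _
        rw [Int.toNat_of_nonneg h0, beta_two_mul k, beta_eq_iff, ← mul_sub]
        exact Dvd.dvd.mul_left ⟨-((n + 1) * k / (2 * n + 1)), by rw [Int.emod_def]; ring⟩ _
  · intro j _
    rfl

lemma sum_rho_zpow {i : ℤ} (hi : ¬ (2 * n + 1 : ℤ) ∣ i) :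
    ∑ j ∈ Finset.range (2 * n + 1), rho n ^ (i * (j : ℤ)) = 0 := by
  have h1 : rho n ^ i - 1 ≠ 0 := sub_ne_zero.2 (mt rho_zpow_eq_one_iff.1 hi)
  have h2 := mul_geom_sum (rho n ^ i) (2 * n + 1)
  rw [← zpow_natCast, ← zpow_mul, mul_comm i, zpow_mul, zpow_natCast, rho_pow, one_zpow,
    sub_self] at h2
  have h3 := (mul_eq_zero.1 h2).resolve_left h1
  simpa only [zpow_mul, zpow_natCast] using h3

/-- The value at `z + β_{2j} z` of the linear form occurring in iterated brackets. -/
def mixed (n : ℕ) (c : ℂ) (j : ℤ) (z : W) : ℂ :=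
  c * starRingEnd ℂ (rho n ^ (-j) * del 0 z + rho n ^ j * del 1 z) +
    starRingEnd ℂ c * (rho n ^ (-j) * del 0 z + rho n ^ j * del 1 z)

/-- Here α_{2m} = β_{2(j−m)}β_{2j}. Both π_{β_{2j}}(x,y) and z + β_{2j}z are fixed by β_{2j}, so
their normal coordinates at the other reflection share the factor ρ^{j−m}(ρ^m − ρ^{-m}). In the
bivector the phases cancel and the imaginary difference contributes minus its square. -/
lemma ReflForm.apply_apply (hc : ReflForm π c) (m j : ℤ) (x y z : W) :
    del 0 (π (beta n (2 * (j - m))) (π (beta n (2 * j)) x y) (z + wrep n (beta n (2 * j)) z)) =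
      -(rho n ^ m - rho n ^ (-m)) ^ 2 * c * rho n ^ (-m) *
        (rho n ^ j * piBivector n j x y * mixed n c j z) ∧
    del 1 (π (beta n (2 * (j - m))) (π (beta n (2 * j)) x y) (z + wrep n (beta n (2 * j)) z)) =
      -(rho n ^ m - rho n ^ (-m)) ^ 2 * c * rho n ^ m *
        (rho n ^ (-j) * piBivector n j x y * mixed n c j z) := by
  have hj := rho_zpow_mul_neg (n := n) j
  have hm := rho_zpow_mul_neg (n := n) m
  have e1 : rho n ^ (j - m) = rho n ^ j * rho n ^ (-m) := by
    rw [sub_eq_add_neg, zpow_add₀ (rho_ne_zero n)]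
  have e2 : rho n ^ (-(j - m)) = rho n ^ (-j) * rho n ^ m := by
    rw [neg_sub, sub_eq_add_neg, add_comm, zpow_add₀ (rho_ne_zero n)]
  have hz : nrm n (j - m) (z + wrep n (beta n (2 * j)) z) =
      rho n ^ j * rho n ^ (-m) * (rho n ^ m - rho n ^ (-m)) *
        (rho n ^ (-j) * del 0 z + rho n ^ j * del 1 z) := by
    rw [nrm, rho_zpow_two_mul, e1]
    simp only [del_add, del_zero_beta, del_one_beta, rho_zpow_two_mul,
      show -(2 * j) = -2 * j by ring, rho_zpow_neg_two_mul]
    linear_combination (-(del 0 z * rho n ^ m * rho n ^ (-m)) -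
      rho n ^ j * rho n ^ (-j) * (rho n ^ (-m)) ^ 2 * del 0 z) * hj +
      (-del 0 z - (rho n ^ j) ^ 2 * del 1 z) * hm
  have hu : nrm n (j - m) (π (beta n (2 * j)) x y) =
      rho n ^ j * rho n ^ (-m) * (rho n ^ m - rho n ^ (-m)) * (c * piBivector n j x y) := by
    rw [nrm, rho_zpow_two_mul, e1, (hc j x y).1, (hc j x y).2]
    linear_combination -(c * rho n ^ j * piBivector n j x y) * hm -
      rho n ^ j * (rho n ^ (-m)) ^ 2 * c * piBivector n j x y * hj
  have hD : piBivector n (j - m) (π (beta n (2 * j)) x y) (z + wrep n (beta n (2 * j)) z) =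
      -(rho n ^ m - rho n ^ (-m)) ^ 2 * (piBivector n j x y * mixed n c j z) := by
    rw [piBivector_eq, hz, hu, mixed]
    simp only [map_mul, map_sub, map_add, conj_rho_zpow, conj_piBivector, neg_neg]
    linear_combination -(rho n ^ m - rho n ^ (-m)) ^ 2 * piBivector n j x y *
      (c * (rho n ^ j * starRingEnd ℂ (del 0 z) + rho n ^ (-j) * starRingEnd ℂ (del 1 z)) +
        starRingEnd ℂ c * (rho n ^ (-j) * del 0 z + rho n ^ j * del 1 z)) *
      (rho n ^ m * rho n ^ (-m) * hj + hm)
  rw [(hc _ _ _).1, (hc _ _ _).2, hD, e1, e2]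
  constructor <;> ring

lemma not_dvd_two (hn : 1 ≤ n) : ¬ (2 * n + 1 : ℤ) ∣ 2 := fun h => by
  have := Int.le_of_dvd (by norm_num) h
  omega

lemma not_dvd_four (hn : 1 ≤ n) : ¬ (2 * n + 1 : ℤ) ∣ 4 := fun h =>
  not_dvd_two hn (IsCoprime.dvd_of_dvd_mul_left (⟨1, -n, by ring⟩ : IsCoprime (2 * n + 1 : ℤ) 2) h)

/-- As a function of j the summand has the Fourier modes 0, 2, 4 and −2. For n ≥ 1 only mode 0 is
divisible by 2n + 1 and survives. -/
lemma sum_piBivector_mixed (hn : 1 ≤ n) (x y z : W) :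
    ∑ j ∈ Finset.range (2 * n + 1), rho n ^ (j : ℤ) * piBivector n j x y * mixed n c j z =
      (2 * n + 1) * ((wedge (del 0) (delbar 0) x y + wedge (del 1) (delbar 1) x y) *
        (c * delbar 1 z + starRingEnd ℂ c * del 0 z) -
        wedge (del 0) (delbar 1) x y * (c * delbar 0 z + starRingEnd ℂ c * del 1 z)) := by
  set d := wedge (del 0) (delbar 0) x y + wedge (del 1) (delbar 1) x y with hd
  set e := wedge (del 0) (delbar 1) x y with he
  set f := wedge (del 1) (delbar 0) x y with hf
  set A := c * delbar 1 z + starRingEnd ℂ c * del 0 z with hA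
  set B := c * delbar 0 z + starRingEnd ℂ c * del 1 z with hB
  have key : ∀ j : ℤ, rho n ^ j * piBivector n j x y * mixed n c j z =
      (d * A - e * B) + (d * B - f * A) * rho n ^ (2 * j) - f * B * rho n ^ (4 * j) -
        e * A * rho n ^ (-2 * j) := fun j => by
    have hj := rho_zpow_mul_neg (n := n) j
    have e4 : rho n ^ (4 * j) = (rho n ^ j) ^ 4 := by rw [← zpow_natCast, ← zpow_mul, mul_comm]; rfl
    rw [piBivector, mixed, rho_zpow_two_mul, rho_zpow_neg_two_mul, e4]
    simp only [map_add, map_mul, conj_rho_zpow, neg_neg, hd, he, hf, hA, hB, ← delbar_eq]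
    linear_combination (d * A - (rho n ^ (-j)) ^ 2 * e * A - (rho n ^ j) ^ 2 * f * A -
      (rho n ^ j * rho n ^ (-j) + 1) * e * B) * hj
  simp only [key, Finset.sum_add_distrib, Finset.sum_sub_distrib, ← Finset.mul_sum]
  rw [sum_rho_zpow (not_dvd_two hn), sum_rho_zpow (not_dvd_four hn),
    sum_rho_zpow (by rw [dvd_neg]; exact not_dvd_two hn)]
  simp only [Finset.sum_const, Finset.card_range, nsmul_eq_mul, mul_zero, add_zero, sub_zero]
  push_cast
  ring

lemma sum_piBivector_mixed' (hn : 1 ≤ n) (x y z : W) :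
    ∑ j ∈ Finset.range (2 * n + 1), rho n ^ (-(j : ℤ)) * piBivector n j x y * mixed n c j z =
      (2 * n + 1) * ((wedge (del 0) (delbar 0) x y + wedge (del 1) (delbar 1) x y) *
        (c * delbar 0 z + starRingEnd ℂ c * del 1 z) -
        wedge (del 1) (delbar 0) x y * (c * delbar 1 z + starRingEnd ℂ c * del 0 z)) := by
  set d := wedge (del 0) (delbar 0) x y + wedge (del 1) (delbar 1) x y with hd
  set e := wedge (del 0) (delbar 1) x y with he
  set f := wedge (del 1) (delbar 0) x y with hf
  set A := c * delbar 1 z + starRingEnd ℂ c * del 0 z with hA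
  set B := c * delbar 0 z + starRingEnd ℂ c * del 1 z with hB
  have key : ∀ j : ℤ, rho n ^ (-j) * piBivector n j x y * mixed n c j z =
      (d * B - f * A) + (d * A - e * B) * rho n ^ (-2 * j) - e * A * rho n ^ (-4 * j) -
        f * B * rho n ^ (2 * j) := fun j => by
    have hj := rho_zpow_mul_neg (n := n) j
    have e4 : rho n ^ (-4 * j) = (rho n ^ (-j)) ^ 4 := by
      rw [← zpow_natCast, ← zpow_mul]; congr 1; push_cast; ring
    rw [piBivector, mixed, rho_zpow_two_mul, rho_zpow_neg_two_mul, e4]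
    simp only [map_add, map_mul, conj_rho_zpow, neg_neg, hd, he, hf, hA, hB, ← delbar_eq]
    linear_combination (d * B - (rho n ^ (-j)) ^ 2 * e * B - (rho n ^ j) ^ 2 * f * B -
      (rho n ^ j * rho n ^ (-j) + 1) * f * A) * hj
  simp only [key, Finset.sum_add_distrib, Finset.sum_sub_distrib, ← Finset.mul_sum]
  rw [sum_rho_zpow (by rw [dvd_neg]; exact not_dvd_two hn),
    sum_rho_zpow (by rw [dvd_neg]; exact not_dvd_four hn), sum_rho_zpow (not_dvd_two hn)]
  simp only [Finset.sum_const, Finset.card_range, nsmul_eq_mul, mul_zero, add_zero, sub_zero]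
  push_cast
  ring

/-- Both sides vanish at reflections and at the identity. At another rotation the left side is the
sum over pairs of reflections, with a factor (ρ^m − ρ^{-m})²; on the right one such factor comes
from `rotFactor` and one from 1 − γ. -/
theorem IsLinearPoisson.dblBracket_eq (hπ : IsLinearPoisson π) (hc : ReflForm π c) (g : Gam n)
    (x y z : W) : dblBracket π π g x y z = (2 : ℝ) • koszul g (secondOrder n c g) x y z := by
  obtain ⟨k, rfl | rfl⟩ := exists_eq_alpha_or_beta g
  swap
  · rw [hπ.dblBracket_beta_eq_zero, secondOrder_beta]
    simp [koszul]
  by_cases hk : (2 * n + 1 : ℤ) ∣ k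
  · rw [alpha_eq_one_iff.2 hk, hπ.dblBracket_one, secondOrder_eq_zero rotFactor_one]
    simp [koszul]
  -- For n = 0 the only rotation is the identity.
  have hn : 1 ≤ n := by
    by_contra h
    exact hk ⟨k, by rw [show n = 0 by omega]; simp⟩
  rw [dblBracket, sum_eq_sum_beta]
  · rw [alpha_two_mul k]
    set m : ℤ := (n + 1) * k
    have hb : ∀ j : ℤ, alpha n (2 * m) * (beta n (2 * j))⁻¹ = beta n (2 * (j - m)) := fun j => by
      rw [beta_inv, alpha_mul_beta', mul_sub]
    have hm := rho_zpow_mul_neg (n := n) m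
    have e1 : rho n ^ (-(2 * m)) = rho n ^ (-m) * rho n ^ (-m) := by
      rw [← rho_zpow_neg_two_mul]; congr 1; ring
    have h0 : ∀ X : ℂ, X - rho n ^ (-m) * rho n ^ (-m) * X =
        rho n ^ (-m) * (rho n ^ m - rho n ^ (-m)) * X := fun X => by
      linear_combination -X * hm
    have h1 : ∀ X : ℂ, X - rho n ^ m * rho n ^ m * X =
        -(rho n ^ m * (rho n ^ m - rho n ^ (-m)) * X) := fun X => by
      linear_combination -X * hm
    refine del_ext ?_ ?_
    · simp only [del_sum, del_add, hb, (hc.apply_apply _ _ _ _ _).1, ← Finset.mul_sum,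
        Finset.sum_add_distrib, sum_piBivector_mixed hn, del_smul, koszul, del_sub,
        ofReal_secondOrder, rotFactor_alpha, del_zero_alpha, e1, h0]
      simp only [wedge, delbar_eq, etaWedge, eta, map_add, map_mul, Complex.conj_conj]
      push_cast
      ring
    · simp only [del_sum, del_add, hb, (hc.apply_apply _ _ _ _ _).2, ← Finset.mul_sum,
        Finset.sum_add_distrib, sum_piBivector_mixed' hn, del_smul, koszul, del_sub,
        ofReal_secondOrder, rotFactor_alpha, del_one_alpha, rho_zpow_two_mul, h1]
      simp only [wedge, delbar_eq, etaWedge, eta, map_add, map_mul, Complex.conj_conj]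
      push_cast
      ring
  · intro l
    by_cases hl : (2 * n + 1 : ℤ) ∣ l
    · rw [alpha_eq_one_iff.2 hl, inv_one, mul_one, hπ.apply_alpha hk]
      simp
    · rw [hπ.apply_alpha hl]
      simp

end

end DihedralQuant

namespace DihedralQuant

noncomputable section

variable {n : ℕ} {π : Cochain n W} {c : ℂ}

/-! ### The bracket of the second order term with `π` -/

lemma sub_alpha_surjective {k : ℤ} (hk : ¬ (2 * n + 1 : ℤ) ∣ k) (w : W) :
    ∃ z, z - wrep n (alpha n k) z = w := by
  rw [← rho_zpow_eq_one_iff] at hk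
  have h0 : 1 - rho n ^ k ≠ 0 := sub_ne_zero.2 (Ne.symm hk)
  have h1 : 1 - rho n ^ (-k) ≠ 0 := sub_ne_zero.2 fun h => hk (by
    rwa [zpow_neg, eq_comm, inv_eq_one] at h)
  refine ⟨toW ((1 - rho n ^ (-k))⁻¹ * del 0 w) ((1 - rho n ^ k)⁻¹ * del 1 w), del_ext ?_ ?_⟩
  · rw [del_sub, del_zero_alpha, del_zero_toW]
    field_simp
  · rw [del_sub, del_one_alpha, del_one_toW]
    field_simp

/-- A `Γ_n`-invariant alternating trilinear form on `V*` vanishes. -/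
lemma eq_zero_of_invariant (hn : 1 ≤ n) (τ : W → W → W → ℝ)
    (hadd : ∀ x x' y z, τ (x + x') y z = τ x y z + τ x' y z)
    (hsmul : ∀ (r : ℝ) x y z, τ (r • x) y z = r * τ x y z)
    (hself : ∀ x z, τ x x z = 0) (hcyc : ∀ x y z, τ x y z = τ y z x)
    (hinv : ∀ x y z, τ (wrep n (alpha n 1) x) (wrep n (alpha n 1) y) (wrep n (alpha n 1) z) =
      τ x y z) (x y z : W) : τ x y z = 0 := by
  have hadd2 : ∀ x y y' z, τ x (y + y') z = τ x y z + τ x y' z := fun x y y' z => by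
    rw [hcyc, hadd, ← hcyc x, ← hcyc x]
  have hadd3 : ∀ x y z z', τ x y (z + z') = τ x y z + τ x y z' := fun x y z z' => by
    rw [← hcyc, hadd, hcyc, hcyc z']
  have hsmul2 : ∀ (r : ℝ) x y z, τ x (r • y) z = r * τ x y z := fun r x y z => by
    rw [hcyc, hsmul, ← hcyc]
  have hsmul3 : ∀ (r : ℝ) x y z, τ x y (r • z) = r * τ x y z := fun r x y z => by
    rw [← hcyc, hsmul, hcyc]
  have hswap : ∀ x y z, τ y x z = -τ x y z := fun x y z => by
    have := hself (x + y) z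
    rw [hadd, hadd2, hadd2, hself, hself] at this
    linarith
  have hk : ¬ (2 * n + 1 : ℤ) ∣ 1 := fun h => by
    have := Int.le_of_dvd (by norm_num) h
    omega
  -- On a plane that α_1 rotates, τ is the determinant of its first two arguments times an
  -- α_1-invariant linear functional of the third; such a functional vanishes because 1 − α_1 is
  -- onto.
  have hplane : ∀ (i : ℂ →ₗ[ℝ] W) (s : ℂ), s * starRingEnd ℂ s = 1 →
      (∀ a, wrep n (alpha n 1) (i a) = i (s * a)) → ∀ a b z, τ (i a) (i b) z = 0 := by
    intro i s hs hi a b z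
    have hdet : ∀ a b z, τ (i a) (i b) z = (a.re * b.im - a.im * b.re) * τ (i 1) (i Complex.I) z := by
      intro a b z
      have hd : ∀ a : ℂ, i a = a.re • i 1 + a.im • i Complex.I := fun a => by
        rw [← map_smul, ← map_smul, ← map_add]
        congr 1
        apply Complex.ext <;> simp
      rw [hd a, hd b, hadd, hadd2, hadd2, hsmul, hsmul, hsmul, hsmul, hsmul2, hsmul2, hsmul2,
        hsmul2, hself, hself, hswap (i 1) (i Complex.I)]
      ring
    have hrot : ∀ z, τ (i a) (i b) (wrep n (alpha n 1) z) = τ (i a) (i b) z := by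
      intro z
      rw [← hinv (i a) (i b) z, hi, hi, hdet a, hdet (s * a)]
      congr 1
      have h1 := congrArg Complex.re hs
      simp only [Complex.mul_re, Complex.mul_im, Complex.conj_re, Complex.conj_im,
        Complex.one_re] at h1 ⊢
      linear_combination -(a.re * b.im - a.im * b.re) * h1
    obtain ⟨w, rfl⟩ := sub_alpha_surjective hk z
    rw [sub_eq_add_neg, hadd3, ← neg_one_smul ℝ, hsmul3, hrot]
    ring
  let i0 : ℂ →ₗ[ℝ] W :=
    { toFun := fun a => toW a 0
      map_add' := fun a b => del_ext (by simp [del_add, del_zero_toW])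
        (by simp [del_add, del_one_toW])
      map_smul' := fun r a => del_ext (by simp [del_smul, del_zero_toW])
        (by simp [del_smul, del_one_toW]) }
  let i1 : ℂ →ₗ[ℝ] W :=
    { toFun := fun a => toW 0 a
      map_add' := fun a b => del_ext (by simp [del_add, del_zero_toW])
        (by simp [del_add, del_one_toW])
      map_smul' := fun r a => del_ext (by simp [del_smul, del_zero_toW])
        (by simp [del_smul, del_one_toW]) }
  have h0 : ∀ a b z, τ (i0 a) (i0 b) z = 0 := by
    refine hplane i0 (rho n ^ (-1 : ℤ)) ?_ fun a => ?_
    · rw [conj_rho_zpow, rho_zpow_mul_neg]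
    · change wrep n (alpha n 1) (toW a 0) = toW _ 0
      rw [wrep_alpha, del_zero_toW, del_one_toW, mul_zero]
  have h1 : ∀ a b z, τ (i1 a) (i1 b) z = 0 := by
    refine hplane i1 (rho n ^ (1 : ℤ)) ?_ fun a => ?_
    · rw [conj_rho_zpow, rho_zpow_mul_neg]
    · change wrep n (alpha n 1) (toW 0 a) = toW 0 _
      rw [wrep_alpha, del_zero_toW, del_one_toW, mul_zero]
  have hd : ∀ x : W, x = i0 (del 0 x) + i1 (del 1 x) := fun x => del_ext
    (by rw [del_add]; change _ = del 0 (toW _ 0) + del 0 (toW 0 _); simp [del_zero_toW])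
    (by rw [del_add]; change _ = del 1 (toW _ 0) + del 1 (toW 0 _); simp [del_one_toW])
  -- V* is the sum of two rotated planes, so among three components two lie in the same plane.
  rw [hd x, hd y, hd z]
  generalize del 0 x = a, del 1 x = a', del 0 y = b, del 1 y = b', del 0 z = d, del 1 z = d'
  simp only [hadd, hadd2, hadd3]
  rw [h0, h0, h1, h1, hcyc (i0 a) (i1 b') (i0 d), hcyc (i1 b'), h0, hcyc (i0 a) (i1 b') (i1 d'), h1,
    hcyc (i1 a') (i0 b) (i0 d), h0, hcyc (i1 a') (i0 b) (i1 d'), hcyc (i0 b), h1]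
  simp

/-- The two summands of `eta` at π_β(x,y) are |c|²ρ^m times the bivector and times its conjugate;
the bivector is imaginary, so they cancel. -/
lemma secondOrder_apply_reflection (hc : ReflForm π c) (g : Gam n) (k : ℤ) (x y z : W) :
    secondOrder n c g (π (beta n k) x y) z = 0 := by
  apply Complex.ofReal_injective
  have h : eta c (π (beta n k) x y) = 0 := by
    rw [beta_two_mul, eta, (hc _ x y).1, (hc _ x y).2]
    simp only [map_mul, conj_piBivector, conj_rho_zpow, neg_neg]
    ring
  rw [ofReal_secondOrder, etaWedge, h]
  simp

theorem dblBracket_secondOrder (hπ : IsLinearCocycle π) (hc : ReflForm π c) (g : Gam n)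
    (x y z : W) : dblBracket (secondOrder n c) π g x y z = 0 := by
  have hone : ∀ x y z, secondOrder n c g (π 1 x y) z + secondOrder n c g (π 1 y z) x +
      secondOrder n c g (π 1 z x) y = 0 := by
    intro x y z
    obtain ⟨k, rfl | rfl⟩ := exists_eq_alpha_or_beta g
    swap
    · rw [secondOrder_beta]; simp
    by_cases hk : (2 * n + 1 : ℤ) ∣ k
    · rw [alpha_eq_one_iff.2 hk, secondOrder_eq_zero rotFactor_one]; simp
    have hn : 1 ≤ n := by
      by_contra h
      exact hk ⟨k, by rw [show n = 0 by omega]; simp⟩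
    -- What remains is the contribution of π_1, an alternating trilinear form invariant under α_1.
    refine eq_zero_of_invariant hn (fun x y z => secondOrder n c (alpha n k) (π 1 x y) z +
      secondOrder n c (alpha n k) (π 1 y z) x + secondOrder n c (alpha n k) (π 1 z x) y)
      (fun x x' y z => ?_) (fun r x y z => ?_) (fun x z => ?_) (fun x y z => ?_)
      (fun x y z => ?_) x y z
    · simp only [map_add, LinearMap.add_apply]; ring
    · simp only [map_smul, LinearMap.smul_apply, smul_eq_mul]; ring
    · rw [(hπ.alt 1).self_eq_zero, ← (hπ.alt 1).neg x z, map_zero, map_neg]; simp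
    · ring
    · have h1 : ∀ x y, π 1 (wrep n (alpha n 1) x) (wrep n (alpha n 1) y) =
          wrep n (alpha n 1) (π 1 x y) := fun x y => by
        have := hπ.invariant (alpha n 1) 1 (wrep n (alpha n 1) x) (wrep n (alpha n 1) y)
        rw [← wrep_mul_apply, ← wrep_mul_apply, inv_mul_cancel, wrep_one_apply, wrep_one_apply,
          mul_one, mul_inv_cancel] at this
        exact this.symm
      have h2 : ∀ x y, secondOrder n c (alpha n k) (wrep n (alpha n 1) x) (wrep n (alpha n 1) y) =
          secondOrder n c (alpha n k) x y := fun x y => by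
        apply Complex.ofReal_injective
        rw [ofReal_secondOrder, ofReal_secondOrder, etaWedge_alpha]
      simp only [h1, h2]
  rw [dblBracket, Fintype.sum_eq_single 1]
  · simp only [inv_one, mul_one, wrep_one_apply, map_add]
    linear_combination 2 * hone x y z
  · intro h hh
    obtain ⟨k, rfl | rfl⟩ := exists_eq_alpha_or_beta h
    · rw [hπ.apply_alpha (mt alpha_eq_one_iff.2 hh)]
      simp
    · simp only [secondOrder_apply_reflection hc, add_zero]

/-! ### Rigidity and nonvanishing at the rotations -/

/-- The Koszul differential is injective at the nontrivial rotations. -/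
lemma eq_zero_of_koszul {k : ℤ} (hk : ¬ (2 * n + 1 : ℤ) ∣ k) {b : W →ₗ[ℝ] W →ₗ[ℝ] ℝ}
    (hb : ∀ x y z, koszul (alpha n k) b x y z = 0) : b = 0 := by
  refine LinearMap.ext fun x => LinearMap.ext fun y => ?_
  by_contra hne
  change b x y ≠ 0 at hne
  set u := x - wrep n (alpha n k) x
  set v := y - wrep n (alpha n k) y
  -- If b(x,y) ≠ 0, the equation expresses each (1 − γ)z, hence each vector of V*, through the two
  -- vectors `u` and `v`; but V* has dimension 4.
  have htop : Submodule.span ℝ {u, v} = ⊤ := by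
    rw [eq_top_iff]
    intro w _
    obtain ⟨z, rfl⟩ := sub_alpha_surjective hk w
    have h := hb x y z
    rw [koszul] at h
    rw [Submodule.mem_span_pair]
    refine ⟨-(b x y)⁻¹ * b y z, (b x y)⁻¹ * b x z, ?_⟩
    refine smul_right_injective W hne ?_
    simp only [smul_add, smul_smul]
    rw [← sub_eq_zero, ← neg_eq_zero, ← h]
    rw [show b x y * (-(b x y)⁻¹ * b y z) = -b y z by field_simp,
      show b x y * ((b x y)⁻¹ * b x z) = b x z by field_simp]
    module
  have h1 : Module.finrank ℝ W = 4 := by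
    rw [Subspace.dual_finrank_eq, Module.finrank_pi_fintype]
    simp [Complex.finrank_real_complex]
  classical
  have h2 := finrank_span_finset_le_card (R := ℝ) ({u, v} : Finset W)
  have h3 : ({u, v} : Finset W).card ≤ 2 := Finset.card_le_two
  rw [Finset.coe_pair, Set.finrank, htop, finrank_top, h1] at h2
  omega

lemma koszul_sub (g : Gam n) (b b' : W →ₗ[ℝ] W →ₗ[ℝ] ℝ) (x y z : W) :
    koszul g (b - b') x y z = koszul g b x y z - koszul g b' x y z := by
  simp only [koszul, LinearMap.sub_apply]
  module

lemma secondOrder_alpha_ne_zero (hc : c ≠ 0) {k : ℤ} (hk : ¬ (2 * n + 1 : ℤ) ∣ k) :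
    secondOrder n c (alpha n k) ≠ 0 := by
  intro h
  have h1 := ofReal_secondOrder (c := c) (alpha n k) (toW 1 0) (toW Complex.I 0)
  rw [h, alpha_two_mul, rotFactor_alpha] at h1
  set m : ℤ := (n + 1) * k with hm
  -- Otherwise ρ^{2m} = 1, while 2m ≡ k modulo 2n + 1.
  have hs : rho n ^ m - rho n ^ (-m) ≠ 0 := by
    intro h0
    refine hk ?_
    have h2 : rho n ^ (2 * m) = 1 := by
      rw [rho_zpow_two_mul]
      linear_combination rho n ^ m * h0 + rho_zpow_mul_neg (n := n) m
    rw [rho_zpow_eq_one_iff, hm] at h2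
    have h3 : 2 * ((n + 1 : ℤ) * k) = k + (2 * n + 1) * k := by ring
    rw [h3] at h2
    exact (dvd_add_left (Dvd.intro _ rfl)).1 h2
  have h2 : etaWedge c (toW 1 0) (toW Complex.I 0) = -2 * Complex.I * (c * starRingEnd ℂ c) := by
    simp only [etaWedge, eta, del_zero_toW, del_one_toW, map_zero, mul_zero, add_zero, mul_one,
      map_mul, Complex.conj_conj, Complex.conj_I]
    ring
  have h3 : (2 * n + 1 : ℂ) ≠ 0 := by exact_mod_cast (by omega : 2 * n + 1 ≠ 0)
  have h4 : starRingEnd ℂ c ≠ 0 := (map_ne_zero _).2 hc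
  rw [h2] at h1
  refine mul_ne_zero (mul_ne_zero h3 hs) (mul_ne_zero (mul_ne_zero (neg_ne_zero.2 two_ne_zero)
    Complex.I_ne_zero) (mul_ne_zero hc h4)) (h1.symm.trans ?_)
  simp

lemma ReflForm.ne_zero (hc : ReflForm π c) {k : ℤ} (hk : π (beta n k) ≠ 0) : c ≠ 0 := by
  rintro rfl
  refine hk (LinearMap.ext fun x => LinearMap.ext fun y => ?_)
  rw [beta_two_mul]
  refine del_ext ?_ ?_
  · rw [(hc _ x y).1]; simp [del_zero]
  · rw [(hc _ x y).2]; simp [del_zero]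

theorem IsLinearPoisson.pbwCondition (hπ : IsLinearPoisson π) (hc : ReflForm π c) :
    PBWCondition π (secondOrder n c) where
  alt_left := hπ.alt
  alt_right := secondOrder_isAlt
  inv_left := hπ.invariant
  inv_right := secondOrder_invariant
  symm := hπ.symmCondition hc
  dbl_left := hπ.dblBracket_eq hc
  dbl_right := dblBracket_secondOrder hπ.toIsLinearCocycle hc

end

end DihedralQuant

/-! ### Assembling the proposition -/

theorem mainTheorem6 (n : ℕ) (π : DihedralQuant.Cochain n DihedralQuant.W)
    (hπ : DihedralQuant.IsLinearPoisson π) :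
    ∃ (c : ℂ) (B : DihedralQuant.Cochain n ℝ),
      -- the components of `π` at the reflections
      (∀ (k : ℤ) (x y : DihedralQuant.W) (v : DihedralQuant.V),
        ((π (DihedralQuant.beta n (2 * k)) x y v : ℝ) : ℂ) =
          DihedralQuant.piFun n c k v * DihedralQuant.piBivector n k x y) ∧
      -- the explicit second order term
      (∀ g, (B g).IsAlt) ∧
      (∀ g h x y, B h (DihedralQuant.wrep n g⁻¹ x) (DihedralQuant.wrep n g⁻¹ y) =
        B (g * h * g⁻¹) x y) ∧
      (∀ k : ℤ, B (DihedralQuant.beta n k) = 0) ∧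
      (∀ (k : ℤ) (x y : DihedralQuant.W),
        ((B (DihedralQuant.alpha n (2 * k)) x y : ℝ) : ℂ) =
          DihedralQuant.BBivector n c k x y) ∧
      -- the double bracket of `π` with itself is a coboundary
      (∀ g x y z, DihedralQuant.dblBracket π π g x y z =
        (2 : ℝ) • DihedralQuant.koszul g (B g) x y z) ∧
      -- the algebra `H` has the PBW property and is a deformation quantization along `π`
      (∃ D : DihedralQuant.FormalDeformation (DihedralQuant.SCross n),
        D.Quantizes π ∧
        ∃ e : DihedralQuant.H π B ≃+ PowerSeries (DihedralQuant.SCross n),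
          DihedralQuant.IsPBWIso e ∧ ∀ u w, e (u * w) = D.star (e u) (e w)) ∧
      -- the second order terms at the rotations are forced, and nonzero
      (∀ b : DihedralQuant.Cochain n ℝ, (∀ g, (b g).IsAlt) → DihedralQuant.HasPBW π b →
        ∀ k : ℤ, ¬ ((2 * n + 1 : ℤ) ∣ k) →
          b (DihedralQuant.alpha n k) = B (DihedralQuant.alpha n k)) ∧
      ((∃ k : ℤ, π (DihedralQuant.beta n k) ≠ 0) → ∀ k : ℤ, ¬ ((2 * n + 1 : ℤ) ∣ k) →
        B (DihedralQuant.alpha n k) ≠ 0 ∧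
        ∃ x y z, DihedralQuant.dblBracket π π (DihedralQuant.alpha n k) x y z ≠ 0) := by
  obtain ⟨c, hc⟩ := hπ.exists_reflForm
  have hPBW := hπ.pbwCondition hc
  refine ⟨c, DihedralQuant.secondOrder n c, hc.ofReal_apply, hPBW.alt_right, hPBW.inv_right,
    DihedralQuant.secondOrder_beta, DihedralQuant.secondOrder_alpha, hPBW.dbl_left,
    hPBW.exists_quantization, fun b hb hH k hk => ?_, fun ⟨j, hj⟩ k hk => ?_⟩
  -- Both second order terms have ½⟦π,π⟧ as Koszul differential, so their difference is closed and
  -- vanishes by injectivity.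
  · refine sub_eq_zero.1 (DihedralQuant.eq_zero_of_koszul hk fun x y z => ?_)
    have h1 := hH.dblBracket_eq hb hPBW.symm (DihedralQuant.alpha n k) x y z
    rw [hPBW.dbl_left] at h1
    rw [DihedralQuant.koszul_sub, sub_eq_zero]
    exact (smul_right_injective DihedralQuant.W (two_ne_zero (α := ℝ)) h1).symm
  · have hB := DihedralQuant.secondOrder_alpha_ne_zero (hc.ne_zero hj) hk
    refine ⟨hB, ?_⟩
    by_contra! h
    -- A vanishing bracket would make B closed at this rotation, hence zero.
    refine hB (DihedralQuant.eq_zero_of_koszul hk fun x y z => ?_)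
    have h1 := h x y z
    rw [hPBW.dbl_left] at h1
    exact (smul_eq_zero.1 h1).resolve_left two_ne_zero
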